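/- \textbf{Corollary (Biadjoint Triangle).} Conventions: $\mathrm{Cat}$ is the $2$-category of (small) categories, all $2$-categories have hom-categories in $\mathrm{Cat}$, and $[\mathcal S,\mathrm{Cat}]_{PS}$ denotes the $2$-category of pseudofunctors $\mathcal S\to\mathrm{Cat}$, pseudonatural transformations and modifications. For a small $2$-category $\mathcal S$ and a pseudofunctor $\mathcal W:\mathcal S\to\mathrm{Cat}$: the weighted bilimit of $\mathcal D:\mathcal S\to\mathcal K$ is an object $\{\mathcal W,\mathcal D\}_{bi}$ with an equivalence $\mathcal K(X,\{\mathcal W,\mathcal D\}_{bi})\simeq[\mathcal S,\mathrm{Cat}]_{PS}(\mathcal W,\mathcal K(X,\mathcal D-))$ pseudonatural in $X$; the weighted bicolimit of $\mathcal A:\mathcal S^{op}\to\mathcal K$ is an object $\mathcal W *_{bi}\mathcal A$ with an equivalence $\mathcal K(\mathcal W *_{bi}\mathcal A,X)\simeq[\mathcal S,\mathrm{Cat}]_{PS}(\mathcal W,\mathcal K(\mathcal A-,X))$ pseudonatural in $X$. A pseudofunctor $R:\mathcal A\to\mathcal B$ is right biadjoint to $E:\mathcal B\to\mathcal A$ if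 there are pseudonatural transformations $\rho:\mathrm{Id}\to RE$, $\varepsilon:ER\to\mathrm{Id}$ and invertible modifications $\mathrm{id}_E\Rightarrow(\varepsilon E)(E\rho)$, $(R\varepsilon)(\rho R)\Rightarrow\mathrm{id}_R$ satisfying the two coherence (swallowtail) axioms; it is right biadjoint if such an $E$ exists. Let $\mathcal S$ be a small $2$-category, $\mathcal W:\mathcal S\to\mathrm{Cat}$ a pseudofunctor, and let $\mathcal A,\mathcal B,\mathcal C,\mathcal C'$ be $2$-categories. Let $R:\mathcal A\to\mathcal B$, $J:\mathcal A\to\mathcal C'$, $U:\mathcal C'\to\mathcal B$ and $V:\mathcal C'\to\mathcal C$ be pseudofunctors such that $R$ is right biadjoint and $U\circ J=R$. Suppose that for each object $y$ of $\mathcal C$ there is given a pseudofunctor $\mathcal D_y:\mathcal S\times\mathcal C'\to\mathrm{Cat}$ such that: \begin{itemize} \item the restriction $|\mathcal D_y|$ of $\mathcal D_y$ to $\mathcal S_0\times\mathcal C'$, where $\mathcal S_0$ is the discrete $2$-category of objects of $\mathcal S$, factorizes through $U^*:=\mathcal B(-,U-):\mathcal B^{op}\times\mathcal C'\to\mathrm{Cat}$;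 that is, there are a pseudofunctor $\mathcal D_y':\mathcal S_0\to\mathcal B^{op}$ and a pseudonatural equivalence $|\mathcal D_y|\simeq U^*\circ(\mathcal D_y'\times\mathrm{Id}_{\mathcal C'})$; \item $\{\mathcal W,\mathcal D_y(-,x)\}_{bi}\simeq\mathcal C(y,Vx)$ in $\mathrm{Cat}$, pseudonaturally in $x\in\mathcal C'$; that is, there are equivalences $\mathrm{Cat}(X,\mathcal C(y,Vx))\simeq[\mathcal S,\mathrm{Cat}]_{PS}(\mathcal W,\mathrm{Cat}(X,\mathcal D_y(-,x)))$ pseudonatural in $X\in\mathrm{Cat}$ and $x\in\mathcal C'$. \end{itemize} Then for each object $y$ of $\mathcal C$ there is a pseudofunctor $\mathcal A_y:\mathcal S^{op}\to\mathcal A$ with a pseudonatural equivalence $\mathcal D_y(-,J-)\simeq\mathcal A(\mathcal A_y-,-)$ of pseudofunctors $\mathcal S\times\mathcal A\to\mathrm{Cat}$. Moreover, for any such family $(\mathcal A_y)_y$, the pseudofunctor $V\circ J$ is right biadjoint if and only if for every object $y$ of $\mathcal C$ the weighted bicolimit $\mathcal W *_{bi}\mathcal A_y$ exists in $\mathcal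 A$. In this case $V\circ J$ is right biadjoint to $G$, defined by $Gy=\mathcal W *_{bi}\mathcal A_y$: for every choice of the weighted bicolimits there is a pseudofunctor $G:\mathcal C\to\mathcal A$ with the chosen values on objects which is left biadjoint to $V\circ J$. -/

import Mathlib

open CategoryTheory Bicategory Opposite
open scoped CategoryTheory.Pseudofunctor.StrongTrans

universe w w₁ w₂ w₃ w₄ v v₁ v₂ v₃ v₄ u u₁ u₂ u₃ u₄

/-!
Bicategories `B` with `Bicategory.Strict B` are 2-categories; `B ⥤ᵖ C` is the type of
pseudofunctors, and (with the scoped instances opened above) it is itself a bicategory, with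
pseudonatural transformations as 1-cells and modifications as 2-cells.  Composition is written in
diagrammatic order: `F.comp G` is `G ∘ F`.
-/

namespace BiTri

section Basic

variable {B : Type u₁} [Bicategory.{w₁, v₁} B] {B' : Type u₂} [Bicategory.{w₂, v₂} B']
  {C : Type u₃} [Bicategory.{w₃, v₃} C] {C' : Type u₄} [Bicategory.{w₄, v₄} C']

/-- The product `F × G` of two pseudofunctors. -/
def prodPF (F : B ⥤ᵖ B') (G : C ⥤ᵖ C') : (B × C) ⥤ᵖ (B' × C') where
  obj X := (F.obj X.1, G.obj X.2)
  map f := (F.map f.1, G.map f.2)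
  map₂ η := (F.map₂ η.1, G.map₂ η.2)
  mapId X := Iso.prod (F.mapId X.1) (G.mapId X.2)
  mapComp f g := Iso.prod (F.mapComp f.1 g.1) (G.mapComp f.2 g.2)

/-- A pseudofunctor `F : Bᵒᵖ → C` regarded as a pseudofunctor `Fᵒᵖ : B → Cᵒᵖ`. -/
def leftOpPF (F : Bᵒᵖ ⥤ᵖ C) : B ⥤ᵖ Cᵒᵖ where
  obj X := op (F.obj (op X))
  map f := (F.map f.op).op
  map₂ η := Bicategory.Opposite.op2 (F.map₂ (Bicategory.Opposite.op2 η))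
  mapId X := (F.mapId (op X)).op2
  mapComp f g := (F.mapComp g.op f.op).op2
  map₂_associator f g h := by
    have := F.map₂_associator h.op g.op f.op
    have h2 : F.map₂ (α_ h.op g.op f.op).inv = _ := (F.map₂Iso_inv _).symm.trans
      (congrArg Iso.inv (Iso.ext (F.map₂_associator h.op g.op f.op) : F.map₂Iso (α_ h.op g.op f.op) =
        F.mapComp (h.op ≫ g.op) f.op ≪≫ whiskerRightIso (F.mapComp h.op g.op) (F.map f.op) ≪≫
          α_ _ _ _ ≪≫ whiskerLeftIso (F.map h.op) (F.mapComp g.op f.op).symm ≪≫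
          (F.mapComp h.op (g.op ≫ f.op)).symm))
    refine (congrArg Bicategory.Opposite.op2 h2).trans ?_
    apply congrArg Bicategory.Opposite.Hom2.op2'
    simp

end Basic

/-- The inclusion `S₀ → S` of the discrete 2-category `S₀` of objects of `S`. -/
def discIncl (S : Type u) [Bicategory.{w, v} S] : LocallyDiscrete (Discrete S) ⥤ᵖ S :=
  pseudofunctorOfIsLocallyDiscrete (fun s => s.as.as)
    (fun f => eqToHom (Discrete.eq_of_hom f.as))
    (fun _ => Iso.refl _)
    (fun f g => (eqToHomTransIso (Discrete.eq_of_hom f.as) (Discrete.eq_of_hom g.as)))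
    (by rintro ⟨⟨a⟩⟩ ⟨⟨b⟩⟩ ⟨⟨c⟩⟩ ⟨⟨d⟩⟩ ⟨⟨⟨e⟩⟩⟩ ⟨⟨⟨e'⟩⟩⟩ ⟨⟨⟨e''⟩⟩⟩
        cases e
        cases e'
        cases e''
        simp
        rfl)
    (by rintro ⟨⟨a⟩⟩ ⟨⟨b⟩⟩ ⟨⟨⟨e⟩⟩⟩
        cases e
        simp
        rfl)
    (by rintro ⟨⟨a⟩⟩ ⟨⟨b⟩⟩ ⟨⟨⟨e⟩⟩⟩
        cases e
        simp
        rfl)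

/-- The symmetry `S × (X × E) → X × (S × E)`. -/
def shuffle (S : Type u₁) [Bicategory.{w₁, v₁} S] (X : Type u₂) [Bicategory.{w₂, v₂} X]
    (E : Type u₃) [Bicategory.{w₃, v₃} E] : (S × (X × E)) ⥤ᵖ (X × (S × E)) where
  obj p := (p.2.1, (p.1, p.2.2))
  map f := (f.2.1, (f.1, f.2.2))
  map₂ η := (η.2.1, (η.1, η.2.2))
  mapId _ := Iso.refl _
  mapComp _ _ := Iso.refl _

/-- The covariant representable pseudofunctor `K(X, -) : K → Cat`. -/
def homFrom {K : Type u} [Bicategory.{w, v} K] (X : K) : K ⥤ᵖ Cat.{w, v} where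
  obj Y := Cat.of (X ⟶ Y)
  map g := (postcomp X g).toCatHom
  map₂ η := NatTrans.toCatHom₂ ((postcomposing X _ _).map η)
  mapId Y := Cat.Hom.isoMk (NatIso.ofComponents (fun h => ρ_ h) (by
    intro h k θ
    change θ ▷ 𝟙 Y ≫ (ρ_ k).hom = (ρ_ h).hom ≫ θ
    simp))
  mapComp {a b c} f g := Cat.Hom.isoMk (NatIso.ofComponents (fun h => (α_ h f g).symm) (by
    intro h k θ
    change θ ▷ (f ≫ g) ≫ (α_ k f g).inv = (α_ h f g).inv ≫ (θ ▷ f) ▷ g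
    simp))
  map₂_id {a b} f := by
    refine Cat.Hom₂.ext (NatTrans.ext (funext fun (x : X ⟶ a) => ?_))
    exact whiskerLeft_id _ _
  map₂_comp {a b f g k} η θ := by
    refine Cat.Hom₂.ext (NatTrans.ext (funext fun (x : X ⟶ a) => ?_))
    exact whiskerLeft_comp _ _ _
  map₂_whisker_left {a b c} f {g h} η := by
    refine Cat.Hom₂.ext (NatTrans.ext (funext fun (x : X ⟶ a) => ?_))
    change x ◁ f ◁ η = (α_ x f g).inv ≫ ((x ≫ f) ◁ η) ≫ (α_ x f h).hom
    simp
  map₂_whisker_right {a b c f g} η h := by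
    refine Cat.Hom₂.ext (NatTrans.ext (funext fun (x : X ⟶ a) => ?_))
    change x ◁ η ▷ h = (α_ x f h).inv ≫ ((x ◁ η) ▷ h) ≫ (α_ x g h).hom
    simp
  map₂_associator {a b c d} f g h := by
    refine Cat.Hom₂.ext (NatTrans.ext (funext fun (x : X ⟶ a) => ?_))
    change x ◁ (α_ f g h).hom = (α_ x (f ≫ g) h).inv ≫ (α_ x f g).inv ▷ h ≫
      𝟙 _ ≫ (α_ (x ≫ f) g h).hom ≫ (α_ x f (g ≫ h)).hom
    simp
  map₂_left_unitor {a b} f := by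
    refine Cat.Hom₂.ext (NatTrans.ext (funext fun (x : X ⟶ a) => ?_))
    change x ◁ (λ_ f).hom = (α_ x (𝟙 a) f).inv ≫ (ρ_ x).hom ▷ f ≫ 𝟙 _
    simp
  map₂_right_unitor {a b} f := by
    refine Cat.Hom₂.ext (NatTrans.ext (funext fun (x : X ⟶ a) => ?_))
    change x ◁ (ρ_ f).hom = (α_ x f (𝟙 b)).inv ≫ (ρ_ (x ≫ f)).hom ≫ 𝟙 _
    simp

/-- The hom pseudofunctor `K(-, -) : Kᵒᵖ × K → Cat`; a pair `(f, g)` acts by `h ↦ f ≫ h ≫ g`. -/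
def homPF (K : Type u) [Bicategory.{w, v} K] : (Kᵒᵖ × K) ⥤ᵖ Cat.{w, v} where
  obj p := Cat.of (p.1.unop ⟶ p.2)
  map {p q} f := Functor.toCatHom
    { obj := fun h => f.1.unop ≫ h ≫ f.2
      map := fun η => f.1.unop ◁ η ▷ f.2
      map_id := by intros; simp
      map_comp := by intros; simp }
  map₂ {p q f g} η := NatTrans.toCatHom₂
    { app := fun h => η.1.unop2 ▷ (h ≫ f.2) ≫ g.1.unop ◁ h ◁ η.2
      naturality := fun h k θ => by
        change (f.1.unop ◁ θ ▷ f.2) ≫ (η.1.unop2 ▷ (k ≫ f.2) ≫ g.1.unop ◁ k ◁ η.2) =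
          (η.1.unop2 ▷ (h ≫ f.2) ≫ g.1.unop ◁ h ◁ η.2) ≫ g.1.unop ◁ θ ▷ g.2
        rw [whisker_exchange_assoc, Category.assoc, ← whiskerLeft_comp, ← whiskerLeft_comp,
          whisker_exchange] }
  mapId p := Cat.Hom.isoMk (NatIso.ofComponents (fun h => λ_ _ ≪≫ ρ_ h) (by
    intro h k θ
    change (𝟙 p.1.unop ◁ θ ▷ 𝟙 p.2) ≫ (λ_ _).hom ≫ (ρ_ _).hom = ((λ_ _).hom ≫ (ρ_ _).hom) ≫ θ
    rw [leftUnitor_naturality_assoc, rightUnitor_naturality, Category.assoc]))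
  mapComp {p q r} f g := Cat.Hom.isoMk (NatIso.ofComponents (fun h =>
      (α_ g.1.unop f.1.unop (h ≫ f.2 ≫ g.2)) ≪≫
        whiskerLeftIso g.1.unop (whiskerLeftIso f.1.unop (α_ h f.2 g.2).symm ≪≫
          (α_ f.1.unop (h ≫ f.2) g.2).symm)) (by
    intro h k θ
    change ((g.1.unop ≫ f.1.unop) ◁ θ ▷ (f.2 ≫ g.2)) ≫ (α_ g.1.unop f.1.unop (k ≫ f.2 ≫ g.2)).hom ≫
        g.1.unop ◁ (f.1.unop ◁ (α_ k f.2 g.2).inv ≫ (α_ f.1.unop (k ≫ f.2) g.2).inv) =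
      ((α_ g.1.unop f.1.unop (h ≫ f.2 ≫ g.2)).hom ≫
        g.1.unop ◁ (f.1.unop ◁ (α_ h f.2 g.2).inv ≫ (α_ f.1.unop (h ≫ f.2) g.2).inv)) ≫
          g.1.unop ◁ (f.1.unop ◁ θ ▷ f.2) ▷ g.2
    simp))
  map₂_id {p q} f := by
    refine Cat.Hom₂.ext (NatTrans.ext (funext fun (h : p.1.unop ⟶ p.2) => ?_))
    change (𝟙 f.1.unop) ▷ (h ≫ f.2) ≫ f.1.unop ◁ h ◁ (𝟙 f.2) = 𝟙 _
    simp
  map₂_comp {p q f g k} η θ := by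
    refine Cat.Hom₂.ext (NatTrans.ext (funext fun (h : p.1.unop ⟶ p.2) => ?_))
    change (η.1.unop2 ≫ θ.1.unop2) ▷ (h ≫ f.2) ≫ k.1.unop ◁ h ◁ (η.2 ≫ θ.2) =
      (η.1.unop2 ▷ (h ≫ f.2) ≫ g.1.unop ◁ h ◁ η.2) ≫
        (θ.1.unop2 ▷ (h ≫ g.2) ≫ k.1.unop ◁ h ◁ θ.2)
    simp only [comp_whiskerRight, whiskerLeft_comp, Category.assoc]
    rw [whisker_exchange_assoc]
  map₂_whisker_left {p q r} f g k η := by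
    refine Cat.Hom₂.ext (NatTrans.ext (funext fun (h : p.1.unop ⟶ p.2) => ?_))
    change (η.1.unop2 ▷ f.1.unop) ▷ (h ≫ f.2 ≫ g.2) ≫ (k.1.unop ≫ f.1.unop) ◁ h ◁ f.2 ◁ η.2 =
      ((α_ g.1.unop f.1.unop (h ≫ f.2 ≫ g.2)).hom ≫
        g.1.unop ◁ (f.1.unop ◁ (α_ h f.2 g.2).inv ≫ (α_ f.1.unop (h ≫ f.2) g.2).inv)) ≫
      (η.1.unop2 ▷ ((f.1.unop ≫ h ≫ f.2) ≫ g.2) ≫ k.1.unop ◁ (f.1.unop ≫ h ≫ f.2) ◁ η.2) ≫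
      (k.1.unop ◁ ((α_ f.1.unop (h ≫ f.2) k.2).hom ≫ f.1.unop ◁ (α_ h f.2 k.2).hom) ≫
        (α_ k.1.unop f.1.unop (h ≫ f.2 ≫ k.2)).inv)
    bicategory
  map₂_whisker_right {p q r f g} η k := by
    refine Cat.Hom₂.ext (NatTrans.ext (funext fun (h : p.1.unop ⟶ p.2) => ?_))
    change (k.1.unop ◁ η.1.unop2) ▷ (h ≫ f.2 ≫ k.2) ≫ (k.1.unop ≫ g.1.unop) ◁ h ◁ η.2 ▷ k.2 =
      ((α_ k.1.unop f.1.unop (h ≫ f.2 ≫ k.2)).hom ≫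
        k.1.unop ◁ (f.1.unop ◁ (α_ h f.2 k.2).inv ≫ (α_ f.1.unop (h ≫ f.2) k.2).inv)) ≫
      (k.1.unop ◁ (η.1.unop2 ▷ (h ≫ f.2) ≫ g.1.unop ◁ h ◁ η.2) ▷ k.2) ≫
      (k.1.unop ◁ ((α_ g.1.unop (h ≫ g.2) k.2).hom ≫ g.1.unop ◁ (α_ h g.2 k.2).hom) ≫
        (α_ k.1.unop g.1.unop (h ≫ g.2 ≫ k.2)).inv)
    bicategory
  map₂_associator {p q r s} f g k := by
    refine Cat.Hom₂.ext (NatTrans.ext (funext fun (h : p.1.unop ⟶ p.2) => ?_))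
    change (α_ k.1.unop g.1.unop f.1.unop).inv ▷ (h ≫ (f.2 ≫ g.2) ≫ k.2) ≫
        ((k.1.unop ≫ g.1.unop) ≫ f.1.unop) ◁ h ◁ (α_ f.2 g.2 k.2).hom =
      ((α_ k.1.unop (g.1.unop ≫ f.1.unop) (h ≫ (f.2 ≫ g.2) ≫ k.2)).hom ≫
        k.1.unop ◁ ((g.1.unop ≫ f.1.unop) ◁ (α_ h (f.2 ≫ g.2) k.2).inv ≫
          (α_ (g.1.unop ≫ f.1.unop) (h ≫ f.2 ≫ g.2) k.2).inv)) ≫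
      (k.1.unop ◁ ((α_ g.1.unop f.1.unop (h ≫ f.2 ≫ g.2)).hom ≫
        g.1.unop ◁ (f.1.unop ◁ (α_ h f.2 g.2).inv ≫ (α_ f.1.unop (h ≫ f.2) g.2).inv)) ▷ k.2) ≫
      𝟙 _ ≫
      (k.1.unop ◁ ((α_ g.1.unop ((f.1.unop ≫ h ≫ f.2) ≫ g.2) k.2).hom ≫
         g.1.unop ◁ (α_ (f.1.unop ≫ h ≫ f.2) g.2 k.2).hom) ≫
        (α_ k.1.unop g.1.unop ((f.1.unop ≫ h ≫ f.2) ≫ g.2 ≫ k.2)).inv) ≫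
      ((k.1.unop ≫ g.1.unop) ◁ ((α_ f.1.unop (h ≫ f.2) (g.2 ≫ k.2)).hom ≫
         f.1.unop ◁ (α_ h f.2 (g.2 ≫ k.2)).hom) ≫
        (α_ (k.1.unop ≫ g.1.unop) f.1.unop (h ≫ f.2 ≫ g.2 ≫ k.2)).inv)
    rw [Category.id_comp]
    bicategory
  map₂_left_unitor {p q} f := by
    refine Cat.Hom₂.ext (NatTrans.ext (funext fun (h : p.1.unop ⟶ p.2) => ?_))
    change (ρ_ f.1.unop).hom ▷ (h ≫ 𝟙 p.2 ≫ f.2) ≫ f.1.unop ◁ h ◁ (λ_ f.2).hom =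
      ((α_ f.1.unop (𝟙 p.1.unop) (h ≫ 𝟙 p.2 ≫ f.2)).hom ≫
        f.1.unop ◁ (𝟙 p.1.unop ◁ (α_ h (𝟙 p.2) f.2).inv ≫ (α_ (𝟙 p.1.unop) (h ≫ 𝟙 p.2) f.2).inv)) ≫
      (f.1.unop ◁ ((λ_ (h ≫ 𝟙 p.2)).hom ≫ (ρ_ h).hom) ▷ f.2) ≫ 𝟙 _
    rw [Category.comp_id]
    bicategory
  map₂_right_unitor {p q} f := by
    refine Cat.Hom₂.ext (NatTrans.ext (funext fun (h : p.1.unop ⟶ p.2) => ?_))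
    change (λ_ f.1.unop).hom ▷ (h ≫ f.2 ≫ 𝟙 q.2) ≫ f.1.unop ◁ h ◁ (ρ_ f.2).hom =
      ((α_ (𝟙 q.1.unop) f.1.unop (h ≫ f.2 ≫ 𝟙 q.2)).hom ≫
        𝟙 q.1.unop ◁ (f.1.unop ◁ (α_ h f.2 (𝟙 q.2)).inv ≫ (α_ f.1.unop (h ≫ f.2) (𝟙 q.2)).inv)) ≫
      ((λ_ ((f.1.unop ≫ h ≫ f.2) ≫ 𝟙 q.2)).hom ≫ (ρ_ (f.1.unop ≫ h ≫ f.2)).hom) ≫ 𝟙 _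
    rw [Category.comp_id]
    bicategory

section Postcomposition

variable {S : Type u₁} [Bicategory.{w₁, v₁} S] {X : Type u₂} [Bicategory.{w₂, v₂} X]
  {K : Type u₃} [Bicategory.{w₃, v₃} K]

theorem map₂_ρ_inv (D : X ⥤ᵖ K) {a b : X} (f : a ⟶ b) :
    D.map₂ (ρ_ f).inv = (ρ_ (D.map f)).inv ≫ D.map f ◁ (D.mapId b).inv ≫
      (D.mapComp f (𝟙 b)).inv := by
  rw [← cancel_epi (D.map₂ (ρ_ f).hom), ← D.map₂_comp]
  simp

theorem map₂_α_inv (D : X ⥤ᵖ K) {a b c d : X} (f : a ⟶ b) (g : b ⟶ c) (h : c ⟶ d) :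
    D.map₂ (α_ f g h).inv = (D.mapComp f (g ≫ h)).hom ≫ D.map f ◁ (D.mapComp g h).hom ≫
      (α_ (D.map f) (D.map g) (D.map h)).inv ≫ (D.mapComp f g).inv ▷ D.map h ≫
      (D.mapComp (f ≫ g) h).inv := by
  rw [← cancel_epi (D.map₂ (α_ f g h).hom), ← D.map₂_comp]
  simp

/-- The whiskering `Dτ : DF ⟶ DG` of a pseudonatural transformation `τ : F ⟶ G` with a
pseudofunctor `D`. -/
def whiskerRightST {F G : S ⥤ᵖ X} (τ : F ⟶ G) (D : X ⥤ᵖ K) : F.comp D ⟶ G.comp D where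
  app a := D.map (τ.app a)
  naturality {a b} f := (D.mapComp (F.map f) (τ.app b)).symm ≪≫ D.map₂Iso (τ.naturality f) ≪≫
    D.mapComp (τ.app a) (G.map f)
  naturality_naturality {a b f g} η := by
    have h := congrArg D.map₂ (τ.naturality_naturality η)
    simp only [D.map₂_comp, D.map₂_whisker_right, D.map₂_whisker_left, Category.assoc] at h
    change D.map₂ (F.map₂ η) ▷ D.map (τ.app b) ≫ (D.mapComp (F.map g) (τ.app b)).inv ≫
        D.map₂ (τ.naturality g).hom ≫ (D.mapComp (τ.app a) (G.map g)).hom =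
      ((D.mapComp (F.map f) (τ.app b)).inv ≫ D.map₂ (τ.naturality f).hom ≫
        (D.mapComp (τ.app a) (G.map f)).hom) ≫ D.map (τ.app a) ◁ D.map₂ (G.map₂ η)
    rw [← cancel_epi (D.mapComp (F.map f) (τ.app b)).hom, reassoc_of% h]
    simp
  naturality_id a := by
    have h := congrArg D.map₂ (τ.naturality_id a)
    simp only [D.map₂_comp, D.map₂_whisker_right, D.map₂_whisker_left, D.map₂_left_unitor,
      map₂_ρ_inv, Category.assoc] at h
    change ((D.mapComp (F.map (𝟙 a)) (τ.app a)).inv ≫ D.map₂ (τ.naturality (𝟙 a)).hom ≫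
        (D.mapComp (τ.app a) (G.map (𝟙 a))).hom) ≫
        D.map (τ.app a) ◁ (D.map₂ (G.mapId a).hom ≫ (D.mapId (G.obj a)).hom) =
      (D.map₂ (F.mapId a).hom ≫ (D.mapId (F.obj a)).hom) ▷ D.map (τ.app a) ≫
        (λ_ (D.map (τ.app a))).hom ≫ (ρ_ (D.map (τ.app a))).inv
    rw [← cancel_epi (D.mapComp (F.map (𝟙 a)) (τ.app a)).hom]
    have h' := h =≫ ((D.mapComp (τ.app a) (𝟙 (G.obj a))).hom ≫
      D.map (τ.app a) ◁ (D.mapId (G.obj a)).hom)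
    simp only [Category.assoc, Iso.inv_hom_id_assoc] at h'
    simp only [Category.assoc, Iso.hom_inv_id_assoc, whiskerLeft_comp, comp_whiskerRight]
    rw [h']
    simp
  naturality_comp {a b c} f g := by
    have h := congrArg D.map₂ (τ.naturality_comp f g)
    simp only [D.map₂_comp, D.map₂_whisker_right, D.map₂_whisker_left, D.map₂_associator,
      map₂_α_inv, Category.assoc] at h
    change ((D.mapComp (F.map (f ≫ g)) (τ.app c)).inv ≫ D.map₂ (τ.naturality (f ≫ g)).hom ≫
        (D.mapComp (τ.app a) (G.map (f ≫ g))).hom) ≫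
        D.map (τ.app a) ◁ (D.map₂ (G.mapComp f g).hom ≫ (D.mapComp (G.map f) (G.map g)).hom) =
      (D.map₂ (F.mapComp f g).hom ≫ (D.mapComp (F.map f) (F.map g)).hom) ▷ D.map (τ.app c) ≫
        (α_ _ _ _).hom ≫
        D.map (F.map f) ◁ ((D.mapComp (F.map g) (τ.app c)).inv ≫ D.map₂ (τ.naturality g).hom ≫
          (D.mapComp (τ.app b) (G.map g)).hom) ≫ (α_ _ _ _).inv ≫
        ((D.mapComp (F.map f) (τ.app b)).inv ≫ D.map₂ (τ.naturality f).hom ≫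
          (D.mapComp (τ.app a) (G.map f)).hom) ▷ D.map (G.map g) ≫ (α_ _ _ _).hom
    rw [← cancel_epi (D.mapComp (F.map (f ≫ g)) (τ.app c)).hom]
    have h' := h =≫ ((D.mapComp (τ.app a) (G.map f ≫ G.map g)).hom ≫
      D.map (τ.app a) ◁ (D.mapComp (G.map f) (G.map g)).hom)
    simp only [Category.assoc, Iso.inv_hom_id_assoc] at h'
    simp only [Category.assoc, Iso.hom_inv_id_assoc, whiskerLeft_comp, comp_whiskerRight]
    rw [h']
    simp

/-- Postcomposition with `D : X → K`, as a pseudofunctor `[S, X]_PS → [S, K]_PS`. -/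
def postcompPF (S : Type u₁) [Bicategory.{w₁, v₁} S] (D : X ⥤ᵖ K) :
    (S ⥤ᵖ X) ⥤ᵖ (S ⥤ᵖ K) where
  obj F := F.comp D
  map τ := whiskerRightST τ D
  map₂ {F G σ τ} Γ := ⟨
    { app := fun a => D.map₂ (Γ.as.app a)
      naturality := fun {a b} f => by
        have h := congrArg D.map₂ (Γ.as.naturality f)
        simp only [D.map₂_comp, D.map₂_whisker_right, D.map₂_whisker_left, Category.assoc] at h
        have h' := h =≫ (D.mapComp (τ.app a) (G.map f)).hom
        simp only [Category.assoc, Iso.inv_hom_id, Category.comp_id] at h'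
        change D.map (F.map f) ◁ D.map₂ (Γ.as.app b) ≫
            ((D.mapComp (F.map f) (τ.app b)).inv ≫ D.map₂ (τ.naturality f).hom ≫
              (D.mapComp (τ.app a) (G.map f)).hom) =
          ((D.mapComp (F.map f) (σ.app b)).inv ≫ D.map₂ (σ.naturality f).hom ≫
              (D.mapComp (σ.app a) (G.map f)).hom) ≫ D.map₂ (Γ.as.app a) ▷ D.map (G.map f)
        rw [← cancel_epi (D.mapComp (F.map f) (σ.app b)).hom, h']
        simp }⟩
  mapId F := Pseudofunctor.StrongTrans.isoMk (fun a => D.mapId (F.obj a)) (by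
    intro a b f
    change D.map (F.map f) ◁ (D.mapId (F.obj b)).hom ≫ (ρ_ (D.map (F.map f))).hom ≫
        (λ_ (D.map (F.map f))).inv =
      ((D.mapComp (F.map f) (𝟙 (F.obj b))).inv ≫ D.map₂ ((ρ_ (F.map f)).hom ≫ (λ_ (F.map f)).inv) ≫
        (D.mapComp (𝟙 (F.obj a)) (F.map f)).hom) ≫ (D.mapId (F.obj a)).hom ▷ D.map (F.map f)
    simp only [D.map₂_comp, D.map₂_right_unitor, Category.assoc]
    have hl : D.map₂ (λ_ (F.map f)).inv = (λ_ (D.map (F.map f))).inv ≫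
        (D.mapId (F.obj a)).inv ▷ D.map (F.map f) ≫ (D.mapComp (𝟙 (F.obj a)) (F.map f)).inv := by
      rw [← cancel_epi (D.map₂ (λ_ (F.map f)).hom), ← D.map₂_comp]
      simp
    rw [hl]
    simp)
  mapComp {F G H} σ τ := Pseudofunctor.StrongTrans.isoMk
    (fun a => D.mapComp (σ.app a) (τ.app a)) (by
    intro a b f
    change D.map (F.map f) ◁ (D.mapComp (σ.app b) (τ.app b)).hom ≫
        (α_ _ _ _).inv ≫
          ((D.mapComp (F.map f) (σ.app b)).inv ≫ D.map₂ (σ.naturality f).hom ≫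
              (D.mapComp (σ.app a) (G.map f)).hom) ▷ D.map (τ.app b) ≫ (α_ _ _ _).hom ≫
          D.map (σ.app a) ◁ ((D.mapComp (G.map f) (τ.app b)).inv ≫ D.map₂ (τ.naturality f).hom ≫
              (D.mapComp (τ.app a) (H.map f)).hom) ≫ (α_ _ _ _).inv =
      ((D.mapComp (F.map f) (σ.app b ≫ τ.app b)).inv ≫
        D.map₂ ((α_ _ _ _).inv ≫ (σ.naturality f).hom ▷ τ.app b ≫ (α_ _ _ _).hom ≫
          σ.app a ◁ (τ.naturality f).hom ≫ (α_ _ _ _).inv) ≫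
        (D.mapComp (σ.app a ≫ τ.app a) (H.map f)).hom) ≫
        (D.mapComp (σ.app a) (τ.app a)).hom ▷ D.map (H.map f)
    simp only [D.map₂_comp, D.map₂_whisker_right, D.map₂_whisker_left, D.map₂_associator,
      map₂_α_inv, Category.assoc]
    simp)
  map₂_id σ := by
    ext a
    exact D.map₂_id _
  map₂_comp Γ Γ' := by
    ext a
    exact D.map₂_comp _ _
  map₂_whisker_left σ _ _ Γ := by
    ext a
    exact D.map₂_whisker_left _ _
  map₂_whisker_right Γ τ := by
    ext a
    exact D.map₂_whisker_right _ _
  map₂_associator σ τ ι := by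
    ext a
    exact D.map₂_associator _ _ _
  map₂_left_unitor σ := by
    ext a
    exact D.map₂_left_unitor _
  map₂_right_unitor σ := by
    ext a
    exact D.map₂_right_unitor _

end Postcomposition

/-- The pseudofunctor `(-, e) : S → S × E`. -/
def sectPF (S : Type u₁) [Bicategory.{w₁, v₁} S] {E : Type u₂} [Bicategory.{w₂, v₂} E] (e : E) :
    S ⥤ᵖ (S × E) where
  obj s := (s, e)
  map f := (f, 𝟙 e)
  map₂ η := (η, 𝟙 (𝟙 e))
  mapId s := Iso.refl _
  mapComp f g := Iso.prod (Iso.refl (f ≫ g)) (λ_ (𝟙 e)).symm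

/-- The pseudofunctor `E → [S, S × E]_PS` that sends `e` to `(-, e)`. -/
def sectionsPF (S : Type u₁) [Bicategory.{w₁, v₁} S] (E : Type u₂) [Bicategory.{w₂, v₂} E] :
    E ⥤ᵖ (S ⥤ᵖ (S × E)) where
  obj e := sectPF S e
  map {e e'} k :=
    { app := fun s => (𝟙 s, k)
      naturality := fun f => Iso.prod (ρ_ f ≪≫ (λ_ f).symm) (λ_ k ≪≫ (ρ_ k).symm)
      naturality_naturality := fun {a b f g} η => by
        refine Prod.ext ?_ ?_
        · change η ▷ 𝟙 b ≫ (ρ_ g).hom ≫ (λ_ g).inv = ((ρ_ f).hom ≫ (λ_ f).inv) ≫ 𝟙 a ◁ η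
          simp
        · change 𝟙 (𝟙 e) ▷ k ≫ (λ_ k).hom ≫ (ρ_ k).inv =
            ((λ_ k).hom ≫ (ρ_ k).inv) ≫ k ◁ 𝟙 (𝟙 e')
          simp
      naturality_id := fun s => by
        refine Prod.ext ?_ ?_
        · change ((ρ_ (𝟙 s)).hom ≫ (λ_ (𝟙 s)).inv) ≫ 𝟙 s ◁ 𝟙 (𝟙 s) =
            𝟙 (𝟙 s) ▷ 𝟙 s ≫ (λ_ (𝟙 s)).hom ≫ (ρ_ (𝟙 s)).inv
          bicategory
        · change ((λ_ k).hom ≫ (ρ_ k).inv) ≫ k ◁ 𝟙 (𝟙 e') =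
            𝟙 (𝟙 e) ▷ k ≫ (λ_ k).hom ≫ (ρ_ k).inv
          bicategory
      naturality_comp := fun {a b c} f g => by
        refine Prod.ext ?_ ?_
        · change ((ρ_ (f ≫ g)).hom ≫ (λ_ (f ≫ g)).inv) ≫ 𝟙 a ◁ 𝟙 (f ≫ g) =
            𝟙 (f ≫ g) ▷ 𝟙 c ≫ (α_ f g (𝟙 c)).hom ≫ f ◁ ((ρ_ g).hom ≫ (λ_ g).inv) ≫
              (α_ f (𝟙 b) g).inv ≫ ((ρ_ f).hom ≫ (λ_ f).inv) ▷ g ≫ (α_ (𝟙 a) f g).hom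
          bicategory
        · change ((λ_ k).hom ≫ (ρ_ k).inv) ≫ k ◁ (λ_ (𝟙 e')).inv =
            (λ_ (𝟙 e)).inv ▷ k ≫ (α_ (𝟙 e) (𝟙 e) k).hom ≫ 𝟙 e ◁ ((λ_ k).hom ≫ (ρ_ k).inv) ≫
              (α_ (𝟙 e) k (𝟙 e')).inv ≫ ((λ_ k).hom ≫ (ρ_ k).inv) ▷ 𝟙 e' ≫
              (α_ k (𝟙 e') (𝟙 e')).hom
          bicategory }
  map₂ {e e' k l} η := ⟨
    { app := fun s => (𝟙 (𝟙 s), η)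
      naturality := fun {a b} f => by
        refine Prod.ext ?_ ?_
        · change f ◁ 𝟙 (𝟙 b) ≫ (ρ_ f).hom ≫ (λ_ f).inv =
            ((ρ_ f).hom ≫ (λ_ f).inv) ≫ 𝟙 (𝟙 a) ▷ f
          bicategory
        · change 𝟙 e ◁ η ≫ (λ_ l).hom ≫ (ρ_ l).inv =
            ((λ_ k).hom ≫ (ρ_ k).inv) ≫ η ▷ 𝟙 e'
          simp }⟩
  mapId e := Pseudofunctor.StrongTrans.isoMk (fun s => Iso.refl _) (by
    intro a b f
    refine Prod.ext ?_ ?_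
    · change f ◁ 𝟙 (𝟙 b) ≫ (ρ_ f).hom ≫ (λ_ f).inv = ((ρ_ f).hom ≫ (λ_ f).inv) ≫ 𝟙 (𝟙 a) ▷ f
      bicategory
    · change 𝟙 e ◁ 𝟙 (𝟙 e) ≫ (ρ_ (𝟙 e)).hom ≫ (λ_ (𝟙 e)).inv =
        ((λ_ (𝟙 e)).hom ≫ (ρ_ (𝟙 e)).inv) ≫ 𝟙 (𝟙 e) ▷ 𝟙 e
      bicategory)
  mapComp {e₀ e₁ e₂} k l := Pseudofunctor.StrongTrans.isoMk
    (fun s => Iso.prod (λ_ (𝟙 s)).symm (Iso.refl (k ≫ l))) (by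
    intro a b f
    refine Prod.ext ?_ ?_
    · change f ◁ (λ_ (𝟙 b)).inv ≫ (α_ f (𝟙 b) (𝟙 b)).inv ≫ ((ρ_ f).hom ≫ (λ_ f).inv) ▷ 𝟙 b ≫
          (α_ (𝟙 a) f (𝟙 b)).hom ≫ 𝟙 a ◁ ((ρ_ f).hom ≫ (λ_ f).inv) ≫ (α_ (𝟙 a) (𝟙 a) f).inv =
        ((ρ_ f).hom ≫ (λ_ f).inv) ≫ (λ_ (𝟙 a)).inv ▷ f
      bicategory
    · change 𝟙 e₀ ◁ 𝟙 (k ≫ l) ≫ (α_ (𝟙 e₀) k l).inv ≫ ((λ_ k).hom ≫ (ρ_ k).inv) ▷ l ≫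
          (α_ k (𝟙 e₁) l).hom ≫ k ◁ ((λ_ l).hom ≫ (ρ_ l).inv) ≫ (α_ k l (𝟙 e₂)).inv =
        ((λ_ (k ≫ l)).hom ≫ (ρ_ (k ≫ l)).inv) ≫ 𝟙 (k ≫ l) ▷ 𝟙 e₂
      bicategory)
  map₂_id _ := by
    ext a
    rfl
  map₂_comp η θ := by
    ext a
    refine Prod.ext ?_ ?_
    · change 𝟙 (𝟙 a) = 𝟙 (𝟙 a) ≫ 𝟙 (𝟙 a)
      simp
    · rfl
  map₂_whisker_left k l m η := by
    ext a
    refine Prod.ext ?_ ?_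
    · change 𝟙 (𝟙 a) = (λ_ (𝟙 a)).inv ≫ 𝟙 a ◁ 𝟙 (𝟙 a) ≫ (λ_ (𝟙 a)).hom
      simp
    · change k ◁ η = 𝟙 (k ≫ l) ≫ k ◁ η ≫ 𝟙 (k ≫ m)
      simp
  map₂_whisker_right {_ _ _ k l} η m := by
    ext a
    refine Prod.ext ?_ ?_
    · change 𝟙 (𝟙 a) = (λ_ (𝟙 a)).inv ≫ 𝟙 (𝟙 a) ▷ 𝟙 a ≫ (λ_ (𝟙 a)).hom
      simp
    · change η ▷ m = 𝟙 (k ≫ m) ≫ η ▷ m ≫ 𝟙 (l ≫ m)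
      simp
  map₂_associator k l m := by
    ext a
    refine Prod.ext ?_ ?_
    · change 𝟙 (𝟙 a) = (λ_ (𝟙 a)).inv ≫ (λ_ (𝟙 a)).inv ▷ 𝟙 a ≫ (α_ (𝟙 a) (𝟙 a) (𝟙 a)).hom ≫
        𝟙 a ◁ (λ_ (𝟙 a)).hom ≫ (λ_ (𝟙 a)).hom
      bicategory
    · change (α_ k l m).hom = 𝟙 ((k ≫ l) ≫ m) ≫ 𝟙 (k ≫ l) ▷ m ≫ (α_ k l m).hom ≫
        k ◁ 𝟙 (l ≫ m) ≫ 𝟙 (k ≫ l ≫ m)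
      simp
  map₂_left_unitor {e _} k := by
    ext a
    refine Prod.ext ?_ ?_
    · change 𝟙 (𝟙 a) = (λ_ (𝟙 a)).inv ≫ 𝟙 (𝟙 a) ▷ 𝟙 a ≫ (λ_ (𝟙 a)).hom
      simp
    · change (λ_ k).hom = 𝟙 (𝟙 e ≫ k) ≫ 𝟙 (𝟙 e) ▷ k ≫ (λ_ k).hom
      simp
  map₂_right_unitor {_ e} k := by
    ext a
    refine Prod.ext ?_ ?_
    · change 𝟙 (𝟙 a) = (λ_ (𝟙 a)).inv ≫ 𝟙 a ◁ 𝟙 (𝟙 a) ≫ (ρ_ (𝟙 a)).hom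
      bicategory
    · change (ρ_ k).hom = 𝟙 (k ≫ 𝟙 e) ≫ k ◁ 𝟙 (𝟙 e) ≫ (ρ_ k).hom
      simp

/-- For `D : S × E → K`, the pseudofunctor `E → [S, K]_PS` that sends `e` to `D(-, e)`. -/
def curryPF {S : Type u₁} [Bicategory.{w₁, v₁} S] {E : Type u₂} [Bicategory.{w₂, v₂} E]
    {K : Type u₃} [Bicategory.{w₃, v₃} K] (D : (S × E) ⥤ᵖ K) : E ⥤ᵖ (S ⥤ᵖ K) :=
  (sectionsPF S E).comp (postcompPF S D)

/-- There is a pseudonatural equivalence `F ≃ G` between `Cat`-valued pseudofunctors: a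
pseudonatural transformation all of whose components are equivalences of categories. -/
def PseudonaturalEquiv {X : Type u₁} [Bicategory.{w₁, v₁} X] (F G : X ⥤ᵖ Cat.{v, u}) : Prop :=
  ∃ τ : F ⟶ G, ∀ x : X, (τ.app x).toFunctor.IsEquivalence

section Weighted

variable {S : Type v} [Bicategory.{v, v} S] {E : Type u₁} [Bicategory.{w₁, v₁} E]
  {K : Type u₂} [Bicategory.{v, v} K]

/-- For a weight `W : S → Cat` and `D : S × E → Cat`, the pseudofunctor
`[S, Cat]_PS(W, D(-, ·)) : E → Cat`, which sends `e` to the category of pseudonatural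
transformations `W ⟶ D(-, e)` and modifications. -/
def psHom (W : S ⥤ᵖ Cat.{v, v}) (D : (S × E) ⥤ᵖ Cat.{v, v}) : E ⥤ᵖ Cat.{v, v} :=
  (curryPF D).comp (homFrom W)

/-- For `D : S × E → K`, the pseudofunctor `(s, (X, e)) ↦ K(X, D(s, e))`. -/
def homInto (D : (S × E) ⥤ᵖ K) : (S × (Kᵒᵖ × E)) ⥤ᵖ Cat.{v, v} :=
  (shuffle S Kᵒᵖ E).comp ((prodPF (Pseudofunctor.id Kᵒᵖ) D).comp (homPF K))

/-- `G e` is the weighted bilimit `{W, D(-, e)}_bi` in `K`, pseudonaturally in the parameter `e`: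
there is an equivalence `K(X, G e) ≃ [S, Cat]_PS(W, K(X, D(-, e)))`, pseudonatural in `X` (which
says that each `G e` is the weighted bilimit) and in `e`. -/
def IsWeightedBilimit (W : S ⥤ᵖ Cat.{v, v}) (D : (S × E) ⥤ᵖ K) (G : E ⥤ᵖ K) : Prop :=
  PseudonaturalEquiv ((prodPF (Pseudofunctor.id Kᵒᵖ) G).comp (homPF K)) (psHom W (homInto D))

/-- For `𝒜 : Sᵒᵖ → K`, the pseudofunctor `K(𝒜 -, -) : S × K → Cat`. -/
def homOut (𝒜 : Sᵒᵖ ⥤ᵖ K) : (S × K) ⥤ᵖ Cat.{v, v} :=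
  (prodPF (leftOpPF 𝒜) (Pseudofunctor.id K)).comp (homPF K)

/-- `L` is the weighted bicolimit `W *_bi 𝒜` in `K`: there is an equivalence
`K(L, X) ≃ [S, Cat]_PS(W, K(𝒜 -, X))`, pseudonatural in `X`. -/
def IsWeightedBicolimit (W : S ⥤ᵖ Cat.{v, v}) (𝒜 : Sᵒᵖ ⥤ᵖ K) (L : K) : Prop :=
  PseudonaturalEquiv (homFrom L) (psHom W (homOut 𝒜))

end Weighted

/-- `R^* = B(-, R -) : Bᵒᵖ × A → Cat`, for `R : A → B`. -/
def upperStar {A : Type u₁} [Bicategory.{w₁, v₁} A] {B : Type u₂} [Bicategory.{w, v} B]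
    (R : A ⥤ᵖ B) : (Bᵒᵖ × A) ⥤ᵖ Cat.{w, v} :=
  (prodPF (Pseudofunctor.id Bᵒᵖ) R).comp (homPF B)

/-- The restriction `|D| : S₀ × A → Cat` of `D : S × A → Cat` can be factorized through `R^*`:
there are a pseudofunctor `D' : S₀ → Bᵒᵖ` and a pseudonatural equivalence
`|D| ≃ R^* ∘ (D' × Id)`. -/
def FactorsThroughStar {S : Type u} [Bicategory.{w₃, v₃} S] {A : Type u₁} [Bicategory.{w₁, v₁} A]
    {B : Type u₂} [Bicategory.{w, v} B] (R : A ⥤ᵖ B) (D : (S × A) ⥤ᵖ Cat.{w, v}) : Prop :=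
  ∃ D' : LocallyDiscrete (Discrete S) ⥤ᵖ Bᵒᵖ,
    PseudonaturalEquiv ((prodPF (discIncl S) (Pseudofunctor.id A)).comp D)
      ((prodPF D' (Pseudofunctor.id A)).comp (upperStar R))

section Biadjunction

variable {A : Type u₁} [Bicategory.{w₁, v₁} A] {B : Type u₂} [Bicategory.{w₂, v₂} B]

section Components

variable {E : B ⥤ᵖ A} {R : A ⥤ᵖ B}

/-- The component `ρ_X : X ⟶ RE X`. -/
abbrev unitApp (η : Pseudofunctor.id B ⟶ E.comp R) (X : B) : X ⟶ R.obj (E.obj X) := η.app X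

/-- The invertible 2-cell `ρ_f : f ≫ ρ_Y ≅ ρ_X ≫ RE f`. -/
abbrev unitNat (η : Pseudofunctor.id B ⟶ E.comp R) {X Y : B} (f : X ⟶ Y) :
    f ≫ unitApp η Y ≅ unitApp η X ≫ R.map (E.map f) := η.naturality f

/-- The component `ε_a : ER a ⟶ a`. -/
abbrev counitApp (θ : R.comp E ⟶ Pseudofunctor.id A) (a : A) : E.obj (R.obj a) ⟶ a := θ.app a

/-- The invertible 2-cell `ε_g : ER g ≫ ε_b ≅ ε_a ≫ g`. -/
abbrev counitNat (θ : R.comp E ⟶ Pseudofunctor.id A) {a b : A} (g : a ⟶ b) :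
    E.map (R.map g) ≫ counitApp θ b ≅ counitApp θ a ≫ g := θ.naturality g

end Components

/-- A biadjunction `E ⊣ R` with unit `ρ : Id ⟶ RE`, counit `ε : ER ⟶ Id` and invertible
modifications `v : id_E ⟹ (εE)(Eρ)` and `w : (Rε)(ρR) ⟹ id_R`, subject to the two coherence
(swallowtail) axioms. -/
structure Biadjunction (E : B ⥤ᵖ A) (R : A ⥤ᵖ B) where
  /-- The unit. -/
  unit : Pseudofunctor.id B ⟶ E.comp R
  /-- The counit. -/
  counit : R.comp E ⟶ Pseudofunctor.id A
  /-- The components of the modification `v : id_E ⟹ (εE)(Eρ)`. -/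
  v (X : B) : 𝟙 (E.obj X) ≅ E.map (unitApp unit X) ≫ counitApp counit (E.obj X)
  /-- The modification axiom for `v`. -/
  v_naturality {X Y : B} (f : X ⟶ Y) :
    E.map f ◁ (v Y).hom ≫ (α_ _ _ _).inv ≫
        (E.mapComp f (unitApp unit Y)).inv ▷ counitApp counit (E.obj Y) ≫
        E.map₂ (unitNat unit f).hom ▷ counitApp counit (E.obj Y) ≫
        (E.mapComp (unitApp unit X) (R.map (E.map f))).hom ▷ counitApp counit (E.obj Y) ≫
        (α_ _ _ _).hom ≫ E.map (unitApp unit X) ◁ (counitNat counit (E.map f)).hom ≫ (α_ _ _ _).inv =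
      (ρ_ (E.map f)).hom ≫ (λ_ (E.map f)).inv ≫ (v X).hom ▷ E.map f
  /-- The components of the modification `w : (Rε)(ρR) ⟹ id_R`. -/
  w (a : A) : unitApp unit (R.obj a) ≫ R.map (counitApp counit a) ≅ 𝟙 (R.obj a)
  /-- The modification axiom for `w`. -/
  w_naturality {a b : A} (g : a ⟶ b) :
    R.map g ◁ (w b).hom ≫ (ρ_ (R.map g)).hom ≫ (λ_ (R.map g)).inv =
      (α_ _ _ _).inv ≫ (unitNat unit (R.map g)).hom ▷ R.map (counitApp counit b) ≫ (α_ _ _ _).hom ≫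
        unitApp unit (R.obj a) ◁ ((R.mapComp (E.map (R.map g)) (counitApp counit b)).inv ≫
          R.map₂ (counitNat counit g).hom ≫ (R.mapComp (counitApp counit a) g).hom) ≫
        (α_ _ _ _).inv ≫ (w a).hom ▷ R.map g
  /-- The first coherence axiom: the pasting of `v_X`, `ρ_{ρ_X}` and `w_{E X}` is the identity of
  the component `ρ_X`. -/
  coherence_unit (X : B) :
    (ρ_ (unitApp unit X)).inv ≫
        unitApp unit X ◁ ((R.mapId (E.obj X)).inv ≫ R.map₂ (v X).hom ≫
          (R.mapComp (E.map (unitApp unit X)) (counitApp counit (E.obj X))).hom) ≫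
        (α_ _ _ _).inv ≫
        (unitNat unit (unitApp unit X)).inv ▷ R.map (counitApp counit (E.obj X)) ≫
        (α_ _ _ _).hom ≫ unitApp unit X ◁ (w (E.obj X)).hom ≫ (ρ_ (unitApp unit X)).hom =
      𝟙 (unitApp unit X)
  /-- The second coherence axiom: the pasting of `v_{R a}`, `ε_{ε_a}` and `w_a` is the identity of
  the component `ε_a`. -/
  coherence_counit (a : A) :
    (λ_ (counitApp counit a)).inv ≫ (v (R.obj a)).hom ▷ counitApp counit a ≫ (α_ _ _ _).hom ≫
        E.map (unitApp unit (R.obj a)) ◁ (counitNat counit (counitApp counit a)).inv ≫ (α_ _ _ _).inv ≫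
        ((E.mapComp (unitApp unit (R.obj a)) (R.map (counitApp counit a))).inv ≫ E.map₂ (w a).hom ≫
          (E.mapId (R.obj a)).hom) ▷ counitApp counit a ≫ (λ_ (counitApp counit a)).hom =
      𝟙 (counitApp counit a)

/-- `R` is right biadjoint: it has a left biadjoint. -/
def IsRightBiadjoint (R : A ⥤ᵖ B) : Prop := ∃ E : B ⥤ᵖ A, Nonempty (Biadjunction E R)

end Biadjunction

end BiTri

open BiTri

/-! A pseudofunctor `H : A → C` has a left biadjoint exactly when each `C(y, H -)` is
birepresentable, that is, when every `y` admits a biuniversal arrow `y ⟶ H L`. The objects `L` are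
then the values of a left biadjoint, and they may be prescribed. One direction is
`exists_biadjunction`, the other `Biadjunction.isBiuniversal`.

For `H = VJ`, the bilimit hypothesis evaluated at the terminal category gives `C(y, VJ -) ≃ [S,
Cat](W, D_y(-, J -)) ≃ [S, Cat](W, A(𝒜_y -, -))`. A birepresentation of the last pseudofunctor is by
definition a weighted bicolimit `W * 𝒜_y`. The theorem is therefore a comparison of
birepresentations, made in `exists_isBiuniversal_iff`.

The diagram `𝒜_y` exists because, for fixed `s`, the factorization through `U^*` and the
biadjunction `E ⊣ R` give `D_y(s, J -) ≃ B(D'_y s, R -) ≃ A(E D'_y s, -)`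
(`exists_colElt_isEquivalence`). The restriction to discrete `S₀` says nothing about 1-cells of `S`.
Their action is recovered from universality: if `x_s` is a universal element of `F(s, -)` over `L
s`, then for `u : s ⟶ t` the element `F(u, 1) x_s` is induced from `x_t` by an essentially unique
1-cell `L t ⟶ L s`. All constraints are forced, and the axioms hold because universal elements
detect 2-cells (`exists_pseudonaturalEquiv_homOut`).

Birepresentations are handled as universal elements, which is the bicategorical Yoneda lemma
`pseudonaturalEquiv_homFrom_iff`. Transporting a universal element from `F` to `G` needs only
equivalences `F a ≃ G a` compatible with evaluation at elements. `ElementwiseEquiv` records just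
that, so the chain of equivalences above is composed without checking coherence of the composites.
-/

namespace BiTri

/-! ### Biuniversal arrows -/

section UniversalArrow

variable {A : Type u₁} [Bicategory.{w₁, v₁} A] {C : Type u₂} [Bicategory.{w₂, v₂} C]

/-- For a 1-cell `η : y ⟶ H L`, the functor `f ↦ η ≫ H f` from `A(L, a)` to `C(y, H a)`. -/
def precompMap (H : A ⥤ᵖ C) {y : C} {L : A} (η : y ⟶ H.obj L) (a : A) :
    (L ⟶ a) ⥤ (y ⟶ H.obj a) where
  obj f := η ≫ H.map f
  map α := η ◁ H.map₂ α

/-- A 1-cell `η : y ⟶ H L` is a biuniversal arrow from `y` to `H`. -/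
def IsBiuniversal (H : A ⥤ᵖ C) {y : C} {L : A} (η : y ⟶ H.obj L) : Prop :=
  ∀ a : A, (precompMap H η a).IsEquivalence

namespace IsBiuniversal

variable {H : A ⥤ᵖ C} {y : C} {L : A} {η : y ⟶ H.obj L} (h : IsBiuniversal H η)
include h

theorem hom_ext {a : A} {f g : L ⟶ a} {α β : f ⟶ g} (e : η ◁ H.map₂ α = η ◁ H.map₂ β) : α = β :=
  haveI := h a
  (precompMap H η a).map_injective e

theorem exists_iso {a : A} (k : y ⟶ H.obj a) : ∃ f : L ⟶ a, Nonempty (k ≅ η ≫ H.map f) :=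
  haveI := h a
  ⟨(precompMap H η a).objPreimage k, ⟨((precompMap H η a).objObjPreimageIso k).symm⟩⟩

/-- The 1-cell induced by the universal property. -/
noncomputable def desc {a : A} (k : y ⟶ H.obj a) : L ⟶ a := (h.exists_iso k).choose

/-- The factorisation of a 1-cell through a biuniversal arrow. -/
noncomputable def fac {a : A} (k : y ⟶ H.obj a) : k ≅ η ≫ H.map (h.desc k) :=
  (h.exists_iso k).choose_spec.some

theorem exists_lift {a : A} {f g : L ⟶ a} (θ : η ≫ H.map f ⟶ η ≫ H.map g) :
    ∃ α : f ⟶ g, η ◁ H.map₂ α = θ :=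
  haveI := h a
  (precompMap H η a).map_surjective θ

/-- The 2-cell induced by the universal property. -/
noncomputable def lift {a : A} {f g : L ⟶ a} (θ : η ≫ H.map f ⟶ η ≫ H.map g) : f ⟶ g :=
  (h.exists_lift θ).choose

@[simp]
theorem map_lift {a : A} {f g : L ⟶ a} (θ : η ≫ H.map f ⟶ η ≫ H.map g) :
    η ◁ H.map₂ (h.lift θ) = θ :=
  (h.exists_lift θ).choose_spec

/-- The invertible 2-cell induced by the universal property. -/
@[simps]
noncomputable def liftIso {a : A} {f g : L ⟶ a} (θ : η ≫ H.map f ≅ η ≫ H.map g) : f ≅ g where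
  hom := h.lift θ.hom
  inv := h.lift θ.inv
  hom_inv_id := h.hom_ext (by simp)
  inv_hom_id := h.hom_ext (by simp)

end IsBiuniversal

/-! ### The pseudofunctor and unit generated by biuniversal arrows -/

section LeftBiadjoint

variable {H : A ⥤ᵖ C} {L : C → A} {η : ∀ y, y ⟶ H.obj (L y)} (h : ∀ y, IsBiuniversal H (η y))

/-- The action on 1-cells of the left biadjoint. -/
noncomputable def lbMap {x y : C} (u : x ⟶ y) : L x ⟶ L y := (h x).desc (u ≫ η y)

/-- The naturality 2-cell of the unit. -/
noncomputable def lbNat {x y : C} (u : x ⟶ y) : u ≫ η y ≅ η x ≫ H.map (lbMap h u) :=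
  (h x).fac (u ≫ η y)

/-- The action on 2-cells of the left biadjoint. -/
noncomputable def lbMap₂ {x y : C} {u u' : x ⟶ y} (θ : u ⟶ u') : lbMap h u ⟶ lbMap h u' :=
  (h x).lift ((lbNat h u).inv ≫ θ ▷ η y ≫ (lbNat h u').hom)

/-- The identity constraint of the left biadjoint. -/
noncomputable def lbMapId (x : C) : lbMap h (𝟙 x) ≅ 𝟙 (L x) :=
  (h x).liftIso ((lbNat h (𝟙 x)).symm ≪≫ λ_ _ ≪≫ (ρ_ _).symm ≪≫
    whiskerLeftIso (η x) (H.mapId (L x)).symm)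

/-- The composition constraint of the left biadjoint. -/
noncomputable def lbMapComp {x y z : C} (u : x ⟶ y) (v : y ⟶ z) :
    lbMap h (u ≫ v) ≅ lbMap h u ≫ lbMap h v :=
  (h x).liftIso ((lbNat h (u ≫ v)).symm ≪≫ α_ _ _ _ ≪≫ whiskerLeftIso u (lbNat h v) ≪≫
    (α_ _ _ _).symm ≪≫ whiskerRightIso (lbNat h u) (H.map (lbMap h v)) ≪≫ α_ _ _ _ ≪≫
    whiskerLeftIso (η x) (H.mapComp (lbMap h u) (lbMap h v)).symm)

/-- This equation and the next two characterize the lifted 2-cells. They are the pseudonaturality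
axioms of the unit with the constraints of `H` moved to the right, so `lbUnit` follows from them
directly. -/
theorem lbNat_map₂ {x y : C} {u u' : x ⟶ y} (θ : u ⟶ u') :
    (lbNat h u).hom ≫ η x ◁ H.map₂ (lbMap₂ h θ) = θ ▷ η y ≫ (lbNat h u').hom := by
  simp [lbMap₂]

theorem lbNat_mapId (x : C) :
    (lbNat h (𝟙 x)).hom ≫ η x ◁ H.map₂ (lbMapId h x).hom =
      (λ_ _).hom ≫ (ρ_ _).inv ≫ η x ◁ (H.mapId (L x)).inv := by
  simp [lbMapId]

theorem lbNat_mapComp {x y z : C} (u : x ⟶ y) (v : y ⟶ z) :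
    (lbNat h (u ≫ v)).hom ≫ η x ◁ H.map₂ (lbMapComp h u v).hom =
      (α_ _ _ _).hom ≫ u ◁ (lbNat h v).hom ≫ (α_ _ _ _).inv ≫
        (lbNat h u).hom ▷ H.map (lbMap h v) ≫ (α_ _ _ _).hom ≫
        η x ◁ (H.mapComp (lbMap h u) (lbMap h v)).inv := by
  simp [lbMapComp]

/-- Prefixing the invertible `lbNat` loses no information and brings both sides to the form in which
the three characterizing equations rewrite. Each pseudofunctor axiom then becomes an identity of
pastings in `C`. -/
theorem lb_ext {x y : C} {u : x ⟶ y} {f : L x ⟶ L y} {α β : lbMap h u ⟶ f}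
    (e : (lbNat h u).hom ≫ η x ◁ H.map₂ α = (lbNat h u).hom ≫ η x ◁ H.map₂ β) : α = β :=
  (h x).hom_ext ((cancel_epi _).1 e)

theorem lbMap₂_whiskerLeft {x y z : C} (u : x ⟶ y) {v v' : y ⟶ z} (θ : v ⟶ v') :
    lbMap₂ h (u ◁ θ) ≫ (lbMapComp h u v').hom =
      (lbMapComp h u v).hom ≫ lbMap h u ◁ lbMap₂ h θ := by
  apply lb_ext h
  have e := lbNat_map₂ h θ
  simp only [H.map₂_comp, whiskerLeft_comp, reassoc_of% lbNat_map₂ h (u ◁ θ),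
    reassoc_of% lbNat_mapComp h u v, lbNat_mapComp, H.map₂_whisker_left]
  simp only [whiskerLeft_inv_hom_assoc]
  rw [← cancel_mono (η x ◁ (H.mapComp (lbMap h u) (lbMap h v')).hom)]
  simp only [Category.assoc, whiskerLeft_inv_hom, Category.comp_id]
  rw [associator_naturality_middle_assoc, ← whiskerLeft_comp_assoc, ← e, whiskerLeft_comp_assoc,
    associator_inv_naturality_right_assoc, whisker_exchange_assoc]
  simp

theorem lbMap₂_whiskerRight {x y z : C} {u u' : x ⟶ y} (θ : u ⟶ u') (v : y ⟶ z) :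
    lbMap₂ h (θ ▷ v) ≫ (lbMapComp h u' v).hom =
      (lbMapComp h u v).hom ≫ lbMap₂ h θ ▷ lbMap h v := by
  apply lb_ext h
  have e := lbNat_map₂ h θ
  simp only [H.map₂_comp, whiskerLeft_comp, reassoc_of% lbNat_map₂ h (θ ▷ v),
    reassoc_of% lbNat_mapComp h u v, lbNat_mapComp, H.map₂_whisker_right]
  simp only [whiskerLeft_inv_hom_assoc]
  rw [← cancel_mono (η x ◁ (H.mapComp (lbMap h u') (lbMap h v)).hom)]
  simp only [Category.assoc, whiskerLeft_inv_hom, Category.comp_id]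
  rw [associator_naturality_left_assoc, ← whisker_exchange_assoc,
    associator_inv_naturality_left_assoc, ← comp_whiskerRight_assoc, ← e]
  simp

theorem lbMap₂_leftUnitor {x y : C} (u : x ⟶ y) :
    lbMap₂ h (λ_ u).hom =
      (lbMapComp h (𝟙 x) u).hom ≫ (lbMapId h x).hom ▷ lbMap h u ≫ (λ_ (lbMap h u)).hom := by
  apply lb_ext h
  have e := lbNat_mapId h x
  simp only [H.map₂_comp, whiskerLeft_comp, lbNat_map₂ h (λ_ u).hom,
    reassoc_of% lbNat_mapComp h (𝟙 x) u, H.map₂_whisker_right, H.map₂_left_unitor, Category.assoc,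
    whiskerLeft_inv_hom_assoc]
  rw [← associator_naturality_middle_assoc, ← comp_whiskerRight_assoc, e]
  simp

theorem lbMap₂_rightUnitor {x y : C} (u : x ⟶ y) :
    lbMap₂ h (ρ_ u).hom =
      (lbMapComp h u (𝟙 y)).hom ≫ lbMap h u ◁ (lbMapId h y).hom ≫ (ρ_ (lbMap h u)).hom := by
  apply lb_ext h
  have e := lbNat_mapId h y
  simp only [H.map₂_comp, whiskerLeft_comp, lbNat_map₂ h (ρ_ u).hom,
    reassoc_of% lbNat_mapComp h u (𝟙 y), H.map₂_whisker_left, H.map₂_right_unitor, Category.assoc,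
    whiskerLeft_inv_hom_assoc]
  rw [← associator_naturality_right_assoc, ← whisker_exchange_assoc,
    ← associator_inv_naturality_right_assoc, ← whiskerLeft_comp_assoc u, e]
  simp only [whiskerLeft_comp, Category.assoc]
  rw [associator_inv_naturality_right_assoc, whisker_exchange_assoc]
  simp

/-- Tested against the unit, both sides are the pasting of the three cells `lbNat` for `u`, `v`,
`w`. They differ only by bicategorical coherence, one interchange, and constraints of `H`, which are
cancelled on the right. -/
theorem lbMap₂_associator {x y z t : C} (u : x ⟶ y) (v : y ⟶ z) (w : z ⟶ t) :
    lbMap₂ h (α_ u v w).hom ≫ (lbMapComp h u (v ≫ w)).hom ≫ lbMap h u ◁ (lbMapComp h v w).hom =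
      (lbMapComp h (u ≫ v) w).hom ≫ (lbMapComp h u v).hom ▷ lbMap h w ≫ (α_ _ _ _).hom := by
  apply lb_ext h
  have e₁ := lbNat_mapComp h u v
  have e₂ := lbNat_mapComp h v w
  simp only [H.map₂_comp, whiskerLeft_comp, reassoc_of% lbNat_map₂ h (α_ u v w).hom,
    reassoc_of% lbNat_mapComp h (u ≫ v) w, reassoc_of% lbNat_mapComp h u (v ≫ w),
    H.map₂_whisker_right, H.map₂_whisker_left, H.map₂_associator, Category.assoc,
    whiskerLeft_inv_hom_assoc]
  rw [← associator_naturality_middle_assoc, ← comp_whiskerRight_assoc, e₁]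
  rw [← associator_naturality_right_assoc, ← whisker_exchange_assoc,
    ← associator_inv_naturality_right_assoc, ← whiskerLeft_comp_assoc u, e₂]
  rw [← cancel_mono (η x ◁ (H.mapComp (lbMap h u) (lbMap h v ≫ lbMap h w)).hom)]
  rw [← cancel_mono (η x ◁ _ ◁ (H.mapComp (lbMap h v) (lbMap h w)).hom)]
  simp only [comp_whiskerRight, whiskerLeft_comp, Category.assoc, pentagon_assoc,
    comp_whiskerLeft, whisker_assoc, Iso.inv_hom_id_assoc]
  rw [associator_inv_naturality_right_assoc, whisker_exchange_assoc]
  simp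
/-- The left biadjoint determined by a biuniversal arrow for each object. -/
noncomputable def lbPF : C ⥤ᵖ A where
  obj := L
  map := lbMap h
  map₂ := lbMap₂ h
  map₂_id u := by
    apply lb_ext h
    simp [lbNat_map₂ h]
  map₂_comp θ θ' := by
    apply lb_ext h
    simp [lbNat_map₂ h, reassoc_of% lbNat_map₂ h]
  mapId := lbMapId h
  mapComp := lbMapComp h
  map₂_whisker_left u _ _ θ := by
    rw [← reassoc_of% lbMap₂_whiskerLeft h u θ, Iso.hom_inv_id, Category.comp_id]
  map₂_whisker_right θ v := by
    rw [← reassoc_of% lbMap₂_whiskerRight h θ v, Iso.hom_inv_id, Category.comp_id]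
  map₂_associator u v w := by
    rw [← reassoc_of% lbMap₂_associator h u v w]
    simp
  map₂_left_unitor := lbMap₂_leftUnitor h
  map₂_right_unitor := lbMap₂_rightUnitor h

/-- The unit of the left biadjoint determined by a biuniversal arrow for each object. -/
noncomputable def lbUnit : Pseudofunctor.id C ⟶ (lbPF h).comp H where
  app := η
  naturality := lbNat h
  naturality_naturality θ := (lbNat_map₂ h θ).symm
  naturality_id x := by
    change (lbNat h (𝟙 x)).hom ≫ η x ◁ (H.map₂ (lbMapId h x).hom ≫ (H.mapId (L x)).hom) =
      𝟙 (𝟙 x) ▷ η x ≫ (λ_ _).hom ≫ (ρ_ _).inv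
    simp [reassoc_of% lbNat_mapId h x]
  naturality_comp {x y z} u v := by
    change (lbNat h (u ≫ v)).hom ≫ η x ◁ (H.map₂ (lbMapComp h u v).hom ≫ (H.mapComp _ _).hom) =
      𝟙 (u ≫ v) ▷ η z ≫ (α_ _ _ _).hom ≫ u ◁ (lbNat h v).hom ≫ (α_ _ _ _).inv ≫
        (lbNat h u).hom ▷ H.map (lbMap h v) ≫ (α_ _ _ _).hom
    simp [reassoc_of% lbNat_mapComp h u v]

end LeftBiadjoint

end UniversalArrow

/-! ### Transposition of 2-cells along a pseudonatural unit -/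

section Transpose

variable {A : Type u₁} [Bicategory.{w₁, v₁} A] {C : Type u₂} [Bicategory.{w₂, v₂} C]
  {G : C ⥤ᵖ A} {H : A ⥤ᵖ C} (η : Pseudofunctor.id C ⟶ G.comp H)

theorem unitNat_map₂ {x y : C} {u u' : x ⟶ y} (θ : u ⟶ u') :
    (unitNat η u).hom ≫ unitApp η x ◁ H.map₂ (G.map₂ θ) =
      θ ▷ unitApp η y ≫ (unitNat η u').hom :=
  (η.naturality_naturality θ).symm

theorem unitNat_mapId (x : C) :
    (unitNat η (𝟙 x)).hom ≫ unitApp η x ◁ H.map₂ (G.mapId x).hom =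
      (λ_ _).hom ≫ (ρ_ _).inv ≫ unitApp η x ◁ (H.mapId (G.obj x)).inv := by
  have e : (unitNat η (𝟙 x)).hom ≫
      unitApp η x ◁ (H.map₂ (G.mapId x).hom ≫ (H.mapId (G.obj x)).hom) =
      𝟙 (𝟙 x) ▷ unitApp η x ≫ (λ_ _).hom ≫ (ρ_ _).inv := η.naturality_id x
  rw [← cancel_mono (unitApp η x ◁ (H.mapId (G.obj x)).hom)]
  simpa using e

theorem unitNat_mapComp {x y z : C} (u : x ⟶ y) (v : y ⟶ z) :
    (unitNat η (u ≫ v)).hom ≫ unitApp η x ◁ H.map₂ (G.mapComp u v).hom =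
      (α_ _ _ _).hom ≫ u ◁ (unitNat η v).hom ≫ (α_ _ _ _).inv ≫
        (unitNat η u).hom ▷ H.map (G.map v) ≫ (α_ _ _ _).hom ≫
        unitApp η x ◁ (H.mapComp (G.map u) (G.map v)).inv := by
  have e : (unitNat η (u ≫ v)).hom ≫
      unitApp η x ◁ (H.map₂ (G.mapComp u v).hom ≫ (H.mapComp (G.map u) (G.map v)).hom) =
      𝟙 (u ≫ v) ▷ unitApp η z ≫ (α_ _ _ _).hom ≫ u ◁ (unitNat η v).hom ≫ (α_ _ _ _).inv ≫
        (unitNat η u).hom ▷ H.map (G.map v) ≫ (α_ _ _ _).hom := η.naturality_comp u v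
  rw [← cancel_mono (unitApp η x ◁ (H.mapComp (G.map u) (G.map v)).hom)]
  simpa using e

/-- The comparison `u ≫ (ρ_y ≫ H k) ≅ ρ_x ≫ H (G u ≫ k)`. -/
def transIso {x y : C} (u : x ⟶ y) {a : A} (k : G.obj y ⟶ a) :
    u ≫ unitApp η y ≫ H.map k ≅ unitApp η x ≫ H.map (G.map u ≫ k) :=
  (α_ _ _ _).symm ≪≫ whiskerRightIso (unitNat η u) (H.map k) ≪≫ α_ _ _ _ ≪≫
    whiskerLeftIso (unitApp η x) (H.mapComp (G.map u) k).symm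

/-- The transpose of a 2-cell `G u ≫ k ⟶ f`. -/
def transp {x y : C} {u : x ⟶ y} {a : A} {k : G.obj y ⟶ a} {f : G.obj x ⟶ a}
    (α : G.map u ≫ k ⟶ f) : u ≫ unitApp η y ≫ H.map k ⟶ unitApp η x ≫ H.map f :=
  (transIso η u k).hom ≫ unitApp η x ◁ H.map₂ α

section

variable {η} {x y : C} {u : x ⟶ y} {a : A} {k : G.obj y ⟶ a} {f : G.obj x ⟶ a}

/-- The comparison `transIso` is invertible and whiskering with a biuniversal arrow is faithful.
Equations in `A` about the counit are therefore checked on transposes in `C`, computed by the rules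
below. -/
theorem transp_ext (h : IsBiuniversal H (unitApp η x)) {α β : G.map u ≫ k ⟶ f}
    (e : transp η α = transp η β) : α = β :=
  h.hom_ext ((cancel_epi _).1 e)

theorem transp_comp (α : G.map u ≫ k ⟶ f) {f' : G.obj x ⟶ a} (γ : f ⟶ f') :
    transp η (α ≫ γ) = transp η α ≫ unitApp η x ◁ H.map₂ γ := by
  simp [transp]

/-- Transposition strips `G`: naturality of the unit replaces `G θ` by `θ`. In the same way
`transp_mapId` and `transp_mapComp` remove the constraints of `G`. -/
theorem transp_map₂_whiskerRight {u' : x ⟶ y} (θ : u' ⟶ u) (α : G.map u ≫ k ⟶ f) :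
    transp η (G.map₂ θ ▷ k ≫ α) = θ ▷ (unitApp η y ≫ H.map k) ≫ transp η α := by
  have e := unitNat_map₂ η θ
  simp only [transp, transIso, Iso.trans_hom, Iso.symm_hom, whiskerRightIso_hom, whiskerLeftIso_hom,
    Category.assoc, H.map₂_comp, H.map₂_whisker_right, whiskerLeft_comp,
    whiskerLeft_inv_hom_assoc]
  rw [← associator_naturality_middle_assoc, ← comp_whiskerRight_assoc, e]
  simp

theorem transp_whiskerRight {b : A} (α : G.map u ≫ k ⟶ f) (g : a ⟶ b) :
    transp η ((α_ _ _ _).inv ≫ α ▷ g) =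
      u ◁ (unitApp η y ◁ (H.mapComp k g).hom ≫ (α_ _ _ _).inv) ≫ (α_ _ _ _).inv ≫
        transp η α ▷ H.map g ≫ (α_ _ _ _).hom ≫ unitApp η x ◁ (H.mapComp f g).inv := by
  simp only [transp, transIso, Iso.trans_hom, Iso.symm_hom, whiskerRightIso_hom, whiskerLeftIso_hom,
    Category.assoc, H.map₂_comp, H.map₂_whisker_right, whiskerLeft_comp, comp_whiskerRight,
    map₂_α_inv, whiskerLeft_inv_hom_assoc]
  rw [← associator_naturality_right_assoc, ← whisker_exchange_assoc]
  simp

end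

theorem transp_mapId {x : C} {a : A} (k : G.obj x ⟶ a) :
    transp η ((G.mapId x).hom ▷ k ≫ (λ_ k).hom) = (λ_ _).hom := by
  have e := unitNat_mapId η x
  simp only [transp, transIso, Iso.trans_hom, Iso.symm_hom, whiskerRightIso_hom, whiskerLeftIso_hom,
    Category.assoc, H.map₂_comp, H.map₂_whisker_right, whiskerLeft_comp, H.map₂_left_unitor,
    whiskerLeft_inv_hom_assoc]
  rw [← associator_naturality_middle_assoc, ← comp_whiskerRight_assoc, e]
  simp

theorem transp_mapComp {x y z : C} (u : x ⟶ y) (v : y ⟶ z) {a : A} {k : G.obj z ⟶ a}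
    {l : G.obj y ⟶ a} {f : G.obj x ⟶ a} (α : G.map v ≫ k ⟶ l) (β : G.map u ≫ l ⟶ f) :
    transp η ((G.mapComp u v).hom ▷ k ≫ (α_ _ _ _).hom ≫ G.map u ◁ α ≫ β) =
      (α_ _ _ _).hom ≫ u ◁ transp η α ≫ transp η β := by
  have e := unitNat_mapComp η u v
  simp only [transp, transIso, Iso.trans_hom, Iso.symm_hom, whiskerRightIso_hom, whiskerLeftIso_hom,
    Category.assoc, H.map₂_comp, H.map₂_whisker_right, H.map₂_whisker_left, whiskerLeft_comp,
    H.map₂_associator, whiskerLeft_inv_hom_assoc]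
  rw [← associator_naturality_middle_assoc, ← comp_whiskerRight_assoc, e]
  rw [associator_inv_naturality_right_assoc u, whisker_exchange_assoc]
  rw [associator_inv_naturality_right_assoc u, whisker_exchange_assoc]
  simp

theorem transp_unitor {x y : C} (u : x ⟶ y) :
    transp η ((ρ_ (G.map u)).hom ≫ (λ_ _).inv) =
      u ◁ (unitApp η y ◁ (H.mapId _).hom ≫ (ρ_ _).hom) ≫ (unitNat η u).hom ≫
        unitApp η x ◁ H.map₂ (λ_ (G.map u)).inv := by
  simp only [transp, transIso, Iso.trans_hom, Iso.symm_hom, whiskerRightIso_hom, whiskerLeftIso_hom,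
    Category.assoc, H.map₂_comp, H.map₂_right_unitor, whiskerLeft_comp,
    whiskerLeft_inv_hom_assoc]
  rw [← associator_naturality_right_assoc, ← whisker_exchange_assoc]
  simp

end Transpose

section Transpose

variable {A : Type u₁} [Bicategory.{w₁, v₁} A] {C : Type u₂} [Bicategory.{w₂, v₂} C]
  {G : C ⥤ᵖ A} {H : A ⥤ᵖ C} (η : Pseudofunctor.id C ⟶ G.comp H)

theorem map₂_leftUnitor_inv (D : A ⥤ᵖ C) {a b : A} (f : a ⟶ b) :
    D.map₂ (λ_ f).inv = (λ_ (D.map f)).inv ≫ (D.mapId a).inv ▷ D.map f ≫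
      (D.mapComp (𝟙 a) f).inv := by
  rw [← cancel_epi (D.map₂ (λ_ f).hom), ← D.map₂_comp]
  simp

/-- Interchange of `w` with itself gives the equation followed by one more copy of `w`, which is
cancelled since `w` is invertible. -/
theorem whiskerRight_comp_leftUnitor {a : A} {x : a ⟶ a} (w : x ≅ 𝟙 a) :
    w.hom ▷ x ≫ (λ_ x).hom = x ◁ w.hom ≫ (ρ_ x).hom := by
  have e := whisker_exchange w.hom w.hom
  simp only [id_whiskerLeft, whiskerRight_id] at e
  rw [← cancel_mono w.hom, ← cancel_mono (λ_ (𝟙 a)).inv]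
  simpa [unitors_equal] using e.symm

/-! ### The counit and the two triangle constraints -/

section Counit

variable (h : ∀ x, IsBiuniversal H (unitApp η x))

/-- The components of the counit. -/
noncomputable def cuApp (a : A) : G.obj (H.obj a) ⟶ a := (h (H.obj a)).desc (𝟙 (H.obj a))

/-- The second triangle constraint. -/
noncomputable def cuTri (a : A) : unitApp η (H.obj a) ≫ H.map (cuApp η h a) ≅ 𝟙 (H.obj a) :=
  ((h (H.obj a)).fac (𝟙 (H.obj a))).symm

/-- The transpose of the naturality constraint of the counit. -/
noncomputable def cuNatTransp {a b : A} (g : a ⟶ b) :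
    H.map g ≫ unitApp η (H.obj b) ≫ H.map (cuApp η h b) ≅
      unitApp η (H.obj a) ≫ H.map (cuApp η h a ≫ g) :=
  whiskerLeftIso (H.map g) (cuTri η h b) ≪≫ ρ_ _ ≪≫ (λ_ _).symm ≪≫
    whiskerRightIso (cuTri η h a).symm (H.map g) ≪≫ α_ _ _ _ ≪≫
    whiskerLeftIso _ (H.mapComp _ _).symm

/-- The naturality constraint of the counit. -/
noncomputable def cuNat {a b : A} (g : a ⟶ b) :
    G.map (H.map g) ≫ cuApp η h b ≅ cuApp η h a ≫ g :=
  (h (H.obj a)).liftIso ((transIso η (H.map g) (cuApp η h b)).symm ≪≫ cuNatTransp η h g)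

theorem transp_cuNat {a b : A} (g : a ⟶ b) :
    transp η (cuNat η h g).hom = (cuNatTransp η h g).hom := by
  simp [transp, cuNat]

/-- The counit. -/
noncomputable def cuTrans : H.comp G ⟶ Pseudofunctor.id A where
  app := cuApp η h
  naturality := cuNat η h
  naturality_naturality {a b f g} θ := by
    change G.map₂ (H.map₂ θ) ▷ cuApp η h b ≫ (cuNat η h g).hom =
      (cuNat η h f).hom ≫ cuApp η h a ◁ θ
    apply transp_ext (h _)
    rw [transp_map₂_whiskerRight, transp_comp, transp_cuNat, transp_cuNat]
    simp only [cuNatTransp, Iso.trans_hom, Iso.symm_hom, whiskerRightIso_hom, whiskerLeftIso_hom,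
      Category.assoc, H.map₂_whisker_left, whiskerLeft_comp, whiskerLeft_inv_hom_assoc]
    rw [← whisker_exchange_assoc, rightUnitor_naturality_assoc, leftUnitor_inv_naturality_assoc,
      whisker_exchange_assoc]
    simp
  naturality_id a := by
    change (cuNat η h (𝟙 a)).hom ≫ cuApp η h a ◁ 𝟙 (𝟙 a) =
      (G.map₂ (H.mapId a).hom ≫ (G.mapId (H.obj a)).hom) ▷ cuApp η h a ≫ (λ_ _).hom ≫ (ρ_ _).inv
    apply transp_ext (h _)
    rw [whiskerLeft_id, Category.comp_id, comp_whiskerRight, Category.assoc,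
      transp_map₂_whiskerRight, ← Category.assoc (_ ▷ _) (λ_ _).hom, transp_comp, transp_mapId,
      transp_cuNat]
    simp only [cuNatTransp, Iso.trans_hom, Iso.symm_hom, whiskerRightIso_hom, whiskerLeftIso_hom,
      map₂_ρ_inv, whiskerLeft_comp]
    rw [← cancel_mono (unitApp η (H.obj a) ◁ (H.mapComp (cuApp η h a) (𝟙 a)).hom),
      ← cancel_mono (unitApp η (H.obj a) ◁ H.map (cuApp η h a) ◁ (H.mapId a).hom)]
    simp only [Category.assoc, whiskerLeft_inv_hom, Category.comp_id]
    rw [← associator_naturality_right, ← whisker_exchange_assoc, ← leftUnitor_inv_naturality_assoc,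
      ← rightUnitor_naturality_assoc, whisker_exchange_assoc]
    simp
  naturality_comp {a b c} f g := by
    change (cuNat η h (f ≫ g)).hom ≫ cuApp η h a ◁ 𝟙 (f ≫ g) =
      (G.map₂ (H.mapComp f g).hom ≫ (G.mapComp (H.map f) (H.map g)).hom) ▷ cuApp η h c ≫
        (α_ _ _ _).hom ≫ G.map (H.map f) ◁ (cuNat η h g).hom ≫ (α_ _ _ _).inv ≫
        (cuNat η h f).hom ▷ g ≫ (α_ _ _ _).hom
    apply transp_ext (h _)
    rw [whiskerLeft_id, Category.comp_id, comp_whiskerRight, Category.assoc,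
      transp_map₂_whiskerRight, transp_mapComp, ← Category.assoc (α_ _ _ _).inv, transp_comp,
      transp_whiskerRight, transp_cuNat, transp_cuNat, transp_cuNat]
    simp only [cuNatTransp, Iso.trans_hom, Iso.symm_hom, whiskerRightIso_hom, whiskerLeftIso_hom,
      Category.assoc, H.map₂_associator, whiskerLeft_comp, comp_whiskerRight]
    rw [← cancel_mono (unitApp η (H.obj a) ◁ (H.mapComp (cuApp η h a) (f ≫ g)).hom),
      ← cancel_mono (unitApp η (H.obj a) ◁ H.map (cuApp η h a) ◁ (H.mapComp f g).hom)]
    simp only [Category.assoc, whiskerLeft_inv_hom, Category.comp_id]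
    rw [← associator_naturality_right, ← whisker_exchange_assoc, ← leftUnitor_inv_naturality_assoc,
      ← rightUnitor_naturality_assoc, whisker_exchange_assoc]
    simp

/-- The comparison `ρ_x ≫ H (𝟙) ≅ ρ_x`, precomposed with the second triangle constraint. -/
noncomputable def triTransp (x : C) :
    unitApp η x ≫ unitApp η (H.obj (G.obj x)) ≫ H.map (cuApp η h (G.obj x)) ≅
      unitApp η x ≫ H.map (𝟙 (G.obj x)) :=
  whiskerLeftIso (unitApp η x) (cuTri η h (G.obj x) ≪≫ (H.mapId (G.obj x)).symm)

/-- The inverse of the first triangle constraint. -/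
noncomputable def unTri (x : C) :
    G.map (unitApp η x) ≫ cuApp η h (G.obj x) ≅ 𝟙 (G.obj x) :=
  (h x).liftIso ((transIso η (unitApp η x) (cuApp η h (G.obj x))).symm ≪≫ triTransp η h x)

theorem transp_unTri (x : C) : transp η (unTri η h x).hom = (triTransp η h x).hom := by
  simp [transp, unTri]

/-- After transposition both sides contain only `unitNat η f` and the second triangle constraints.
The one non-formal step is the interchange of `unitNat η f` with `cuTri` at `G y`. -/
theorem unTri_naturality {x y : C} (f : x ⟶ y) :
    G.map₂ (unitNat η f).hom ▷ cuApp η h (G.obj y) ≫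
        (G.mapComp (unitApp η x) (H.map (G.map f))).hom ▷ cuApp η h (G.obj y) ≫
        (α_ _ _ _).hom ≫ G.map (unitApp η x) ◁ (cuNat η h (G.map f)).hom ≫ (α_ _ _ _).inv ≫
        (unTri η h x).hom ▷ G.map f =
      (G.mapComp f (unitApp η y)).hom ▷ cuApp η h (G.obj y) ≫ (α_ _ _ _).hom ≫
        G.map f ◁ (unTri η h y).hom ≫ (ρ_ (G.map f)).hom ≫ (λ_ (G.map f)).inv := by
  apply transp_ext (h _)
  rw [transp_map₂_whiskerRight, transp_mapComp, transp_mapComp, transp_whiskerRight,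
    transp_unitor, transp_cuNat, transp_unTri, transp_unTri]
  simp only [cuNatTransp, triTransp, Iso.trans_hom, Iso.symm_hom, whiskerRightIso_hom,
    whiskerLeftIso_hom, Category.assoc, whiskerLeft_comp, comp_whiskerRight]
  have e := whisker_exchange (unitNat η f).hom (cuTri η h (G.obj y)).hom
  simp only [comp_whiskerLeft, whiskerRight_comp, whiskerRight_id, Category.assoc] at e
  simp only [map₂_leftUnitor_inv, whiskerRight_comp, Category.assoc]
  simp
  rw [← reassoc_of% e]
  simp

/-- This is the second coherence axiom with the inverses cleared. The transposes of its sides differ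
by whiskering `cuTri a` on the left or on the right with its own source, and
`whiskerRight_comp_leftUnitor` identifies the two. -/
theorem cuNat_cuApp (a : A) :
    G.map₂ (cuTri η h a).hom ▷ cuApp η h a ≫ (G.mapId (H.obj a)).hom ▷ cuApp η h a ≫
        (λ_ _).hom =
      (G.mapComp (unitApp η (H.obj a)) (H.map (cuApp η h a))).hom ▷ cuApp η h a ≫
        (α_ _ _ _).hom ≫ G.map (unitApp η (H.obj a)) ◁ (cuNat η h (cuApp η h a)).hom ≫
        ((α_ _ _ _).inv ≫ (unTri η h (H.obj a)).hom ▷ cuApp η h a) ≫ (λ_ _).hom := by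
  apply transp_ext (h _)
  rw [transp_map₂_whiskerRight, transp_mapId, transp_mapComp, transp_comp, transp_whiskerRight,
    transp_cuNat, transp_unTri]
  simp only [cuNatTransp, triTransp, Iso.trans_hom, Iso.symm_hom, whiskerRightIso_hom,
    whiskerLeftIso_hom, Category.assoc, whiskerLeft_comp, comp_whiskerRight, H.map₂_left_unitor]
  have e := whiskerRight_comp_leftUnitor (cuTri η h a)
  simp only [comp_whiskerLeft, whiskerRight_comp, Category.assoc] at e
  simp [e]

/-- A pseudonatural transformation `Id ⟶ HG` whose components are biuniversal arrows is the unit of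
a biadjunction `G ⊣ H`. -/
noncomputable def biadjunctionOfBiuniversal : Biadjunction G H where
  unit := η
  counit := cuTrans η h
  v x := (unTri η h x).symm
  v_naturality {x y} f := by
    have e := unTri_naturality η h f
    change G.map f ◁ (unTri η h y).inv ≫ (α_ _ _ _).inv ≫
        (G.mapComp f (unitApp η y)).inv ▷ cuApp η h (G.obj y) ≫
        G.map₂ (unitNat η f).hom ▷ cuApp η h (G.obj y) ≫
        (G.mapComp (unitApp η x) (H.map (G.map f))).hom ▷ cuApp η h (G.obj y) ≫
        (α_ _ _ _).hom ≫ G.map (unitApp η x) ◁ (cuNat η h (G.map f)).hom ≫ (α_ _ _ _).inv =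
      (ρ_ (G.map f)).hom ≫ (λ_ (G.map f)).inv ≫ (unTri η h x).inv ▷ G.map f
    rw [← cancel_mono ((unTri η h x).hom ▷ G.map f)]
    simp only [Category.assoc, e]
    simp
  w := cuTri η h
  -- Unfolding the transpose of `cuNat` gives this axiom: `cuNat` was chosen as its unique solution.
  w_naturality {a b} g := by
    have e := transp_cuNat η h g
    change H.map g ◁ (cuTri η h b).hom ≫ (ρ_ (H.map g)).hom ≫ (λ_ (H.map g)).inv =
      (α_ _ _ _).inv ≫ (unitNat η (H.map g)).hom ▷ H.map (cuApp η h b) ≫ (α_ _ _ _).hom ≫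
        unitApp η (H.obj a) ◁ ((H.mapComp (G.map (H.map g)) (cuApp η h b)).inv ≫
          H.map₂ (cuNat η h g).hom ≫ (H.mapComp (cuApp η h a) g).hom) ≫
        (α_ _ _ _).inv ≫ (cuTri η h a).hom ▷ H.map g
    simp only [transp, transIso, cuNatTransp, Iso.trans_hom, Iso.symm_hom, whiskerRightIso_hom,
      whiskerLeftIso_hom, Category.assoc] at e
    simp only [whiskerLeft_comp, Category.assoc]
    rw [reassoc_of% e]
    simp
  -- The first coherence axiom is the equation that defines `unTri`, solved for its inverse.
  coherence_unit x := by
    have e := transp_unTri η h x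
    change (ρ_ (unitApp η x)).inv ≫
        unitApp η x ◁ ((H.mapId (G.obj x)).inv ≫ H.map₂ (unTri η h x).inv ≫
          (H.mapComp (G.map (unitApp η x)) (cuApp η h (G.obj x))).hom) ≫
        (α_ _ _ _).inv ≫
        (unitNat η (unitApp η x)).inv ▷ H.map (cuApp η h (G.obj x)) ≫
        (α_ _ _ _).hom ≫ unitApp η x ◁ (cuTri η h (G.obj x)).hom ≫ (ρ_ (unitApp η x)).hom =
      𝟙 (unitApp η x)
    have e' : (triTransp η h x).hom ≫ unitApp η x ◁ H.map₂ (unTri η h x).inv =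
        (transIso η _ _).hom := by
      rw [← e, transp, Category.assoc, ← whiskerLeft_comp, ← H.map₂_comp]
      simp
    have e'' : unitApp η x ◁ H.map₂ (unTri η h x).inv =
        (triTransp η h x).inv ≫ (transIso η _ _).hom := by
      rw [← e', Iso.inv_hom_id_assoc]
    simp only [whiskerLeft_comp, Category.assoc, reassoc_of% e'']
    simp [transIso, triTransp]
  coherence_counit a := by
    have e := cuNat_cuApp η h a
    change (λ_ (cuApp η h a)).inv ≫ (unTri η h (H.obj a)).inv ▷ cuApp η h a ≫ (α_ _ _ _).hom ≫
        G.map (unitApp η (H.obj a)) ◁ (cuNat η h (cuApp η h a)).inv ≫ (α_ _ _ _).inv ≫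
        ((G.mapComp (unitApp η (H.obj a)) (H.map (cuApp η h a))).inv ≫ G.map₂ (cuTri η h a).hom ≫
          (G.mapId (H.obj a)).hom) ▷ cuApp η h a ≫ (λ_ (cuApp η h a)).hom =
      𝟙 (cuApp η h a)
    simp only [comp_whiskerRight, Category.assoc, e]
    simp

end Counit

end Transpose

section LeftBiadjoint

variable {A : Type u₁} [Bicategory.{w₁, v₁} A] {C : Type u₂} [Bicategory.{w₂, v₂} C]
  {H : A ⥤ᵖ C}

/-- Biuniversal arrows `y ⟶ H (L y)` for all `y` give a left biadjoint with values `L y`. -/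
theorem exists_biadjunction (L : C → A) (η : ∀ y, y ⟶ H.obj (L y))
    (h : ∀ y, IsBiuniversal H (η y)) :
    ∃ G : C ⥤ᵖ A, (∀ y, G.obj y = L y) ∧ Nonempty (Biadjunction G H) :=
  ⟨lbPF h, fun _ => rfl, ⟨biadjunctionOfBiuniversal (lbUnit h) h⟩⟩

end LeftBiadjoint

/-! ### Units of biadjunctions are biuniversal -/

section BiuniversalOfBiadjunction

variable {A : Type u₁} [Bicategory.{w₁, v₁} A] {B : Type u₂} [Bicategory.{w₂, v₂} B]
  {E : B ⥤ᵖ A} {R : A ⥤ᵖ B}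

theorem counitNat_map₂ (θ : R.comp E ⟶ Pseudofunctor.id A) {a b : A} {f g : a ⟶ b} (α : f ⟶ g) :
    E.map₂ (R.map₂ α) ▷ counitApp θ b ≫ (counitNat θ g).hom =
      (counitNat θ f).hom ≫ counitApp θ a ◁ α :=
  θ.naturality_naturality α

/-- The components of the unit of a biadjunction are biuniversal arrows. -/
theorem Biadjunction.isBiuniversal (b : Biadjunction E R) (x : B) :
    IsBiuniversal R (unitApp b.unit x) := fun a => by
  -- The quasi-inverse is `g ↦ ε_a ∘ E g`. The constraint `v` with naturality of the counit gives
  -- one natural isomorphism, and `w` with naturality of the unit gives the other. `Equivalence.mk`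
  -- corrects them to satisfy the triangle identity.
  let P : (x ⟶ R.obj a) ⥤ (E.obj x ⟶ a) :=
    { obj := fun g => E.map g ≫ counitApp b.counit a
      map := fun α => E.map₂ α ▷ counitApp b.counit a }
  let i₁ : 𝟭 _ ≅ precompMap R (unitApp b.unit x) a ⋙ P :=
    NatIso.ofComponents (fun f => (λ_ f).symm ≪≫ whiskerRightIso (b.v x) f ≪≫ α_ _ _ _ ≪≫
      whiskerLeftIso _ (counitNat b.counit f).symm ≪≫ (α_ _ _ _).symm ≪≫
      whiskerRightIso (E.mapComp (unitApp b.unit x) (R.map f)).symm (counitApp b.counit a)) (by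
      intro f g α
      have e := counitNat_map₂ b.counit α
      have e' : (counitNat b.counit f).inv ≫ E.map₂ (R.map₂ α) ▷ counitApp b.counit a =
          counitApp b.counit _ ◁ α ≫ (counitNat b.counit g).inv := by
        rw [Iso.inv_comp_eq, ← reassoc_of% e, Iso.hom_inv_id, Category.comp_id]
      change α ≫ (λ_ g).inv ≫ (b.v x).hom ▷ g ≫ (α_ _ _ _).hom ≫
          E.map (unitApp b.unit x) ◁ (counitNat b.counit g).inv ≫ (α_ _ _ _).inv ≫
          (E.mapComp _ (R.map g)).inv ▷ counitApp b.counit a =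
        ((λ_ f).inv ≫ (b.v x).hom ▷ f ≫ (α_ _ _ _).hom ≫
          E.map (unitApp b.unit x) ◁ (counitNat b.counit f).inv ≫ (α_ _ _ _).inv ≫
          (E.mapComp _ (R.map f)).inv ▷ counitApp b.counit a) ≫
        E.map₂ (unitApp b.unit x ◁ R.map₂ α) ▷ counitApp b.counit a
      simp only [E.map₂_whisker_left, comp_whiskerRight, Category.assoc,
        inv_hom_whiskerRight_assoc]
      rw [← associator_inv_naturality_middle_assoc, ← whiskerLeft_comp_assoc (E.map _), e',
        leftUnitor_inv_naturality_assoc, whisker_exchange_assoc]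
      simp)
  let i₂ : P ⋙ precompMap R (unitApp b.unit x) a ≅ 𝟭 _ :=
    NatIso.ofComponents (fun g => whiskerLeftIso _ (R.mapComp _ _) ≪≫ (α_ _ _ _).symm ≪≫
      whiskerRightIso (unitNat b.unit g).symm _ ≪≫ α_ _ _ _ ≪≫ whiskerLeftIso g (b.w a) ≪≫ ρ_ g) (by
      intro f g α
      have e := unitNat_map₂ b.unit α
      have e' : unitApp b.unit x ◁ R.map₂ (E.map₂ α) ≫ (unitNat b.unit g).inv =
          (unitNat b.unit f).inv ≫ α ▷ unitApp b.unit _ := by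
        rw [Iso.eq_inv_comp, reassoc_of% e, Iso.hom_inv_id, Category.comp_id]
      change unitApp b.unit x ◁ R.map₂ (E.map₂ α ▷ counitApp b.counit a) ≫
          unitApp b.unit x ◁ (R.mapComp _ _).hom ≫ (α_ _ _ _).inv ≫
          (unitNat b.unit g).inv ▷ R.map (counitApp b.counit a) ≫ (α_ _ _ _).hom ≫
          g ◁ (b.w a).hom ≫ (ρ_ g).hom =
        (unitApp b.unit x ◁ (R.mapComp _ _).hom ≫ (α_ _ _ _).inv ≫
          (unitNat b.unit f).inv ▷ R.map (counitApp b.counit a) ≫ (α_ _ _ _).hom ≫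
          f ◁ (b.w a).hom ≫ (ρ_ f).hom) ≫ α
      simp only [R.map₂_whisker_right, whiskerLeft_comp,
        Category.assoc, whiskerLeft_inv_hom_assoc]
      rw [associator_inv_naturality_middle_assoc, ← comp_whiskerRight_assoc (_ ◁ _), e']
      simp only [comp_whiskerRight, Category.assoc]
      rw [associator_naturality_left_assoc, ← whisker_exchange_assoc, rightUnitor_naturality])
  exact (CategoryTheory.Equivalence.mk _ P i₁ i₂).isEquivalence_functor

end BiuniversalOfBiadjunction

/-! ### Elementwise calculus for `Cat`-valued pseudofunctors -/

section CatValued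

variable {B : Type u₁} [Bicategory.{w₁, v₁} B]

/-- The action of a 1-cell on a `Cat`-valued pseudofunctor, as a functor. -/
abbrev fn (F : B ⥤ᵖ Cat.{v, u}) {a b : B} (f : a ⟶ b) : F.obj a ⥤ F.obj b := (F.map f).toFunctor

/-- The action of a 2-cell on a `Cat`-valued pseudofunctor, at an element. -/
abbrev fn₂ (F : B ⥤ᵖ Cat.{v, u}) {a b : B} {f g : a ⟶ b} (α : f ⟶ g) (x : F.obj a) :
    (fn F f).obj x ⟶ (fn F g).obj x := (F.map₂ α).toNatTrans.app x

/-- The unit constraint of a `Cat`-valued pseudofunctor, at an element. -/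
def fnId (F : B ⥤ᵖ Cat.{v, u}) (a : B) (x : F.obj a) : (fn F (𝟙 a)).obj x ≅ x :=
  (Cat.Hom.toNatIso (F.mapId a)).app x

/-- The composition constraint of a `Cat`-valued pseudofunctor, at an element. -/
def fnComp (F : B ⥤ᵖ Cat.{v, u}) {a b c : B} (f : a ⟶ b) (g : b ⟶ c) (x : F.obj a) :
    (fn F (f ≫ g)).obj x ≅ (fn F g).obj ((fn F f).obj x) :=
  (Cat.Hom.toNatIso (F.mapComp f g)).app x

/-- The naturality constraint of a pseudonatural transformation of `Cat`-valued pseudofunctors, at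
an element. -/
def natApp {F G : B ⥤ᵖ Cat.{v, u}} (τ : F ⟶ G) {a b : B} (f : a ⟶ b) (x : F.obj a) :
    (τ.app b).toFunctor.obj ((fn F f).obj x) ≅ (fn G f).obj ((τ.app a).toFunctor.obj x) :=
  (Cat.Hom.toNatIso (τ.naturality f)).app x

section Laws

variable (F : B ⥤ᵖ Cat.{v, u}) {a b c d : B}

@[simp]
theorem fn₂_id (f : a ⟶ b) (x : F.obj a) : fn₂ F (𝟙 f) x = 𝟙 _ := by
  simp [fn₂]

theorem fn₂_comp {f g h : a ⟶ b} (α : f ⟶ g) (β : g ⟶ h) (x : F.obj a) :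
    fn₂ F (α ≫ β) x = fn₂ F α x ≫ fn₂ F β x := by
  simp [fn₂]

theorem fn₂_naturality {f g : a ⟶ b} (α : f ⟶ g) {x y : F.obj a} (φ : x ⟶ y) :
    (fn F f).map φ ≫ fn₂ F α y = fn₂ F α x ≫ (fn F g).map φ :=
  (F.map₂ α).toNatTrans.naturality φ

theorem fnId_naturality {x y : F.obj a} (φ : x ⟶ y) :
    (fn F (𝟙 a)).map φ ≫ (fnId F a y).hom = (fnId F a x).hom ≫ φ :=
  (F.mapId a).hom.toNatTrans.naturality φ

theorem fnComp_naturality (f : a ⟶ b) (g : b ⟶ c) {x y : F.obj a} (φ : x ⟶ y) :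
    (fn F (f ≫ g)).map φ ≫ (fnComp F f g y).hom =
      (fnComp F f g x).hom ≫ (fn F g).map ((fn F f).map φ) :=
  (F.mapComp f g).hom.toNatTrans.naturality φ

theorem fnComp_whiskerLeft (f : a ⟶ b) {g g' : b ⟶ c} (β : g ⟶ g') (x : F.obj a) :
    fn₂ F (f ◁ β) x ≫ (fnComp F f g' x).hom =
      (fnComp F f g x).hom ≫ fn₂ F β ((fn F f).obj x) := by
  have e : F.map₂ (f ◁ β) ≫ (F.mapComp f g').hom = (F.mapComp f g).hom ≫ F.map f ◁ F.map₂ β := by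
    simp
  exact congr(($e).toNatTrans.app x)

theorem fnComp_whiskerRight {f f' : a ⟶ b} (α : f ⟶ f') (g : b ⟶ c) (x : F.obj a) :
    fn₂ F (α ▷ g) x ≫ (fnComp F f' g x).hom =
      (fnComp F f g x).hom ≫ (fn F g).map (fn₂ F α x) := by
  have e : F.map₂ (α ▷ g) ≫ (F.mapComp f' g).hom = (F.mapComp f g).hom ≫ F.map₂ α ▷ F.map g := by
    simp
  exact congr(($e).toNatTrans.app x)

theorem fnComp_associator (f : a ⟶ b) (g : b ⟶ c) (h : c ⟶ d) (x : F.obj a) :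
    fn₂ F (α_ f g h).hom x ≫ (fnComp F f (g ≫ h) x).hom ≫ (fnComp F g h ((fn F f).obj x)).hom =
      (fnComp F (f ≫ g) h x).hom ≫ (fn F h).map (fnComp F f g x).hom := by
  have e : F.map₂ (α_ f g h).hom ≫ (F.mapComp f (g ≫ h)).hom ≫ F.map f ◁ (F.mapComp g h).hom =
    (F.mapComp (f ≫ g) h).hom ≫ (F.mapComp f g).hom ▷ F.map h ≫ (α_ _ _ _).hom := by
    simp
  have e' := congr(($e).toNatTrans.app x)
  -- Associators and unitors of `Cat` have identity components, so the evaluated equation carries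
  -- identities that are removed by hand, here and below.
  exact e'.trans (congrArg ((fnComp F (f ≫ g) h x).hom ≫ ·) (Category.comp_id _))

theorem fnComp_rightUnitor (f : a ⟶ b) (x : F.obj a) :
    (fnComp F f (𝟙 b) x).hom ≫ (fnId F b ((fn F f).obj x)).hom = fn₂ F (ρ_ f).hom x := by
  have e := F.map₂_right_unitor f
  have e' := congr(($e).toNatTrans.app x)
  exact (e'.trans (congrArg ((fnComp F f (𝟙 b) x).hom ≫ ·) (Category.comp_id _))).symm

variable {F} {G : B ⥤ᵖ Cat.{v, u}} (τ : F ⟶ G)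

theorem natApp_naturality (f : a ⟶ b) {x y : F.obj a} (φ : x ⟶ y) :
    (τ.app b).toFunctor.map ((fn F f).map φ) ≫ (natApp τ f y).hom =
      (natApp τ f x).hom ≫ (fn G f).map ((τ.app a).toFunctor.map φ) :=
  (τ.naturality f).hom.toNatTrans.naturality φ

theorem natApp_map₂ {f g : a ⟶ b} (α : f ⟶ g) (x : F.obj a) :
    (τ.app b).toFunctor.map (fn₂ F α x) ≫ (natApp τ g x).hom =
      (natApp τ f x).hom ≫ fn₂ G α ((τ.app a).toFunctor.obj x) := by
  have e := τ.naturality_naturality α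
  exact congr(($e).toNatTrans.app x)

theorem natApp_id (a : B) (x : F.obj a) :
    (natApp τ (𝟙 a) x).hom ≫ (fnId G a ((τ.app a).toFunctor.obj x)).hom =
      (τ.app a).toFunctor.map (fnId F a x).hom := by
  have e := τ.naturality_id a
  have e' := congr(($e).toNatTrans.app x)
  refine e'.trans ?_
  change (τ.app a).toFunctor.map (fnId F a x).hom ≫ 𝟙 _ ≫ 𝟙 _ = _
  rw [Category.comp_id, Category.comp_id]

theorem natApp_comp (f : a ⟶ b) (g : b ⟶ c) (x : F.obj a) :
    (natApp τ (f ≫ g) x).hom ≫ (fnComp G f g ((τ.app a).toFunctor.obj x)).hom =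
      (τ.app c).toFunctor.map (fnComp F f g x).hom ≫ (natApp τ g ((fn F f).obj x)).hom ≫
        (fn G g).map (natApp τ f x).hom := by
  have e := τ.naturality_comp f g
  have e' := congr(($e).toNatTrans.app x)
  refine e'.trans ?_
  change (τ.app c).toFunctor.map (fnComp F f g x).hom ≫ 𝟙 _ ≫
    (natApp τ g ((fn F f).obj x)).hom ≫ 𝟙 _ ≫ (fn G g).map (natApp τ f x).hom ≫ 𝟙 _ = _
  simp only [Category.comp_id, Category.id_comp]

end Laws

/-- A pseudonatural transformation of `Cat`-valued pseudofunctors, from elementwise data. -/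
def catTrans {F G : B ⥤ᵖ Cat.{v, u}} (app : ∀ a, F.obj a ⥤ G.obj a)
    (nat : ∀ {a b : B} (f : a ⟶ b) (x : F.obj a),
      (app b).obj ((fn F f).obj x) ≅ (fn G f).obj ((app a).obj x))
    (nat_naturality : ∀ {a b : B} (f : a ⟶ b) {x y : F.obj a} (φ : x ⟶ y),
      (app b).map ((fn F f).map φ) ≫ (nat f y).hom =
        (nat f x).hom ≫ (fn G f).map ((app a).map φ))
    (nat_map₂ : ∀ {a b : B} {f g : a ⟶ b} (α : f ⟶ g) (x : F.obj a),
      (app b).map (fn₂ F α x) ≫ (nat g x).hom = (nat f x).hom ≫ fn₂ G α ((app a).obj x))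
    (nat_id : ∀ (a : B) (x : F.obj a),
      (nat (𝟙 a) x).hom ≫ (fnId G a ((app a).obj x)).hom = (app a).map (fnId F a x).hom)
    (nat_comp : ∀ {a b c : B} (f : a ⟶ b) (g : b ⟶ c) (x : F.obj a),
      (nat (f ≫ g) x).hom ≫ (fnComp G f g ((app a).obj x)).hom =
        (app c).map (fnComp F f g x).hom ≫ (nat g ((fn F f).obj x)).hom ≫
          (fn G g).map (nat f x).hom) : F ⟶ G where
  app a := (app a).toCatHom
  naturality {a b} f := Cat.Hom.isoMk (F := (fn F f) ⋙ app b) (G := app a ⋙ fn G f)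
    (NatIso.ofComponents (fun x => nat f x) (fun φ => nat_naturality f φ))
  naturality_naturality {a b f g} α :=
    Cat.Hom₂.ext (NatTrans.ext (funext fun x => nat_map₂ α x))
  naturality_id a := by
    refine Cat.Hom₂.ext (NatTrans.ext (funext fun x => (nat_id a x).trans ?_))
    change _ = (app a).map (fnId F a x).hom ≫ 𝟙 _ ≫ 𝟙 _
    rw [Category.comp_id, Category.comp_id]
  naturality_comp {a b c} f g := by
    refine Cat.Hom₂.ext (NatTrans.ext (funext fun x => (nat_comp f g x).trans ?_))
    change _ = (app c).map (fnComp F f g x).hom ≫ 𝟙 _ ≫ (nat g ((fn F f).obj x)).hom ≫ 𝟙 _ ≫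
      (fn G g).map (nat f x).hom ≫ 𝟙 _
    simp only [Category.comp_id, Category.id_comp]

end CatValued

section CatValued

variable {B : Type u₁} [Bicategory.{w₁, v₁} B]

/-! ### Inverting a pseudonatural equivalence -/

section Inverse

variable {F G : B ⥤ᵖ Cat.{v, u}} (τ : F ⟶ G) (h : ∀ x, (τ.app x).toFunctor.IsEquivalence)

/-- The components of a pseudonatural equivalence, as equivalences of categories. -/
noncomputable def compEquiv (a : B) : CategoryTheory.Equivalence (F.obj a) (G.obj a) :=
  haveI := h a
  (τ.app a).toFunctor.asEquivalence

/-- The components of the inverse of a pseudonatural equivalence. -/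
noncomputable def invApp (a : B) : G.obj a ⥤ F.obj a := (compEquiv τ h a).inverse

/-- The counit of the components of a pseudonatural equivalence. -/
noncomputable def invCounit (a : B) (x : G.obj a) :
    (τ.app a).toFunctor.obj ((invApp τ h a).obj x) ≅ x :=
  (compEquiv τ h a).counitIso.app x

theorem invCounit_naturality {a : B} {x y : G.obj a} (φ : x ⟶ y) :
    (τ.app a).toFunctor.map ((invApp τ h a).map φ) ≫ (invCounit τ h a y).hom =
      (invCounit τ h a x).hom ≫ φ :=
  (compEquiv τ h a).counitIso.hom.naturality φ

/-- The naturality constraint of the inverse of a pseudonatural equivalence. -/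
noncomputable def invNat {a b : B} (f : a ⟶ b) (x : G.obj a) :
    (invApp τ h b).obj ((fn G f).obj x) ≅ (fn F f).obj ((invApp τ h a).obj x) :=
  haveI := h b
  (τ.app b).toFunctor.preimageIso (invCounit τ h b _ ≪≫
    (fn G f).mapIso (invCounit τ h a x).symm ≪≫ (natApp τ f ((invApp τ h a).obj x)).symm)

/-- The defining equation of `invNat`: its image under `τ`, followed by this invertible tail,
collapses to the counit. Every axiom of the inverse is verified by appending the tail and using this
equation. -/
theorem map_invNat {a b : B} (f : a ⟶ b) (x : G.obj a) :
    (τ.app b).toFunctor.map (invNat τ h f x).hom ≫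
      (natApp τ f ((invApp τ h a).obj x)).hom ≫ (fn G f).map (invCounit τ h a x).hom =
      (invCounit τ h b _).hom := by
  simp [invNat, ← Functor.map_comp]

include h in
theorem inv_ext {a b : B} {f : a ⟶ b} {x : G.obj a} {y : F.obj b}
    {φ ψ : y ⟶ (fn F f).obj ((invApp τ h a).obj x)}
    (e : (τ.app b).toFunctor.map φ ≫
      (natApp τ f ((invApp τ h a).obj x)).hom ≫ (fn G f).map (invCounit τ h a x).hom =
      (τ.app b).toFunctor.map ψ ≫
      (natApp τ f ((invApp τ h a).obj x)).hom ≫ (fn G f).map (invCounit τ h a x).hom) : φ = ψ :=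
  haveI := h b
  (τ.app b).toFunctor.map_injective ((cancel_mono _).1 e)

/-- The inverse of a pseudonatural equivalence. -/
noncomputable def invTrans : G ⟶ F :=
  catTrans (invApp τ h) (invNat τ h)
    (fun f x y φ => by
      apply inv_ext
      simp only [Functor.map_comp, Category.assoc, map_invNat, invCounit_naturality,
        reassoc_of% @natApp_naturality]
      simp only [← Functor.map_comp, invCounit_naturality]
      simp only [Functor.map_comp, reassoc_of% @map_invNat])
    (fun {a b f g} α x => by
      apply inv_ext
      simp only [Functor.map_comp, Category.assoc, map_invNat, invCounit_naturality,
        reassoc_of% @natApp_map₂]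
      rw [← fn₂_naturality, reassoc_of% @map_invNat])
    (fun a x => by
      have := h a
      apply (τ.app a).toFunctor.map_injective
      rw [← cancel_mono (invCounit τ h a x).hom, invCounit_naturality, Functor.map_comp,
        ← natApp_id, Category.assoc, Category.assoc, ← fnId_naturality, reassoc_of% @map_invNat])
    (fun {a b c} f g x => by
      have := h c
      apply (τ.app c).toFunctor.map_injective
      rw [← cancel_mono (natApp τ g _).hom, ← cancel_mono ((fn G g).map (natApp τ f _).hom),
        ← cancel_mono ((fn G g).map ((fn G f).map (invCounit τ h a x).hom))]
      simp only [Functor.map_comp, Category.assoc]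
      rw [← reassoc_of% @natApp_comp, ← fnComp_naturality, reassoc_of% @map_invNat,
        reassoc_of% @natApp_naturality]
      simp only [← Functor.map_comp]
      rw [map_invNat, map_invNat, invCounit_naturality])

theorem invTrans_isEquivalence (a : B) : ((invTrans τ h).app a).toFunctor.IsEquivalence :=
  (compEquiv τ h a).isEquivalence_inverse

/-- The composite of a pseudonatural equivalence after its inverse is the identity, up to an
invertible modification. -/
noncomputable def invTransComp : invTrans τ h ≫ τ ≅ 𝟙 G :=
  Pseudofunctor.StrongTrans.isoMk
    (fun a => Cat.Hom.isoMk (F := invApp τ h a ⋙ (τ.app a).toFunctor) (G := 𝟭 (G.obj a))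
      (NatIso.ofComponents (fun x => invCounit τ h a x) (fun φ => invCounit_naturality τ h φ)))
    (fun {a b} f => by
      refine Cat.Hom₂.ext (NatTrans.ext (funext fun (x : G.obj a) => ?_))
      change (invCounit τ h b _).hom ≫ 𝟙 _ ≫ 𝟙 _ = (𝟙 _ ≫
        (τ.app b).toFunctor.map (invNat τ h f x).hom ≫ 𝟙 _ ≫
          (natApp τ f ((invApp τ h a).obj x)).hom ≫ 𝟙 _) ≫ (fn G f).map (invCounit τ h a x).hom
      simp [map_invNat])

end Inverse

/-! ### Postcomposition with a pseudonatural equivalence -/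

section Postcomposition

variable {S : Type u₂} [Bicategory.{w₂, v₂} S] {F G : S ⥤ᵖ Cat.{v, u}}

/-- Postcomposition with a pseudonatural equivalence is an equivalence of categories. -/
theorem postcomp_isEquivalence (W : S ⥤ᵖ Cat.{v, u}) (τ : F ⟶ G)
    (h : ∀ x, (τ.app x).toFunctor.IsEquivalence) : (postcomp W τ).IsEquivalence where
  faithful := ⟨fun {σ σ'} Γ Γ' e => by
    refine Pseudofunctor.StrongTrans.homCategory.ext fun a => ?_
    have := h a
    refine Cat.Hom₂.ext (NatTrans.ext (funext fun x => (τ.app a).toFunctor.map_injective ?_))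
    exact congr((($e).as.app a).toNatTrans.app x)⟩
  -- Preimages are chosen at each component and each object. Their naturality and the modification
  -- axiom are then consequences of faithfulness of the components of `τ`.
  full := ⟨fun {σ σ'} Γ => by
    have key : ∀ a, ∃ γ : σ.app a ⟶ σ'.app a, γ ▷ τ.app a = Γ.as.app a := fun a => by
      have := h a
      have key : ∀ x, ∃ p : (σ.app a).toFunctor.obj x ⟶ (σ'.app a).toFunctor.obj x,
          (τ.app a).toFunctor.map p = (Γ.as.app a).toNatTrans.app x :=
        fun x => (τ.app a).toFunctor.map_surjective _
      choose p hp using key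
      refine ⟨⟨{ app := p, naturality := fun x y φ => (τ.app a).toFunctor.map_injective ?_ }⟩,
        Cat.Hom₂.ext (NatTrans.ext (funext hp))⟩
      rw [Functor.map_comp, Functor.map_comp, hp, hp]
      exact (Γ.as.app a).toNatTrans.naturality φ
    choose γ hγ using key
    have hγ' : ∀ a x, (τ.app a).toFunctor.map ((γ a).toNatTrans.app x) =
        (Γ.as.app a).toNatTrans.app x := fun a x => congr(($(hγ a)).toNatTrans.app x)
    refine ⟨⟨⟨γ, fun {a b} f => ?_⟩⟩, ?_⟩
    · refine Cat.Hom₂.ext (NatTrans.ext (funext fun x => ?_))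
      have := h b
      apply (τ.app b).toFunctor.map_injective
      have e := congr(($(Γ.as.naturality f)).toNatTrans.app x)
      change (τ.app b).toFunctor.map ((γ b).toNatTrans.app ((fn W f).obj x) ≫ (natApp σ' f x).hom) =
        (τ.app b).toFunctor.map ((natApp σ f x).hom ≫ (fn F f).map ((γ a).toNatTrans.app x))
      replace e : (Γ.as.app b).toNatTrans.app ((fn W f).obj x) ≫ (𝟙 _ ≫
          (τ.app b).toFunctor.map (natApp σ' f x).hom ≫ 𝟙 _ ≫
            (natApp τ f ((σ'.app a).toFunctor.obj x)).hom ≫ 𝟙 _) =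
          (𝟙 _ ≫ (τ.app b).toFunctor.map (natApp σ f x).hom ≫ 𝟙 _ ≫
            (natApp τ f ((σ.app a).toFunctor.obj x)).hom ≫ 𝟙 _) ≫
            (fn G f).map ((Γ.as.app a).toNatTrans.app x) := e
      rw [← cancel_mono (natApp τ f _).hom]
      simp only [Category.id_comp, Category.comp_id, Category.assoc] at e
      rw [Functor.map_comp, Functor.map_comp, Category.assoc, Category.assoc, natApp_naturality,
        hγ', hγ']
      exact e
    · exact Pseudofunctor.StrongTrans.homCategory.ext hγ⟩
  -- A one-sided inverse of `τ` suffices: full faithfulness has already been checked on components.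
  essSurj := ⟨fun σ => ⟨σ ≫ invTrans τ h,
    ⟨α_ _ _ _ ≪≫ whiskerLeftIso σ (invTransComp τ h) ≪≫ ρ_ σ⟩⟩⟩

end Postcomposition

/-! ### Universal elements and the bicategorical Yoneda lemma -/

section Elements

variable {A : Type u₂} [Bicategory.{w, v} A] {F G : A ⥤ᵖ Cat.{w, v}}

/-- For an element `x : F L`, the functor `f ↦ F f x` from `A(L, a)` to `F a`. -/
def evalElt (F : A ⥤ᵖ Cat.{w, v}) {L : A} (x : F.obj L) (a : A) : (L ⟶ a) ⥤ F.obj a where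
  obj f := (fn F f).obj x
  map α := fn₂ F α x
  map_id f := fn₂_id F f x
  map_comp α β := fn₂_comp F α β x

/-- An element `x : F L` is biuniversal if `f ↦ F f x` is an equivalence `A(L, a) ≃ F a`
for each `a`. -/
def IsUniversalElt (F : A ⥤ᵖ Cat.{w, v}) {L : A} (x : F.obj L) : Prop :=
  ∀ a, (evalElt F x a).IsEquivalence

/-- Transfer of equivalences of categories along a square that commutes up to isomorphism. -/
theorem isEquivalence_iff_of_iso {X : Type*} [Category X] {Y : Type*} [Category Y]
    {Z : Type*} [Category Z] {P : X ⥤ Y} {e : Y ⥤ Z} {Q : X ⥤ Z} (i : P ⋙ e ≅ Q)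
    (he : e.IsEquivalence) : P.IsEquivalence ↔ Q.IsEquivalence :=
  ⟨fun _ => Functor.isEquivalence_of_iso i, fun _ =>
    haveI : (P ⋙ e).IsEquivalence := Functor.isEquivalence_of_iso i.symm
    Functor.isEquivalence_of_comp_right P e⟩

/-- Pseudonatural transformations commute with evaluation at an element. -/
def evalEltIso (τ : F ⟶ G) {L : A} (x : F.obj L) (a : A) :
    evalElt F x a ⋙ (τ.app a).toFunctor ≅ evalElt G ((τ.app L).toFunctor.obj x) a :=
  NatIso.ofComponents (fun f => natApp τ f x) (fun α => natApp_map₂ τ α x)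

/-- Isomorphic elements have isomorphic evaluation functors. -/
def evalEltCongr {L : A} {x y : F.obj L} (i : x ≅ y) (a : A) : evalElt F x a ≅ evalElt F y a :=
  NatIso.ofComponents (fun f => (fn F f).mapIso i) (fun α => (fn₂_naturality F α i.hom).symm)

theorem IsUniversalElt.of_iso {L : A} {x y : F.obj L} (i : x ≅ y) (h : IsUniversalElt F x) :
    IsUniversalElt F y := fun a =>
  haveI := h a
  Functor.isEquivalence_of_iso (evalEltCongr i a)

/-- The naturality constraints of `τ` identify evaluation at `x` followed by `τ` with evaluation at
the image of `x`. Two-out-of-three for equivalences concludes. -/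
theorem isUniversalElt_iff (τ : F ⟶ G) (h : ∀ x, (τ.app x).toFunctor.IsEquivalence) {L : A}
    (x : F.obj L) : IsUniversalElt F x ↔ IsUniversalElt G ((τ.app L).toFunctor.obj x) :=
  forall_congr' fun a => isEquivalence_iff_of_iso (evalEltIso τ x a) (h a)

theorem isUniversalElt_id (L : A) : IsUniversalElt (homFrom L) (𝟙 L) := fun a =>
  Functor.isEquivalence_of_iso (F := 𝟭 (L ⟶ a))
    (NatIso.ofComponents (fun f => (λ_ f).symm) (fun α => leftUnitor_inv_naturality α))

/-- The pseudonatural transformation `A(L, -) ⟶ F` determined by an element of `F L`. -/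
def eltTrans {L : A} (x : F.obj L) : homFrom L ⟶ F :=
  catTrans (evalElt F x) (fun f g => fnComp F g f x)
    (fun {a b} f g g' φ => fnComp_whiskerRight F φ f x)
    (fun {a b f g} α k => fnComp_whiskerLeft F k α x)
    (fun a g => fnComp_rightUnitor F g x)
    (fun {a b c} f g (k : L ⟶ a) => by
      change (fnComp F k (f ≫ g) x).hom ≫ (fnComp F f g ((fn F k).obj x)).hom =
        fn₂ F (α_ k f g).inv x ≫ (fnComp F (k ≫ f) g x).hom ≫ (fn F g).map (fnComp F k f x).hom
      rw [← fnComp_associator, ← reassoc_of% @fn₂_comp]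
      simp)

/-- A `Cat`-valued pseudofunctor is birepresented by `L` if and only if it has a biuniversal
element over `L`. -/
theorem pseudonaturalEquiv_homFrom_iff (L : A) :
    PseudonaturalEquiv (homFrom L) F ↔ ∃ x : F.obj L, IsUniversalElt F x :=
  ⟨fun ⟨τ, h⟩ => ⟨_, (isUniversalElt_iff τ h (𝟙 L)).1 (isUniversalElt_id L)⟩,
    fun ⟨x, hx⟩ => ⟨eltTrans x, hx⟩⟩

end Elements

end CatValued

/-! ### Whiskering morphisms between values of a pseudofunctor -/

section Whiskering

variable {B : Type u₁} [Bicategory.{w₁, v₁} B] (F : B ⥤ᵖ Cat.{v, u})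

/-- The whiskering of a morphism `F k x ⟶ F l y` with a 1-cell. -/
def whisk {p p' q r : B} {k : p ⟶ q} {l : p' ⟶ q} {x : F.obj p} {y : F.obj p'}
    (φ : (fn F k).obj x ⟶ (fn F l).obj y) (g : q ⟶ r) :
    (fn F (k ≫ g)).obj x ⟶ (fn F (l ≫ g)).obj y :=
  (fnComp F k g x).hom ≫ (fn F g).map φ ≫ (fnComp F l g y).inv

/-- The isomorphism `F k x ≅ F l x` induced by an invertible 2-cell. -/
@[simps]
def fn₂Iso {p q : B} {k l : p ⟶ q} (α : k ≅ l) (x : F.obj p) : (fn F k).obj x ≅ (fn F l).obj x where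
  hom := fn₂ F α.hom x
  inv := fn₂ F α.inv x
  hom_inv_id := by rw [← fn₂_comp, Iso.hom_inv_id, fn₂_id]
  inv_hom_id := by rw [← fn₂_comp, Iso.inv_hom_id, fn₂_id]

section

variable {F} {p p' p'' q r t : B} {k : p ⟶ q} {l : p' ⟶ q} {m : p'' ⟶ q} {x : F.obj p}
  {y : F.obj p'} {z : F.obj p''}

theorem whisk_comp (φ : (fn F k).obj x ⟶ (fn F l).obj y) (ψ : (fn F l).obj y ⟶ (fn F m).obj z)
    (g : q ⟶ r) : whisk F (φ ≫ ψ) g = whisk F φ g ≫ whisk F ψ g := by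
  simp [whisk]

theorem whisk_fn₂ {k k' : p ⟶ q} (α : k ⟶ k') (g : q ⟶ r) :
    whisk F (fn₂ F α x) g = fn₂ F (α ▷ g) x := by
  rw [whisk, ← reassoc_of% @fnComp_whiskerRight, Iso.hom_inv_id, Category.comp_id]

theorem whisk_naturality (φ : (fn F k).obj x ⟶ (fn F l).obj y) {g g' : q ⟶ r} (β : g ⟶ g') :
    fn₂ F (k ◁ β) x ≫ whisk F φ g' = whisk F φ g ≫ fn₂ F (l ◁ β) y := by
  rw [whisk, reassoc_of% @fnComp_whiskerLeft, ← reassoc_of% @fn₂_naturality, whisk, Category.assoc,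
    Category.assoc]
  congr 2
  rw [Iso.eq_inv_comp, ← reassoc_of% @fnComp_whiskerLeft, Iso.hom_inv_id, Category.comp_id]

/-- This aligns the whiskering 1-cells of two expressions. With `whisk_whisk` and `whisk_fn₂`, it
reduces an equation of composites to equations of 2-cells in the domain bicategory. -/
theorem whisk_congr (φ : (fn F k).obj x ⟶ (fn F l).obj y) {g g' : q ⟶ r} (β : g ≅ g') :
    whisk F φ g = fn₂ F (k ◁ β.hom) x ≫ whisk F φ g' ≫ fn₂ F (l ◁ β.inv) y := by
  rw [reassoc_of% @whisk_naturality, ← fn₂_comp, ← whiskerLeft_comp, Iso.hom_inv_id, whiskerLeft_id,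
    fn₂_id, Category.comp_id]

theorem whisk_whisk (φ : (fn F k).obj x ⟶ (fn F l).obj y) (g : q ⟶ r) (h : r ⟶ t) :
    whisk F (whisk F φ g) h =
      fn₂ F (α_ k g h).hom x ≫ whisk F φ (g ≫ h) ≫ fn₂ F (α_ l g h).inv y := by
  rw [← cancel_mono (fn₂Iso F (α_ l g h) y).hom,
    ← cancel_mono (fnComp F l (g ≫ h) y).hom, ← cancel_mono (fnComp F g h _).hom]
  simp only [Category.assoc, fn₂Iso_hom]
  rw [← reassoc_of% @fn₂_comp, Iso.inv_hom_id, fn₂_id, Category.id_comp, fnComp_associator]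
  simp only [whisk, Category.assoc, Functor.map_comp, Iso.inv_hom_id_assoc]
  rw [fnComp_naturality, reassoc_of% @fnComp_associator]
  simp [← Functor.map_comp]

theorem whisk_id (φ : (fn F k).obj x ⟶ (fn F l).obj y) :
    whisk F φ (𝟙 q) = fn₂ F (ρ_ k).hom x ≫ φ ≫ fn₂ F (ρ_ l).inv y := by
  rw [← cancel_mono (fn₂Iso F (ρ_ l) y).hom]
  simp only [Category.assoc, fn₂Iso_hom]
  rw [← fn₂_comp, Iso.inv_hom_id, fn₂_id, Category.comp_id, ← fnComp_rightUnitor,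
    ← fnComp_rightUnitor, Category.assoc, ← fnId_naturality]
  simp [whisk]

theorem whisk_fnComp (φ : (fn F k).obj x ⟶ (fn F l).obj y) (g : q ⟶ r) :
    whisk F φ g ≫ (fnComp F l g y).hom = (fnComp F k g x).hom ≫ (fn F g).map φ := by
  simp [whisk]

/-- The whiskering of an isomorphism `F k x ≅ F l y` with a 1-cell. -/
def whiskIso (φ : (fn F k).obj x ≅ (fn F l).obj y) (g : q ⟶ r) :
    (fn F (k ≫ g)).obj x ≅ (fn F (l ≫ g)).obj y where
  hom := whisk F φ.hom g
  inv := whisk F φ.inv g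
  hom_inv_id := by simp [whisk]
  inv_hom_id := by simp [whisk]

end

end Whiskering

/-! ### Squares in a pseudofunctor on a product, and their composition -/

section Squares

variable {S : Type u₁} [Bicategory.{w₁, v₁} S] {A : Type u₂} [Bicategory.{w₂, v₂} A]

/-- The 1-cell `(𝟙, f)` of a product. -/
abbrev inR (s : S) {a b : A} (f : a ⟶ b) : (s, a) ⟶ (s, b) := (𝟙 s, f)

/-- The 1-cell `(u, 𝟙)` of a product. -/
abbrev inL {s t : S} (u : s ⟶ t) (a : A) : (s, a) ⟶ (t, a) := (u, 𝟙 a)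

/-- The 2-cell `(𝟙, α)` of a product. -/
abbrev inR₂ (s : S) {a b : A} {f g : a ⟶ b} (α : f ⟶ g) : inR s f ⟶ inR s g := (𝟙 (𝟙 s), α)

/-- The 2-cell `(θ, 𝟙)` of a product. -/
abbrev inL₂ {s t : S} {u u' : s ⟶ t} (θ : u ⟶ u') (a : A) : inL u a ⟶ inL u' a := (θ, 𝟙 (𝟙 a))

/-- `(𝟙, f ≫ g) ≅ (𝟙, f) ≫ (𝟙, g)`. -/
def inRComp (s : S) {a b c : A} (f : a ⟶ b) (g : b ⟶ c) : inR s (f ≫ g) ≅ inR s f ≫ inR s g :=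
  Iso.prod (λ_ (𝟙 s)).symm (Iso.refl _)

/-- `(u ≫ v, 𝟙) ≅ (u, 𝟙) ≫ (v, 𝟙)`. -/
def inLComp {s t r : S} (u : s ⟶ t) (v : t ⟶ r) (a : A) : inL (u ≫ v) a ≅ inL u a ≫ inL v a :=
  Iso.prod (Iso.refl _) (λ_ (𝟙 a)).symm

/-- `(u, 𝟙) ≫ (𝟙, f) ≅ (𝟙, f) ≫ (u, 𝟙)`. -/
def exch {s t : S} (u : s ⟶ t) {a b : A} (f : a ⟶ b) :
    inL u a ≫ inR t f ≅ inR s f ≫ inL u b :=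
  Iso.prod (ρ_ u ≪≫ (λ_ u).symm) (λ_ f ≪≫ (ρ_ f).symm)

variable (F : (S × A) ⥤ᵖ Cat.{v, u})

/-- A square over `u` and `f`: a morphism `F (𝟙, f) y ⟶ F (u, 𝟙) x`. -/
abbrev Sq {s t : S} (u : s ⟶ t) {b a : A} (f : b ⟶ a) (y : F.obj (t, b)) (x : F.obj (s, a)) :=
  (fn F (inR t f)).obj y ⟶ (fn F (inL u a)).obj x

variable {F} {s t r q : S} {a b c d : A} {u : s ⟶ t} {v : t ⟶ r} {w : r ⟶ q} {f : b ⟶ a}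
  {g : c ⟶ b} {h : d ⟶ c} {x : F.obj (s, a)} {y : F.obj (t, b)} {z : F.obj (r, c)}
  {z' : F.obj (q, d)}

/-- The composition of squares. -/
def sqComp (ψ : Sq F v g z y) (φ : Sq F u f y x) : Sq F (u ≫ v) (g ≫ f) z x :=
  fn₂ F (inRComp r g f).hom z ≫ whisk F ψ (inR r f) ≫ fn₂ F (exch v f).hom y ≫
    whisk F φ (inL v a) ≫ fn₂ F (inLComp u v a).inv x

/-- The composition of invertible squares. -/
@[simps! hom]
def sqCompIso (ψ : (fn F (inR r g)).obj z ≅ (fn F (inL v b)).obj y)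
    (φ : (fn F (inR t f)).obj y ≅ (fn F (inL u a)).obj x) :
    (fn F (inR r (g ≫ f))).obj z ≅ (fn F (inL (u ≫ v) a)).obj x where
  hom := sqComp ψ.hom φ.hom
  inv := (fn₂Iso F (inRComp r g f) z ≪≫ whiskIso ψ (inR r f) ≪≫ fn₂Iso F (exch v f) y ≪≫
    whiskIso φ (inL v a) ≪≫ fn₂Iso F (inLComp u v a).symm x).inv
  hom_inv_id := Iso.hom_inv_id (fn₂Iso F (inRComp r g f) z ≪≫ whiskIso ψ (inR r f) ≪≫
    fn₂Iso F (exch v f) y ≪≫ whiskIso φ (inL v a) ≪≫ fn₂Iso F (inLComp u v a).symm x)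
  inv_hom_id := Iso.inv_hom_id (fn₂Iso F (inRComp r g f) z ≪≫ whiskIso ψ (inR r f) ≪≫
    fn₂Iso F (exch v f) y ≪≫ whiskIso φ (inL v a) ≪≫ fn₂Iso F (inLComp u v a).symm x)

/-- Together with the next three lemmas, this makes composition of squares natural in all four
boundary 1-cells. Once 2-cells slide past the whiskered squares, what remains is an equation in the
product `S × A`, checked in each factor. -/
theorem sqComp_whiskerRight {g' : c ⟶ b} (γ : g' ⟶ g) (ψ : Sq F v g z y) (φ : Sq F u f y x) :
    sqComp (fn₂ F (inR₂ r γ) z ≫ ψ) φ = fn₂ F (inR₂ r (γ ▷ f)) z ≫ sqComp ψ φ := by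
  rw [sqComp, sqComp, whisk_comp, whisk_fn₂, Category.assoc, ← reassoc_of% @fn₂_comp,
    ← reassoc_of% @fn₂_comp]
  congr 2
  refine Prod.ext ?_ ?_
  · simp [inRComp]
  · simp [inRComp]

theorem sqComp_whiskerLeft {f' : b ⟶ a} (β : f' ⟶ f) (ψ : Sq F v g z y) (φ : Sq F u f y x) :
    sqComp ψ (fn₂ F (inR₂ t β) y ≫ φ) = fn₂ F (inR₂ r (g ◁ β)) z ≫ sqComp ψ φ := by
  rw [sqComp, sqComp, whisk_comp, whisk_fn₂, Category.assoc, ← reassoc_of% @fn₂_comp,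
    ← reassoc_of% @fn₂_comp]
  have e₁ : inR₂ r (g ◁ β) ≫ (inRComp r g f).hom = (inRComp r g f').hom ≫ inR r g ◁ inR₂ r β := by
    refine Prod.ext ?_ ?_
    · simp [inRComp]
    · simp [inRComp]
  have e₂ : (exch v f').hom ≫ inR₂ t β ▷ inL v a = inL v b ◁ inR₂ r β ≫ (exch v f).hom := by
    refine Prod.ext ?_ ?_
    · simp [exch]
    · simp [exch]
  rw [e₁, e₂, reassoc_of% @fn₂_comp, reassoc_of% @fn₂_comp, reassoc_of% @whisk_naturality]

theorem sqComp_whiskerLeft₂ {v' : t ⟶ r} (θ : v ⟶ v') (ψ : Sq F v g z y) (φ : Sq F u f y x) :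
    sqComp (ψ ≫ fn₂ F (inL₂ θ b) y) φ = sqComp ψ φ ≫ fn₂ F (inL₂ (u ◁ θ) a) x := by
  rw [sqComp, sqComp, whisk_comp, whisk_fn₂]
  simp only [Category.assoc]
  rw [← reassoc_of% @fn₂_comp, ← fn₂_comp]
  have e₁ : inL₂ θ b ▷ inR r f ≫ (exch v' f).hom = (exch v f).hom ≫ inR t f ◁ inL₂ θ a := by
    refine Prod.ext ?_ ?_
    · simp [exch]
    · simp [exch]
  have e₂ : (inLComp u v a).inv ≫ inL₂ (u ◁ θ) a = inL u a ◁ inL₂ θ a ≫ (inLComp u v' a).inv := by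
    refine Prod.ext ?_ ?_
    · simp [inLComp]
    · simp [inLComp]
  rw [e₁, e₂, reassoc_of% @fn₂_comp, fn₂_comp, reassoc_of% @whisk_naturality]

theorem sqComp_whiskerRight₂ {u' : s ⟶ t} (θ : u ⟶ u') (ψ : Sq F v g z y) (φ : Sq F u f y x) :
    sqComp ψ (φ ≫ fn₂ F (inL₂ θ a) x) = sqComp ψ φ ≫ fn₂ F (inL₂ (θ ▷ v) a) x := by
  rw [sqComp, sqComp, whisk_comp, whisk_fn₂]
  simp only [Category.assoc]
  rw [← fn₂_comp, ← fn₂_comp]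
  congr 5
  refine Prod.ext ?_ ?_
  · simp [inLComp]
  · simp [inLComp]

theorem sqComp_id_left (φ : Sq F u f y x) :
    sqComp (g := 𝟙 b) (v := 𝟙 t) (z := y) (𝟙 _) φ =
      fn₂ F (inR₂ t (λ_ f).hom) y ≫ φ ≫ fn₂ F (inL₂ (ρ_ u).inv a) x := by
  rw [sqComp, ← fn₂_id, whisk_fn₂]
  have e := whisk_id φ
  -- Both `inL (𝟙 t) a` and the identity of `(t, a)` are the pair of identities, so `whisk_id`
  -- applies up to unfolding.
  change whisk F φ (inL (𝟙 t) a) = _ at e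
  rw [e]
  simp only [Category.assoc]
  rw [← reassoc_of% @fn₂_comp, ← reassoc_of% @fn₂_comp, ← reassoc_of% @fn₂_comp, ← fn₂_comp]
  congr 2
  · refine Prod.ext ?_ ?_
    · simp [inRComp, exch]
    · simp [inRComp, exch]
  · congr 2
    refine Prod.ext ?_ ?_
    · simp [inLComp]
    · simp [inLComp]

theorem sqComp_id_right (ψ : Sq F v g z y) :
    sqComp (u := 𝟙 t) (f := 𝟙 b) (x := y) ψ (𝟙 _) =
      fn₂ F (inR₂ r (ρ_ g).hom) z ≫ ψ ≫ fn₂ F (inL₂ (λ_ v).inv b) y := by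
  have e := whisk_id ψ
  change whisk F ψ (inR r (𝟙 b)) = _ at e
  rw [sqComp, e, ← fn₂_id, whisk_fn₂]
  simp only [Category.assoc]
  rw [← reassoc_of% @fn₂_comp, ← reassoc_of% @fn₂_comp, ← reassoc_of% @fn₂_comp, ← fn₂_comp]
  congr 2
  · refine Prod.ext ?_ ?_
    · simp [inRComp]
    · simp [inRComp]
  · congr 2
    refine Prod.ext ?_ ?_
    · simp [inLComp, exch]
    · simp [inLComp, exch]

/-- Each side is brought to a form where `χ`, `ψ`, `φ` occur once each, whiskered by a single 1-cell
and separated by images of 2-cells. After the 1-cells are aligned by `whisk_congr`, the four gaps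
are structural 2-cells of the product and agree in each factor. -/
theorem sqComp_assoc (χ : Sq F w h z' z) (ψ : Sq F v g z y) (φ : Sq F u f y x) :
    sqComp (sqComp χ ψ) φ =
      fn₂ F (inR₂ q (α_ h g f).hom) z' ≫ sqComp χ (sqComp ψ φ) ≫
        fn₂ F (inL₂ (α_ u v w).hom a) x := by
  rw [sqComp, sqComp, sqComp, sqComp]
  simp only [whisk_comp, whisk_fn₂, whisk_whisk, Category.assoc]
  rw [whisk_congr χ (inRComp q g f), whisk_congr φ (inLComp v w a),
    whisk_congr ψ (exch w f)]
  simp only [Category.assoc]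
  simp only [← reassoc_of% @fn₂_comp]
  rw [← fn₂_comp, ← fn₂_comp]
  refine congrArg₂ (· ≫ ·) (congrArg (fn₂ F · z') ?_) (congrArg (_ ≫ ·) (congrArg₂ (· ≫ ·)
    (congrArg (fn₂ F · z) ?_) (congrArg (_ ≫ ·) (congrArg₂ (· ≫ ·) (congrArg (fn₂ F · y) ?_)
    (congrArg (_ ≫ ·) (congrArg (fn₂ F · x) ?_))))))
  all_goals refine Prod.ext ?_ ?_ <;> simp [inRComp, inLComp, exch]

end Squares

/-! ### Representing objects assemble into a pseudofunctor on the opposite -/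

section Parametrized

variable {S : Type u₁} [Bicategory.{w₁, v₁} S] {A : Type u₂} [Bicategory.{w, v} A]
  {F : (S × A) ⥤ᵖ Cat.{w, v}}

/-- For `x : F (s, l)`, the functor `f ↦ F (𝟙, f) x` from `A(l, a)` to `F (s, a)`. -/
def colElt (s : S) {l : A} (x : F.obj (s, l)) (a : A) : (l ⟶ a) ⥤ F.obj (s, a) where
  obj f := (fn F (inR s f)).obj x
  map α := fn₂ F (inR₂ s α) x
  map_id f := fn₂_id F (inR s f) x
  map_comp {f g h} α β := by
    rw [← fn₂_comp]
    exact congrArg (fn₂ F · x) (Prod.ext (Category.comp_id (𝟙 (𝟙 s))).symm rfl)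

theorem colElt_map_comp {s : S} {l : A} (x : F.obj (s, l)) {a : A} {f g h : l ⟶ a} (α : f ⟶ g)
    (β : g ⟶ h) : fn₂ F (inR₂ s (α ≫ β)) x = fn₂ F (inR₂ s α) x ≫ fn₂ F (inR₂ s β) x :=
  (colElt s x a).map_comp α β

theorem rowElt_map_comp {s t : S} {a : A} (x : F.obj (s, a)) {u v w : s ⟶ t} (α : u ⟶ v)
    (β : v ⟶ w) : fn₂ F (inL₂ (α ≫ β) a) x = fn₂ F (inL₂ α a) x ≫ fn₂ F (inL₂ β a) x := by
  rw [← fn₂_comp]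
  exact congrArg (fn₂ F · x) (Prod.ext rfl (Category.comp_id (𝟙 (𝟙 a))).symm)

theorem rowElt_map_id {s t : S} {a : A} (x : F.obj (s, a)) (u : s ⟶ t) :
    fn₂ F (inL₂ (𝟙 u) a) x = 𝟙 _ := fn₂_id F (inL u a) x

variable {L : S → A} (x : ∀ s, F.obj (s, L s)) (h : ∀ s a, (colElt s (x s) a).IsEquivalence)

include h in
theorem colElt_ext {s : S} {a : A} {f g : L s ⟶ a} {α β : f ⟶ g}
    (e : fn₂ F (inR₂ s α) (x s) = fn₂ F (inR₂ s β) (x s)) : α = β :=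
  haveI := h s a
  (colElt s (x s) a).map_injective e

/-- The 1-cell `L t ⟶ L s` induced by `u : s ⟶ t`. -/
noncomputable def arr {s t : S} (u : s ⟶ t) : L t ⟶ L s :=
  haveI := h t (L s)
  (colElt t (x t) (L s)).objPreimage ((fn F (inL u (L s))).obj (x s))

/-- The invertible square that characterizes the 1-cell `arr u`. -/
noncomputable def arrIso {s t : S} (u : s ⟶ t) :
    (fn F (inR t (arr x h u))).obj (x t) ≅ (fn F (inL u (L s))).obj (x s) :=
  haveI := h t (L s)
  (colElt t (x t) (L s)).objObjPreimageIso ((fn F (inL u (L s))).obj (x s))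

/-- The 2-cell between the induced 1-cells. -/
noncomputable def arr₂ {s t : S} {u u' : s ⟶ t} (θ : u ⟶ u') : arr x h u ⟶ arr x h u' :=
  haveI := h t (L s)
  (colElt t (x t) (L s)).preimage
    ((arrIso x h u).hom ≫ fn₂ F (inL₂ θ (L s)) (x s) ≫ (arrIso x h u').inv)

theorem arr₂_fac {s t : S} {u u' : s ⟶ t} (θ : u ⟶ u') :
    fn₂ F (inR₂ t (arr₂ x h θ)) (x t) ≫ (arrIso x h u').hom =
      (arrIso x h u).hom ≫ fn₂ F (inL₂ θ (L s)) (x s) := by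
  have := h t (L s)
  have e : fn₂ F (inR₂ t (arr₂ x h θ)) (x t) =
      (arrIso x h u).hom ≫ fn₂ F (inL₂ θ (L s)) (x s) ≫ (arrIso x h u').inv :=
    (colElt t (x t) (L s)).map_preimage
      ((arrIso x h u).hom ≫ fn₂ F (inL₂ θ (L s)) (x s) ≫ (arrIso x h u').inv)
  rw [e]
  simp

/-- The unit constraint of the induced 1-cells. -/
noncomputable def arrId (s : S) : arr x h (𝟙 s) ≅ 𝟙 (L s) :=
  haveI := h s (L s)
  (colElt s (x s) (L s)).preimageIso (arrIso x h (𝟙 s))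

theorem arrId_fac (s : S) :
    fn₂ F (inR₂ s (arrId x h s).hom) (x s) = (arrIso x h (𝟙 s)).hom :=
  haveI := h s (L s)
  (colElt s (x s) (L s)).map_preimage (arrIso x h (𝟙 s)).hom

/-- The composition constraint of the induced 1-cells. -/
noncomputable def arrComp {s t r : S} (u : s ⟶ t) (v : t ⟶ r) :
    arr x h (u ≫ v) ≅ arr x h v ≫ arr x h u :=
  haveI := h r (L s)
  (colElt r (x r) (L s)).preimageIso
    (arrIso x h (u ≫ v) ≪≫ (sqCompIso (arrIso x h v) (arrIso x h u)).symm)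

/-- With `arr₂_fac` and `arrId_fac`, this determines the structure cells by their effect on
universal elements. By `colElt_ext`, each axiom of `arrPF` reduces to the corresponding law for
composing squares. -/
theorem arrComp_fac {s t r : S} (u : s ⟶ t) (v : t ⟶ r) :
    fn₂ F (inR₂ r (arrComp x h u v).hom) (x r) ≫ sqComp (arrIso x h v).hom (arrIso x h u).hom =
      (arrIso x h (u ≫ v)).hom := by
  have := h r (L s)
  have e : fn₂ F (inR₂ r (arrComp x h u v).hom) (x r) =
      (arrIso x h (u ≫ v)).hom ≫ (sqCompIso (arrIso x h v) (arrIso x h u)).inv :=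
    (colElt r (x r) (L s)).map_preimage
      ((arrIso x h (u ≫ v)).hom ≫ (sqCompIso (arrIso x h v) (arrIso x h u)).inv)
  rw [e, Category.assoc, ← sqCompIso_hom, Iso.inv_hom_id, Category.comp_id]

theorem arr₂_id {s t : S} (u : s ⟶ t) : arr₂ x h (𝟙 u) = 𝟙 _ := by
  apply colElt_ext x h
  rw [← cancel_mono (arrIso x h u).hom, arr₂_fac, rowElt_map_id, Category.comp_id]
  have e : fn₂ F (inR₂ t (𝟙 (arr x h u))) (x t) = 𝟙 _ := fn₂_id _ _ _
  rw [e, Category.id_comp]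

theorem arr₂_comp {s t : S} {u u' u'' : s ⟶ t} (θ : u ⟶ u') (θ' : u' ⟶ u'') :
    arr₂ x h (θ ≫ θ') = arr₂ x h θ ≫ arr₂ x h θ' := by
  apply colElt_ext x h
  rw [← cancel_mono (arrIso x h u'').hom, arr₂_fac, colElt_map_comp, Category.assoc, arr₂_fac,
    reassoc_of% @arr₂_fac, rowElt_map_comp]

theorem arr₂_whiskerRight {s t r : S} {u u' : s ⟶ t} (θ : u ⟶ u') (v : t ⟶ r) :
    arr₂ x h (θ ▷ v) ≫ (arrComp x h u' v).hom =
      (arrComp x h u v).hom ≫ arr x h v ◁ arr₂ x h θ := by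
  apply colElt_ext x h
  rw [← cancel_mono (sqCompIso (arrIso x h v) (arrIso x h u')).hom, sqCompIso_hom,
    colElt_map_comp, colElt_map_comp, Category.assoc, Category.assoc, arrComp_fac, arr₂_fac,
    ← sqComp_whiskerLeft, arr₂_fac, sqComp_whiskerRight₂, reassoc_of% @arrComp_fac]

theorem arr₂_whiskerLeft {s t r : S} (u : s ⟶ t) {v v' : t ⟶ r} (θ : v ⟶ v') :
    arr₂ x h (u ◁ θ) ≫ (arrComp x h u v').hom =
      (arrComp x h u v).hom ≫ arr₂ x h θ ▷ arr x h u := by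
  apply colElt_ext x h
  rw [← cancel_mono (sqCompIso (arrIso x h v') (arrIso x h u)).hom, sqCompIso_hom,
    colElt_map_comp, colElt_map_comp, Category.assoc, Category.assoc, arrComp_fac, arr₂_fac,
    ← sqComp_whiskerRight, arr₂_fac, sqComp_whiskerLeft₂, reassoc_of% @arrComp_fac]

/-- The inverse appears because the associator of `Sᵒᵖ` is the opposite of the inverse associator of
`S`. On the universal element, both sides become triple composites of squares, compared by
`sqComp_assoc`. -/
theorem arr₂_associator_inv {s t r q : S} (u : s ⟶ t) (v : t ⟶ r) (w : r ⟶ q) :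
    arr₂ x h (α_ u v w).inv ≫ (arrComp x h (u ≫ v) w).hom ≫ arr x h w ◁ (arrComp x h u v).hom =
      (arrComp x h u (v ≫ w)).hom ≫ (arrComp x h v w).hom ▷ arr x h u ≫ (α_ _ _ _).hom := by
  apply colElt_ext x h
  rw [← cancel_mono (sqCompIso (arrIso x h w) (sqCompIso (arrIso x h v) (arrIso x h u))).hom,
    sqCompIso_hom, sqCompIso_hom]
  simp only [colElt_map_comp, Category.assoc]
  have e : fn₂ F (inR₂ q (α_ (arr x h w) (arr x h v) (arr x h u)).hom) (x q) ≫
      sqComp (arrIso x h w).hom (sqComp (arrIso x h v).hom (arrIso x h u).hom) =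
      sqComp (sqComp (arrIso x h w).hom (arrIso x h v).hom) (arrIso x h u).hom ≫
        fn₂ F (inL₂ (α_ u v w).inv (L s)) (x s) := by
    rw [sqComp_assoc, Category.assoc, Category.assoc, ← rowElt_map_comp, Iso.hom_inv_id,
      rowElt_map_id, Category.comp_id]
  rw [e, ← sqComp_whiskerLeft, arrComp_fac, arrComp_fac, arr₂_fac,
    ← reassoc_of% @sqComp_whiskerRight,
    arrComp_fac, reassoc_of% @arrComp_fac]

theorem arr₂_rightUnitor {s t : S} (u : s ⟶ t) :
    arr₂ x h (ρ_ u).hom =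
      (arrComp x h u (𝟙 t)).hom ≫ (arrId x h t).hom ▷ arr x h u ≫ (λ_ _).hom := by
  apply colElt_ext x h
  rw [← cancel_mono (arrIso x h u).hom, arr₂_fac]
  simp only [colElt_map_comp, Category.assoc]
  have e : fn₂ F (inR₂ t (λ_ (arr x h u)).hom) (x t) ≫ (arrIso x h u).hom =
      sqComp (g := 𝟙 (L t)) (v := 𝟙 t) (z := x t) (𝟙 _) (arrIso x h u).hom ≫
        fn₂ F (inL₂ (ρ_ u).hom (L s)) (x s) := by
    rw [sqComp_id_left, Category.assoc, Category.assoc, ← rowElt_map_comp, Iso.inv_hom_id,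
      rowElt_map_id, Category.comp_id]
  rw [e, ← reassoc_of% @sqComp_whiskerRight, Category.comp_id, arrId_fac, reassoc_of% @arrComp_fac]

theorem arr₂_leftUnitor {s t : S} (u : s ⟶ t) :
    arr₂ x h (λ_ u).hom =
      (arrComp x h (𝟙 s) u).hom ≫ arr x h u ◁ (arrId x h s).hom ≫ (ρ_ _).hom := by
  apply colElt_ext x h
  rw [← cancel_mono (arrIso x h u).hom, arr₂_fac]
  simp only [colElt_map_comp, Category.assoc]
  have e : fn₂ F (inR₂ t (ρ_ (arr x h u)).hom) (x t) ≫ (arrIso x h u).hom =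
      sqComp (u := 𝟙 s) (f := 𝟙 (L s)) (x := x s) (arrIso x h u).hom (𝟙 _) ≫
        fn₂ F (inL₂ (λ_ u).hom (L s)) (x s) := by
    rw [sqComp_id_right, Category.assoc, Category.assoc, ← rowElt_map_comp, Iso.inv_hom_id,
      rowElt_map_id, Category.comp_id]
  rw [e, ← reassoc_of% @sqComp_whiskerLeft, Category.comp_id, arrId_fac, reassoc_of% @arrComp_fac]

/-- The pseudofunctor `Sᵒᵖ ⥤ᵖ A` determined by biuniversal elements of the `F (s, -)`. -/
noncomputable def arrPF : Sᵒᵖ ⥤ᵖ A where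
  obj s := L s.unop
  map u := arr x h u.unop
  map₂ θ := arr₂ x h θ.unop2
  map₂_id u := arr₂_id x h u.unop
  map₂_comp θ θ' := arr₂_comp x h θ.unop2 θ'.unop2
  mapId s := arrId x h s.unop
  mapComp v u := arrComp x h u.unop v.unop
  map₂_whisker_left v u u' θ := by
    have e := arr₂_whiskerRight x h θ.unop2 v.unop
    change arr₂ x h (θ.unop2 ▷ v.unop) = _
    rw [← Category.assoc, Iso.eq_comp_inv]
    exact e
  map₂_whisker_right {_ _ _ v v'} θ u := by
    have e := arr₂_whiskerLeft x h u.unop θ.unop2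
    change arr₂ x h (u.unop ◁ θ.unop2) = _
    rw [← Category.assoc, Iso.eq_comp_inv]
    exact e
  map₂_associator w v u := by
    have e := arr₂_associator_inv x h u.unop v.unop w.unop
    change arr₂ x h (α_ u.unop v.unop w.unop).inv = _
    rw [← cancel_mono (arrComp x h (u.unop ≫ v.unop) w.unop).hom,
      ← cancel_mono (arr x h w.unop ◁ (arrComp x h u.unop v.unop).hom), Category.assoc, e]
    simp
  -- Composition in `Sᵒᵖ` is reversed, so the two unitors trade places, as the two whiskerings did
  -- above.
  map₂_left_unitor u := arr₂_rightUnitor x h u.unop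
  map₂_right_unitor u := arr₂_leftUnitor x h u.unop

end Parametrized

/-! ### Comparison of the assembled representable with the given pseudofunctor -/

section Parametrized

variable {S : Type v} [Bicategory.{v, v} S] {A : Type u₂} [Bicategory.{v, v} A]
  {F : (S × A) ⥤ᵖ Cat.{v, v}} {L : S → A} (x : ∀ s, F.obj (s, L s))
  (h : ∀ s a, (colElt s (x s) a).IsEquivalence)

/-- `(u, 𝟙) ≫ (𝟙, k ≫ f) ≅ (𝟙, k) ≫ (u, f)`. -/
def exchHom {s t : S} (u : s ⟶ t) {l a b : A} (k : l ⟶ a) (f : a ⟶ b) :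
    inL u l ≫ inR t (k ≫ f) ≅ inR s k ≫ ((u, f) : (s, a) ⟶ (t, b)) :=
  Iso.prod (ρ_ u ≪≫ (λ_ u).symm) (λ_ (k ≫ f))

/-- The comparison of the actions of `(u, f)` on `A(L s, a)` and on `F (s, a)`. -/
noncomputable def actIso {s t : S} (u : s ⟶ t) {a b : A} (f : a ⟶ b) (k : L s ⟶ a) :
    (fn F (inR t (arr x h u ≫ k ≫ f))).obj (x t) ≅
      (fn F (inR s k ≫ ((u, f) : (s, a) ⟶ (t, b)))).obj (x s) :=
  fn₂Iso F (inRComp t (arr x h u) (k ≫ f)) (x t) ≪≫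
    whiskIso (arrIso x h u) (inR t (k ≫ f)) ≪≫ fn₂Iso F (exchHom u k f) (x s)

theorem actIso_hom {s t : S} (u : s ⟶ t) {a b : A} (f : a ⟶ b) (k : L s ⟶ a) :
    (actIso x h u f k).hom = fn₂ F (inRComp t (arr x h u) (k ≫ f)).hom (x t) ≫
      whisk F (arrIso x h u).hom (inR t (k ≫ f)) ≫ fn₂ F (exchHom u k f).hom (x s) := rfl

theorem actIso_naturality {s t : S} (u : s ⟶ t) {a b : A} (f : a ⟶ b) {k k' : L s ⟶ a}
    (φ : k ⟶ k') :
    fn₂ F (inR₂ t (arr x h u ◁ φ ▷ f)) (x t) ≫ (actIso x h u f k').hom =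
      (actIso x h u f k).hom ≫ fn₂ F (inR₂ s φ ▷ ((u, f) : (s, a) ⟶ (t, b))) (x s) := by
  simp only [actIso_hom, Category.assoc]
  rw [← reassoc_of% @fn₂_comp, ← fn₂_comp]
  have e₁ : inR₂ t (arr x h u ◁ φ ▷ f) ≫ (inRComp t (arr x h u) (k' ≫ f)).hom =
      (inRComp t (arr x h u) (k ≫ f)).hom ≫ inR t (arr x h u) ◁ inR₂ t (φ ▷ f) := by
    refine Prod.ext ?_ ?_ <;> simp [inRComp]
  have e₂ : (exchHom u k f).hom ≫ inR₂ s φ ▷ ((u, f) : (s, a) ⟶ (t, b)) =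
      inL u (L s) ◁ inR₂ t (φ ▷ f) ≫ (exchHom u k' f).hom := by
    refine Prod.ext ?_ ?_ <;> simp [exchHom]
  rw [e₁, e₂, reassoc_of% @fn₂_comp, fn₂_comp, reassoc_of% @whisk_naturality]

theorem actIso_map₂ {s t : S} {u u' : s ⟶ t} (θ : u ⟶ u') {a b : A} {f f' : a ⟶ b} (β : f ⟶ f')
    (k : L s ⟶ a) :
    fn₂ F (inR₂ t (arr₂ x h θ ▷ (k ≫ f) ≫ arr x h u' ◁ k ◁ β)) (x t) ≫
        (actIso x h u' f' k).hom =
      (actIso x h u f k).hom ≫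
        fn₂ F (inR s k ◁ ((θ, β) : ((u, f) : (s, a) ⟶ (t, b)) ⟶ (u', f'))) (x s) := by
  simp only [actIso_hom, Category.assoc]
  rw [← reassoc_of% @fn₂_comp, ← fn₂_comp]
  have e₁ : inR₂ t (arr₂ x h θ ▷ (k ≫ f) ≫ arr x h u' ◁ k ◁ β) ≫
      (inRComp t (arr x h u') (k ≫ f')).hom =
      (inRComp t (arr x h u) (k ≫ f)).hom ≫ inR₂ t (arr₂ x h θ) ▷ inR t (k ≫ f) ≫
        inR t (arr x h u') ◁ inR₂ t (k ◁ β) := by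
    refine Prod.ext ?_ ?_ <;> simp [inRComp]
  have e₂ : (exchHom u k f).hom ≫
      inR s k ◁ ((θ, β) : ((u, f) : (s, a) ⟶ (t, b)) ⟶ (u', f')) =
      inL₂ θ (L s) ▷ inR t (k ≫ f) ≫ inL u' (L s) ◁ inR₂ t (k ◁ β) ≫ (exchHom u' k f').hom := by
    refine Prod.ext ?_ ?_ <;> simp [exchHom]
  rw [e₁, e₂, reassoc_of% @fn₂_comp, reassoc_of% @fn₂_comp, fn₂_comp, fn₂_comp,
    reassoc_of% @whisk_naturality,
    ← whisk_fn₂, ← whisk_fn₂, ← reassoc_of% @whisk_comp, arr₂_fac, reassoc_of% @whisk_comp]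

theorem actIso_id (s : S) {a : A} (k : L s ⟶ a) :
    (actIso x h (𝟙 s) (𝟙 a) k).hom ≫ fn₂ F (ρ_ (inR s k)).hom (x s) =
      fn₂ F (inR₂ s ((arrId x h s).hom ▷ (k ≫ 𝟙 a) ≫ (λ_ _).hom ≫ (ρ_ k).hom)) (x s) := by
  have e : (arrIso x h (𝟙 s)).hom = fn₂ F (inR₂ s (arrId x h s).hom) (x s) :=
    (arrId_fac x h s).symm
  rw [actIso_hom, e, whisk_fn₂, Category.assoc, Category.assoc, ← fn₂_comp, ← fn₂_comp,
    ← fn₂_comp]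
  refine congrArg (fn₂ F · (x s)) (Prod.ext ?_ ?_)
  · simp [inRComp, exchHom]
  · simp [inRComp, exchHom]

/-- By `arrComp_fac`, the square of `u ≫ v` is the composite of the squares of `u` and `v`, so the
action of `(u ≫ v, f ≫ g)` splits into two successive actions. This is the composition axiom of
`arrTrans` before the constraint `fnComp` is applied. -/
theorem actIso_comp {s t r : S} (u : s ⟶ t) (v : t ⟶ r) {a b c : A} (f : a ⟶ b) (g : b ⟶ c)
    (k : L s ⟶ a) :
    (actIso x h (u ≫ v) (f ≫ g) k).hom =
      fn₂ F (inR₂ r ((arrComp x h u v).hom ▷ (k ≫ f ≫ g) ≫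
        (α_ (arr x h v) (arr x h u) (k ≫ f ≫ g)).hom ≫
        arr x h v ◁ (arr x h u ◁ (α_ k f g).inv ≫ (α_ (arr x h u) (k ≫ f) g).inv))) (x r) ≫
      (actIso x h v g (arr x h u ≫ k ≫ f)).hom ≫
      whisk F (actIso x h u f k).hom ((v, g) : (t, b) ⟶ (r, c)) ≫
      fn₂ F (α_ (inR s k) ((u, f) : (s, a) ⟶ (t, b)) ((v, g) : (t, b) ⟶ (r, c))).hom (x s) := by
  rw [actIso_hom, actIso_hom, actIso_hom, ← arrComp_fac, sqComp]
  simp only [whisk_comp, whisk_fn₂, whisk_whisk, Category.assoc]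
  -- `β` and `γ` match the 1-cells that whisker the squares of `v` and of `u` on the two sides.
  let β : inR r (arr x h u) ≫ inR r (k ≫ f ≫ g) ≅ inR r ((arr x h u ≫ k ≫ f) ≫ g) :=
    Iso.prod (λ_ _) (whiskerLeftIso _ (α_ k f g).symm ≪≫ (α_ _ _ _).symm)
  let γ : inL v (L s) ≫ inR r (k ≫ f ≫ g) ≅ inR t (k ≫ f) ≫ ((v, g) : (t, b) ⟶ (r, c)) :=
    Iso.prod (ρ_ v ≪≫ (λ_ v).symm) (λ_ _ ≪≫ (α_ k f g).symm)
  rw [whisk_congr (arrIso x h v).hom β, whisk_congr (arrIso x h u).hom γ]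
  simp only [Category.assoc, ← reassoc_of% @fn₂_comp]
  rw [← fn₂_comp, ← fn₂_comp]
  refine congrArg₂ (· ≫ ·) (congrArg (fn₂ F · (x r)) ?_) (congrArg (_ ≫ ·) (congrArg₂ (· ≫ ·)
    (congrArg (fn₂ F · (x t)) ?_) (congrArg (_ ≫ ·) (congrArg (fn₂ F · (x s)) ?_))))
  all_goals refine Prod.ext ?_ ?_ <;> simp [inRComp, inLComp, exch, exchHom, β, γ]
  all_goals bicategory

/-- The comparison of `A(L -, -)` with `F`. -/
noncomputable def arrTrans : homOut (arrPF x h) ⟶ F :=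
  catTrans (fun p => colElt p.1 (x p.1) p.2)
    (fun {p q} f (k : L p.1 ⟶ p.2) => actIso x h f.1 f.2 k ≪≫ fnComp F (inR p.1 k) f (x p.1))
    (fun {p q} f (k k' : L p.1 ⟶ p.2) (φ : k ⟶ k') => by
      change fn₂ F (inR₂ q.1 (arr x h f.1 ◁ φ ▷ f.2)) (x q.1) ≫ (actIso x h f.1 f.2 k').hom ≫
          (fnComp F (inR p.1 k') f (x p.1)).hom =
        ((actIso x h f.1 f.2 k).hom ≫ (fnComp F (inR p.1 k) f (x p.1)).hom) ≫
          (fn F f).map (fn₂ F (inR₂ p.1 φ) (x p.1))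
      rw [reassoc_of% @actIso_naturality, Category.assoc, ← fnComp_whiskerRight]
      rfl)
    (fun {p q f f'} θ (k : L p.1 ⟶ p.2) => by
      change fn₂ F (inR₂ q.1 (arr₂ x h θ.1 ▷ (k ≫ f.2) ≫ arr x h f'.1 ◁ k ◁ θ.2)) (x q.1) ≫
          (actIso x h f'.1 f'.2 k).hom ≫ (fnComp F (inR p.1 k) f' (x p.1)).hom =
        ((actIso x h f.1 f.2 k).hom ≫ (fnComp F (inR p.1 k) f (x p.1)).hom) ≫
          fn₂ F θ ((fn F (inR p.1 k)).obj (x p.1))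
      rw [Category.assoc, ← fnComp_whiskerLeft, ← Category.assoc, actIso_map₂, Category.assoc]
      rfl)
    (fun p (k : L p.1 ⟶ p.2) => by
      change ((actIso x h (𝟙 p.1) (𝟙 p.2) k).hom ≫ (fnComp F (inR p.1 k) (𝟙 p) (x p.1)).hom) ≫
          (fnId F p ((fn F (inR p.1 k)).obj (x p.1))).hom =
        fn₂ F (inR₂ p.1 (((arrId x h p.1).hom ▷ (k ≫ 𝟙 p.2) ≫ 𝟙 _ ◁ k ◁ 𝟙 (𝟙 p.2)) ≫
          (λ_ (k ≫ 𝟙 p.2)).hom ≫ (ρ_ k).hom)) (x p.1)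
      rw [Category.assoc, fnComp_rightUnitor, whiskerLeft_id, whiskerLeft_id, Category.comp_id]
      exact actIso_id x h p.1 k)
    (fun {p q r} f g (k : L p.1 ⟶ p.2) => by
      change ((actIso x h (f.1 ≫ g.1) (f.2 ≫ g.2) k).hom ≫
          (fnComp F (inR p.1 k) (f ≫ g) (x p.1)).hom) ≫
          (fnComp F f g ((fn F (inR p.1 k)).obj (x p.1))).hom =
        fn₂ F (inR₂ r.1 (((arrComp x h f.1 g.1).hom ▷ (k ≫ f.2 ≫ g.2) ≫
          (arr x h g.1 ≫ arr x h f.1) ◁ k ◁ 𝟙 (f.2 ≫ g.2)) ≫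
          (α_ (arr x h g.1) (arr x h f.1) (k ≫ f.2 ≫ g.2)).hom ≫
          arr x h g.1 ◁ (arr x h f.1 ◁ (α_ k f.2 g.2).inv ≫
            (α_ (arr x h f.1) (k ≫ f.2) g.2).inv))) (x r.1) ≫
        ((actIso x h g.1 g.2 (arr x h f.1 ≫ k ≫ f.2)).hom ≫
          (fnComp F (inR q.1 (arr x h f.1 ≫ k ≫ f.2)) g (x q.1)).hom) ≫
          (fn F g).map ((actIso x h f.1 f.2 k).hom ≫ (fnComp F (inR p.1 k) f (x p.1)).hom)
      rw [actIso_comp, whiskerLeft_id, whiskerLeft_id, Category.comp_id, Functor.map_comp]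
      simp only [Category.assoc]
      have e := fnComp_associator F (inR p.1 k) f g (x p.1)
      have e' := whisk_fnComp (actIso x h f.1 f.2 k).hom g
      rw [← reassoc_of% e']
      refine congrArg (_ ≫ ·) (congrArg (_ ≫ ·) (congrArg (_ ≫ ·) ?_))
      exact e)

end Parametrized

/-- A `Cat`-valued pseudofunctor `F` on `S × A` is equivalent to `A(𝒜 -, -)` for some `𝒜` if each
`F (s, -)` is birepresentable. -/
theorem exists_pseudonaturalEquiv_homOut {S : Type v} [Bicategory.{v, v} S] {A : Type u₂}
    [Bicategory.{v, v} A] (F : (S × A) ⥤ᵖ Cat.{v, v})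
    (h : ∀ s, ∃ (l : A) (x : F.obj (s, l)), ∀ a, (colElt s x a).IsEquivalence) :
    ∃ 𝒜 : Sᵒᵖ ⥤ᵖ A, PseudonaturalEquiv F (homOut 𝒜) := by
  choose L x h using h
  -- Universal elements produce the comparison out of the representable side, while the claim asks
  -- for one out of `F`; hence the inverse.
  exact ⟨arrPF x h, invTrans (arrTrans x h) (fun p => h p.1 p.2), fun p =>
    invTrans_isEquivalence (arrTrans x h) (fun p => h p.1 p.2) p⟩

/-! ### Birepresentability from the factorization and the biadjunction -/

section Factorization

/-- Stated for arbitrary morphisms, so that the three naturality squares used below are matched up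
to definitional unfolding, where rewriting would need syntactic agreement. -/
theorem comp_square₃ {X : Type u} [Category.{v} X] {a a' b b' c c' d d' : X} {n : a ⟶ b}
    {m : b ⟶ c} {q : c ⟶ d} {n' : a' ⟶ b'} {m' : b' ⟶ c'} {q' : c' ⟶ d'} {φ₀ : a ⟶ a'}
    {φ₁ : b ⟶ b'} {φ₂ : c ⟶ c'} {φ₃ : d ⟶ d'} (e₁ : φ₀ ≫ n' = n ≫ φ₁) (e₂ : m ≫ φ₂ = φ₁ ≫ m')
    (e₃ : φ₂ ≫ q' = q ≫ φ₃) : φ₀ ≫ n' ≫ m' ≫ q' = (n ≫ m ≫ q) ≫ φ₃ := by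
  rw [reassoc_of% e₁, ← reassoc_of% e₂, e₃, Category.assoc, Category.assoc]

variable {S : Type v} [Bicategory.{v, v} S] {A : Type u₁} [Bicategory.{v, v} A]
  {B : Type u₂} [Bicategory.{v, v} B] {C : Type u₃} [Bicategory.{v, v} C]

/-- A pseudofunctor that factors through `U^*` has birepresentable restrictions along `J` if `U ∘ J`
is right biadjoint. -/
theorem exists_colElt_isEquivalence (J : A ⥤ᵖ C) (U : C ⥤ᵖ B) (D : (S × C) ⥤ᵖ Cat.{v, v})
    (hfac : FactorsThroughStar U D) (hR : IsRightBiadjoint (J.comp U)) (s : S) :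
    ∃ (l : A) (x : ((prodPF (Pseudofunctor.id S) J).comp D).obj (s, l)),
      ∀ a, (colElt (F := (prodPF (Pseudofunctor.id S) J).comp D) s x a).IsEquivalence := by
  obtain ⟨D', τ, hτ⟩ := hfac
  obtain ⟨E, ⟨adj⟩⟩ := hR
  let s' : LocallyDiscrete (Discrete S) := ⟨⟨s⟩⟩
  let b : B := (D'.obj s').unop
  let l : A := E.obj b
  let η : b ⟶ U.obj (J.obj l) := unitApp adj.unit b
  let H := (prodPF D' (Pseudofunctor.id C)).comp (upperStar U)
  have := hτ (s', J.obj l)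
  -- The candidate universal element corresponds, under the factorization, to the component at `b`
  -- of the unit of `E ⊣ UJ`.
  let x : D.obj (s, J.obj l) := (τ.app (s', J.obj l)).toFunctor.objPreimage η
  let i : (τ.app (s', J.obj l)).toFunctor.obj x ≅ η :=
    (τ.app (s', J.obj l)).toFunctor.objObjPreimageIso η
  refine ⟨l, x, fun a => ?_⟩
  -- `D'` preserves the identity of `s'` only up to isomorphism, so `δ` is needed to compare with `f
  -- ↦ η ≫ UJ f`.
  let δ : (D'.map (𝟙 s')).unop ≅ 𝟙 b := (D'.mapId s').unop2
  let k (f : l ⟶ a) : ((s', J.obj l) : LocallyDiscrete (Discrete S) × C) ⟶ (s', J.obj a) :=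
    (𝟙 s', J.map f)
  let k₂ {f g : l ⟶ a} (α : f ⟶ g) : k f ⟶ k g := (𝟙 (𝟙 s'), J.map₂ α)
  let j : colElt (F := (prodPF (Pseudofunctor.id S) J).comp D) s x a ⋙
      (τ.app (s', J.obj a)).toFunctor ≅ precompMap (J.comp U) η a :=
    NatIso.ofComponents (fun f => natApp τ (k f) x ≪≫ (fn H (k f)).mapIso i ≪≫
      (whiskerRightIso δ (η ≫ U.map (J.map f)) ≪≫ λ_ _ : _)) (fun {f g} α => by
        have e₁ := natApp_map₂ τ (k₂ α) x
        have e₂ := fn₂_naturality H (k₂ α) i.hom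
        have e₃ : fn₂ H (k₂ α) η ≫ (δ.hom ▷ (η ≫ U.map (J.map g)) ≫ (λ_ _).hom) =
            (δ.hom ▷ (η ≫ U.map (J.map f)) ≫ (λ_ _).hom) ≫ η ◁ U.map₂ (J.map₂ α) := by
          change ((D'.map₂ (𝟙 (𝟙 s'))).unop2 ▷ (η ≫ U.map (J.map f)) ≫
            (D'.map (𝟙 s')).unop ◁ η ◁ U.map₂ (J.map₂ α)) ≫
              (δ.hom ▷ (η ≫ U.map (J.map g)) ≫ (λ_ _).hom) = _
          rw [D'.map₂_id]
          change (𝟙 (D'.map (𝟙 s')).unop ▷ (η ≫ U.map (J.map f)) ≫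
            (D'.map (𝟙 s')).unop ◁ η ◁ U.map₂ (J.map₂ α)) ≫
              (δ.hom ▷ (η ≫ U.map (J.map g)) ≫ (λ_ _).hom) = _
          rw [id_whiskerRight, Category.id_comp, whisker_exchange_assoc, leftUnitor_naturality,
            Category.assoc]
        exact comp_square₃ e₁ e₂ e₃)
  exact (isEquivalence_iff_of_iso j (hτ _)).2 (adj.isBiuniversal b a)

end Factorization

/-! ### Equivalences compatible with evaluation at elements -/

section Elementwise

variable {A : Type u₁} [Bicategory.{w, v} A] {E : Type u₂} [Bicategory.{w, v} E]

/-- A family of equivalences of categories `F a ≃ G a` that is compatible with the evaluation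
functors at elements. -/
structure ElementwiseEquiv (F G : A ⥤ᵖ Cat.{w, v}) where
  /-- The functors. -/
  app (a : A) : F.obj a ⥤ G.obj a
  isEquivalence (a : A) : (app a).IsEquivalence
  /-- The compatibility with evaluation. -/
  iso {l : A} (x : F.obj l) (a : A) : evalElt F x a ⋙ app a ≅ evalElt G ((app l).obj x) a

namespace ElementwiseEquiv

variable {F G H : A ⥤ᵖ Cat.{w, v}}

/-- A pseudonatural equivalence is an elementwise equivalence. -/
def ofTrans (τ : F ⟶ G) (h : ∀ x, (τ.app x).toFunctor.IsEquivalence) : ElementwiseEquiv F G where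
  app a := (τ.app a).toFunctor
  isEquivalence := h
  iso x a := evalEltIso τ x a

/-- The composition of elementwise equivalences. -/
def trans (e : ElementwiseEquiv F G) (e' : ElementwiseEquiv G H) : ElementwiseEquiv F H where
  app a := e.app a ⋙ e'.app a
  isEquivalence a :=
    have := e.isEquivalence a
    have := e'.isEquivalence a
    inferInstance
  iso x a := (Functor.associator _ _ _).symm ≪≫ Functor.isoWhiskerRight (e.iso x a) (e'.app a) ≪≫
    e'.iso _ a

/-- The restriction of an elementwise equivalence along a pseudofunctor. -/
def restrict {F G : E ⥤ᵖ Cat.{w, v}} (e : ElementwiseEquiv F G) (I : A ⥤ᵖ E) :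
    ElementwiseEquiv (I.comp F) (I.comp G) where
  app a := e.app (I.obj a)
  isEquivalence a := e.isEquivalence (I.obj a)
  iso x a := NatIso.ofComponents (fun f => (e.iso x (I.obj a)).app (I.map f))
    (fun α => (e.iso x (I.obj a)).hom.naturality (I.map₂ α))

theorem isUniversalElt_iff (e : ElementwiseEquiv F G) {l : A} (x : F.obj l) :
    IsUniversalElt F x ↔ IsUniversalElt G ((e.app l).obj x) :=
  forall_congr' fun a => isEquivalence_iff_of_iso (e.iso x a) (e.isEquivalence a)

/-- For the backward direction, an element of `G l` is replaced by the image of an element of `F l`.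
Universality survives because it is invariant under isomorphism of elements. -/
theorem exists_isUniversalElt_iff (e : ElementwiseEquiv F G) (l : A) :
    (∃ x : F.obj l, IsUniversalElt F x) ↔ ∃ x : G.obj l, IsUniversalElt G x :=
  ⟨fun ⟨x, hx⟩ => ⟨_, (e.isUniversalElt_iff x).1 hx⟩, fun ⟨x, hx⟩ =>
    have := e.isEquivalence l
    ⟨(e.app l).objPreimage x,
      (e.isUniversalElt_iff _).2 (hx.of_iso ((e.app l).objObjPreimageIso x).symm)⟩⟩

end ElementwiseEquiv

end Elementwise

/-! ### Invertible modifications from elementwise data -/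

section Modifications

variable {S : Type u₁} [Bicategory.{w₁, v₁} S] {F G H : S ⥤ᵖ Cat.{v, u}}

theorem natApp_trans (σ : F ⟶ G) (τ : G ⟶ H) {a b : S} (f : a ⟶ b) (x : F.obj a) :
    (natApp (σ ≫ τ) f x).hom = (τ.app b).toFunctor.map (natApp σ f x).hom ≫
      (natApp τ f ((σ.app a).toFunctor.obj x)).hom := by
  change 𝟙 _ ≫ (τ.app b).toFunctor.map (natApp σ f x).hom ≫ 𝟙 _ ≫
      (natApp τ f ((σ.app a).toFunctor.obj x)).hom ≫ 𝟙 _ = _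
  simp only [Category.id_comp, Category.comp_id]

/-- An invertible modification between composites of pseudonatural transformations of `Cat`-valued
pseudofunctors, from elementwise data. -/
def catModIso {K : S ⥤ᵖ Cat.{v, u}} {σ : F ⟶ G} {σ' : G ⟶ H} {τ : F ⟶ K} {τ' : K ⟶ H}
    (φ : ∀ a (x : F.obj a), (σ'.app a).toFunctor.obj ((σ.app a).toFunctor.obj x) ≅
      (τ'.app a).toFunctor.obj ((τ.app a).toFunctor.obj x))
    (nat : ∀ a {x y : F.obj a} (p : x ⟶ y),
      (σ'.app a).toFunctor.map ((σ.app a).toFunctor.map p) ≫ (φ a y).hom =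
        (φ a x).hom ≫ (τ'.app a).toFunctor.map ((τ.app a).toFunctor.map p))
    (mod : ∀ {a b : S} (f : a ⟶ b) (x : F.obj a),
      (φ b ((fn F f).obj x)).hom ≫ (τ'.app b).toFunctor.map (natApp τ f x).hom ≫
          (natApp τ' f ((τ.app a).toFunctor.obj x)).hom =
        (σ'.app b).toFunctor.map (natApp σ f x).hom ≫
          (natApp σ' f ((σ.app a).toFunctor.obj x)).hom ≫ (fn H f).map (φ a x).hom) :
    σ ≫ σ' ≅ τ ≫ τ' :=
  Pseudofunctor.StrongTrans.isoMk
    (fun a => Cat.Hom.isoMk (F := (σ.app a).toFunctor ⋙ (σ'.app a).toFunctor)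
      (G := (τ.app a).toFunctor ⋙ (τ'.app a).toFunctor)
      (NatIso.ofComponents (fun x => φ a x) (fun p => nat a p)))
    (fun {a b} f => by
      refine Cat.Hom₂.ext (NatTrans.ext (funext fun (x : F.obj a) => ?_))
      change (φ b ((fn F f).obj x)).hom ≫ (natApp (τ ≫ τ') f x).hom =
        (natApp (σ ≫ σ') f x).hom ≫ (fn H f).map (φ a x).hom
      rw [natApp_trans, natApp_trans]
      exact (mod f x).trans (Category.assoc _ _ _).symm)

end Modifications

/-! ### Elementwise equivalences between categories of weighted cones -/

section Weights

variable {S : Type v} [Bicategory.{v, v} S] {A : Type u₁} [Bicategory.{v, v} A]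
  {E : Type u₂} [Bicategory.{v, v} E] (W : S ⥤ᵖ Cat.{v, v})

/-- Elementwise equivalences between pseudofunctors of the form `[S, Cat](W, -)`. -/
def psHomEquiv {F : (S × E) ⥤ᵖ Cat.{v, v}} {G : (S × A) ⥤ᵖ Cat.{v, v}} (I : A ⥤ᵖ E)
    (π : ∀ a, (curryPF F).obj (I.obj a) ⟶ (curryPF G).obj a)
    (hπ : ∀ a s, ((π a).app s).toFunctor.IsEquivalence)
    (μ : ∀ {l a : A} (f : l ⟶ a),
      (curryPF F).map (I.map f) ≫ π a ≅ π l ≫ (curryPF G).map f)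
    (hμ : ∀ {l a : A} {f g : l ⟶ a} (α : f ⟶ g),
      (curryPF F).map₂ (I.map₂ α) ▷ π a ≫ (μ g).hom = (μ f).hom ≫ π l ◁ (curryPF G).map₂ α) :
    ElementwiseEquiv (I.comp (psHom W F)) (psHom W G) where
  app a := postcomp W (π a)
  isEquivalence a := postcomp_isEquivalence W (π a) (hπ a)
  iso {l} (x : W ⟶ (curryPF F).obj (I.obj l)) a := NatIso.ofComponents
    (fun f => α_ x ((curryPF F).map (I.map f)) (π a) ≪≫ whiskerLeftIso x (μ f) ≪≫
      (α_ x (π l) ((curryPF G).map f)).symm)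
    (fun {f g} α => by
      change (x ◁ (curryPF F).map₂ (I.map₂ α)) ▷ π a ≫ (α_ _ _ _).hom ≫ x ◁ (μ g).hom ≫
          (α_ _ _ _).inv =
        ((α_ _ _ _).hom ≫ x ◁ (μ f).hom ≫ (α_ _ _ _).inv) ≫ (x ≫ π l) ◁ (curryPF G).map₂ α
      rw [associator_naturality_middle_assoc, ← whiskerLeft_comp_assoc, hμ]
      simp)

end Weights

/-! ### Restricting a transformation to one value of the parameter -/

section SectionTrans

variable {S : Type u₁} [Bicategory.{w₁, v₁} S] {E : Type u₂} [Bicategory.{w₂, v₂} E]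
  {F G : (S × E) ⥤ᵖ Cat.{v, u}} (σ : F ⟶ G)

/-- The restriction of a pseudonatural transformation to `S × {e}`. -/
def sectTrans (e : E) : (curryPF F).obj e ⟶ (curryPF G).obj e :=
  catTrans (F := (sectPF S e).comp F) (G := (sectPF S e).comp G)
    (fun s => (σ.app (s, e)).toFunctor) (fun u x => natApp σ (inL u e) x)
    (fun u _ _ φ => natApp_naturality σ (inL u e) φ)
    (fun θ x => natApp_map₂ σ (inL₂ θ e) x)
    (fun s (x : F.obj (s, e)) => by
      change (natApp σ (𝟙 (s, e)) x).hom ≫ fn₂ G (𝟙 (𝟙 (s, e))) _ ≫ (fnId G (s, e) _).hom =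
        (σ.app (s, e)).toFunctor.map (fn₂ F (𝟙 (𝟙 (s, e))) x ≫ (fnId F (s, e) x).hom)
      rw [fn₂_id, fn₂_id, Category.id_comp, Category.id_comp, natApp_id])
    (fun {s t r} u v (x : F.obj (s, e)) => by
      change (natApp σ (inL (u ≫ v) e) x).hom ≫ fn₂ G (inLComp u v e).hom _ ≫
          (fnComp G (inL u e) (inL v e) _).hom =
        (σ.app (r, e)).toFunctor.map (fn₂ F (inLComp u v e).hom x ≫
            (fnComp F (inL u e) (inL v e) x).hom) ≫
          (natApp σ (inL v e) ((fn F (inL u e)).obj x)).hom ≫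
            (fn G (inL v e)).map (natApp σ (inL u e) x).hom
      rw [Functor.map_comp, Category.assoc]
      have e₁ := natApp_map₂ σ (inLComp u v e).hom x
      have e₂ := natApp_comp σ (inL u e) (inL v e) x
      rw [← e₂, ← reassoc_of% e₁])

/-- The compatibility of `sectTrans` with the functoriality in `e`. -/
def sectTransIso {e e' : E} (k : e ⟶ e') :
    (curryPF F).map k ≫ sectTrans σ e' ≅ sectTrans σ e ≫ (curryPF G).map k :=
  catModIso (fun s (x : F.obj (s, e)) => natApp σ (inR s k) x)
    (fun s _ _ φ => natApp_naturality σ (inR s k) φ)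
    (fun {s t} u (x : F.obj (s, e)) => by
      change (natApp σ (inR t k) ((fn F (inL u e)).obj x)).hom ≫
          (fn G (inR t k)).map (natApp σ (inL u e) x).hom ≫
          ((fnComp G (inL u e) (inR t k) _).inv ≫ fn₂ G (exch u k).hom _ ≫
            (fnComp G (inR s k) (inL u e') _).hom) =
        (σ.app (t, e')).toFunctor.map ((fnComp F (inL u e) (inR t k) x).inv ≫
          fn₂ F (exch u k).hom x ≫ (fnComp F (inR s k) (inL u e') x).hom) ≫
          (natApp σ (inL u e') ((fn F (inR s k)).obj x)).hom ≫
          (fn G (inL u e')).map (natApp σ (inR s k) x).hom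
      have e₁ := natApp_map₂ σ (exch u k).hom x
      have e₂ := natApp_comp σ (inL u e) (inR t k) x
      have e₃ := natApp_comp σ (inR s k) (inL u e') x
      rw [← cancel_epi ((σ.app (t, e')).toFunctor.map (fnComp F (inL u e) (inR t k) x).hom),
        ← reassoc_of% e₂]
      simp only [Functor.map_comp, Category.assoc, Iso.hom_inv_id_assoc]
      rw [← e₃, reassoc_of% e₁, ← Functor.map_comp_assoc, Iso.hom_inv_id,
        CategoryTheory.Functor.map_id, Category.id_comp])

end SectionTrans

/-! ### Base change of the parameter along a pseudofunctor -/

section BaseChange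

variable {S : Type u₁} [Bicategory.{w₁, v₁} S] {E : Type u₂} [Bicategory.{w₂, v₂} E]
  {A : Type u₃} [Bicategory.{w₃, v₃} A] (J : A ⥤ᵖ E) (F : (S × E) ⥤ᵖ Cat.{v, u})

/-- `(u, 𝟙) ≅ (u, J 𝟙)`. -/
def inLMapId {s t : S} (u : s ⟶ t) (a : A) : inL u (J.obj a) ≅ (u, J.map (𝟙 a)) :=
  Iso.prod (Iso.refl u) (J.mapId a).symm

/-- The 1-cell `(u, f)` of a product. -/
abbrev pairHom {s t : S} (u : s ⟶ t) {e e' : E} (k : e ⟶ e') : (s, e) ⟶ (t, e') := (u, k)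

/-- `(u ≫ v, J (f ≫ g)) ≅ (u, J f) ≫ (v, J g)`. -/
def pairMapComp {s t r : S} (u : s ⟶ t) (v : t ⟶ r) {a b c : A} (f : a ⟶ b) (g : b ⟶ c) :
    pairHom (u ≫ v) (J.map (f ≫ g)) ≅ pairHom u (J.map f) ≫ pairHom v (J.map g) :=
  Iso.prod (Iso.refl _) (J.mapComp f g)

/-- The comparison of `F(-, J a)` with the restriction of `F ∘ (1 × J)` to `S × {a}`. -/
def baseChange (a : A) :
    (curryPF F).obj (J.obj a) ⟶ (curryPF ((prodPF (Pseudofunctor.id S) J).comp F)).obj a :=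
  catTrans (F := (sectPF S (J.obj a)).comp F)
    (G := (sectPF S a).comp ((prodPF (Pseudofunctor.id S) J).comp F))
    -- Both pseudofunctors agree on objects. They differ on 1-cells, by `(u, 𝟙)` against `(u, J 𝟙)`,
    -- so the unit constraint of `J` is the whole content of the comparison.
    (fun s => 𝟭 (F.obj (s, J.obj a))) (fun u x => fn₂Iso F (inLMapId J u a) x)
    (fun u x y φ => fn₂_naturality F (inLMapId J u a).hom φ)
    (fun {s t u u'} θ (x : F.obj (s, J.obj a)) => by
      change fn₂ F (inL₂ θ (J.obj a)) x ≫ fn₂ F (inLMapId J u' a).hom x =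
        fn₂ F (inLMapId J u a).hom x ≫ fn₂ F (θ, J.map₂ (𝟙 (𝟙 a))) x
      rw [← fn₂_comp, ← fn₂_comp]
      refine congrArg (fn₂ F · x) (Prod.ext ?_ ?_) <;> simp [inLMapId])
    (fun s (x : F.obj (s, J.obj a)) => by
      change fn₂ F (inLMapId J (𝟙 s) a).hom x ≫
          fn₂ F ((𝟙 (𝟙 s), J.map₂ (𝟙 (𝟙 a))) : (𝟙 s, J.map (𝟙 a)) ⟶ (𝟙 s, J.map (𝟙 a))) x ≫
          fn₂ F ((𝟙 (𝟙 s), (J.mapId a).hom) : (𝟙 s, J.map (𝟙 a)) ⟶ 𝟙 (s, J.obj a)) x ≫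
          (fnId F (s, J.obj a) x).hom =
        fn₂ F (𝟙 (𝟙 (s, J.obj a))) x ≫ (fnId F (s, J.obj a) x).hom
      rw [← reassoc_of% @fn₂_comp, ← reassoc_of% @fn₂_comp]
      have e : ((inLMapId J (𝟙 s) a).hom ≫
          ((𝟙 (𝟙 s), J.map₂ (𝟙 (𝟙 a))) : (𝟙 s, J.map (𝟙 a)) ⟶ (𝟙 s, J.map (𝟙 a)))) ≫
          ((𝟙 (𝟙 s), (J.mapId a).hom) : (𝟙 s, J.map (𝟙 a)) ⟶ 𝟙 (s, J.obj a)) = 𝟙 _ := by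
        refine Prod.ext ?_ ?_ <;> simp [inLMapId]
      exact congrArg (fun α => fn₂ F α x ≫ (fnId F (s, J.obj a) x).hom) e)
    (fun {s t r} u v (x : F.obj (s, J.obj a)) => by
      change fn₂ F (inLMapId J (u ≫ v) a).hom x ≫
          fn₂ F ((𝟙 (u ≫ v), J.map₂ (λ_ (𝟙 a)).inv) :
            (u ≫ v, J.map (𝟙 a)) ⟶ (u ≫ v, J.map (𝟙 a ≫ 𝟙 a))) x ≫
          fn₂ F (pairMapComp J u v (𝟙 a) (𝟙 a)).hom x ≫
          (fnComp F ((u, J.map (𝟙 a)) : (s, J.obj a) ⟶ (t, J.obj a))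
            ((v, J.map (𝟙 a)) : (t, J.obj a) ⟶ (r, J.obj a)) x).hom =
        (fn₂ F (inLComp u v (J.obj a)).hom x ≫
            (fnComp F (inL u (J.obj a)) (inL v (J.obj a)) x).hom) ≫
          fn₂ F (inLMapId J v a).hom ((fn F (inL u (J.obj a))).obj x) ≫
          (fn F ((v, J.map (𝟙 a)) : (t, J.obj a) ⟶ (r, J.obj a))).map
            (fn₂ F (inLMapId J u a).hom x)
      rw [Category.assoc, ← reassoc_of% @fnComp_whiskerLeft, ← fnComp_whiskerRight]
      simp only [← reassoc_of% @fn₂_comp]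
      have e : J.map₂ (λ_ (𝟙 a)).inv ≫ (J.mapComp (𝟙 a) (𝟙 a)).hom =
          (λ_ (J.map (𝟙 a))).inv ≫ (J.mapId a).inv ▷ J.map (𝟙 a) := by
        rw [← cancel_epi (J.map₂ (λ_ (𝟙 a)).hom), ← J.map₂_comp_assoc, Iso.hom_inv_id,
          J.map₂_id, J.map₂_left_unitor]
        simp
      refine congrArg (· ≫ _) (congrArg (fn₂ F · x) (Prod.ext ?_ ?_))
      · simp [inLMapId, inLComp, pairMapComp]
      · simpa [inLMapId, inLComp, pairMapComp] using e)

/-- The compatibility of `baseChange` with the functoriality in `a`. -/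
def baseChangeIso {a b : A} (f : a ⟶ b) :
    (curryPF F).map (J.map f) ≫ baseChange J F b ≅
      baseChange J F a ≫ (curryPF ((prodPF (Pseudofunctor.id S) J).comp F)).map f :=
  catModIso (fun s (x : F.obj (s, J.obj a)) => Iso.refl ((fn F (inR s (J.map f))).obj x))
    (fun s x y φ => (Category.comp_id _).trans (Category.id_comp _).symm)
    (fun {s t} u (x : F.obj (s, J.obj a)) => by
      change 𝟙 _ ≫ (fn F (inR t (J.map f))).map (fn₂ F (inLMapId J u a).hom x) ≫
          ((fnComp F ((u, J.map (𝟙 a)) : (s, J.obj a) ⟶ (t, J.obj a)) (inR t (J.map f)) x).inv ≫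
            fn₂ F (pairMapComp J u (𝟙 t) (𝟙 a) f).inv x) ≫
          fn₂ F (((exch u f).hom.1, J.map₂ (exch u f).hom.2) :
            (u ≫ 𝟙 t, J.map (𝟙 a ≫ f)) ⟶ (𝟙 s ≫ u, J.map (f ≫ 𝟙 b))) x ≫
          fn₂ F (pairMapComp J (𝟙 s) u f (𝟙 b)).hom x ≫
          (fnComp F (inR s (J.map f)) ((u, J.map (𝟙 b)) : (s, J.obj b) ⟶ (t, J.obj b)) x).hom =
        ((fnComp F (inL u (J.obj a)) (inR t (J.map f)) x).inv ≫
          fn₂ F (exch u (J.map f)).hom x ≫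
            (fnComp F (inR s (J.map f)) (inL u (J.obj b)) x).hom) ≫
          fn₂ F (inLMapId J u b).hom ((fn F (inR s (J.map f))).obj x) ≫
          (fn F ((u, J.map (𝟙 b)) : (s, J.obj b) ⟶ (t, J.obj b))).map (𝟙 _)
      rw [← cancel_epi (fnComp F (inL u (J.obj a)) (inR t (J.map f)) x).hom, Category.id_comp,
        ← reassoc_of% @fnComp_whiskerRight, CategoryTheory.Functor.map_id, Category.comp_id]
      simp only [Category.assoc, Iso.hom_inv_id_assoc]
      rw [← fnComp_whiskerLeft]
      simp only [← reassoc_of% @fn₂_comp]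
      refine congrArg (· ≫ _) (congrArg (fn₂ F · x) (Prod.ext ?_ ?_)) <;>
        simp [inLMapId, exch, pairMapComp, map₂_ρ_inv])

end BaseChange

/-! ### Invariance of weighted cones under equivalence and base change -/

section Weights

variable {S : Type v} [Bicategory.{v, v} S] {A : Type u₁} [Bicategory.{v, v} A]
  {E : Type u₂} [Bicategory.{v, v} E] (W : S ⥤ᵖ Cat.{v, v})

/-- The pseudofunctor `[S, Cat](W, -)` preserves pseudonatural equivalences, elementwise. -/
def psHomEquivOfTrans {F G : (S × E) ⥤ᵖ Cat.{v, v}} (σ : F ⟶ G)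
    (h : ∀ x, (σ.app x).toFunctor.IsEquivalence) :
    ElementwiseEquiv (psHom W F) (psHom W G) :=
  let e := psHomEquiv W (Pseudofunctor.id E) (sectTrans σ) (fun e s => h (s, e)) (sectTransIso σ)
    (fun {l a f g} α => by
      refine Pseudofunctor.StrongTrans.homCategory.ext fun s => ?_
      -- The constraints of `sectTransIso` are those of `σ` at `(𝟙, f)`, so compatibility with `α`
      -- is naturality of `σ` at the 2-cell `(𝟙, α)`.
      exact Cat.Hom₂.ext (NatTrans.ext (funext fun x => natApp_map₂ σ (inR₂ s α) x)))
  -- Composing with `Pseudofunctor.id E` leaves the actions on objects, 1-cells and 2-cells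
  -- unchanged up to unfolding. Evaluation functors see nothing else, so the fields carry over.
  { app := e.app
    isEquivalence := e.isEquivalence
    iso := e.iso }

/-- The pseudofunctor `[S, Cat](W, -)` is compatible with base change, elementwise. -/
def psHomEquivBaseChange (J : A ⥤ᵖ E) (F : (S × E) ⥤ᵖ Cat.{v, v}) :
    ElementwiseEquiv (J.comp (psHom W F))
      (psHom W ((prodPF (Pseudofunctor.id S) J).comp F)) :=
  psHomEquiv W J (baseChange J F)
    (fun a s => inferInstanceAs (𝟭 (F.obj (s, J.obj a))).IsEquivalence)
    (baseChangeIso J F)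
    (fun {l a f g} α => by
      refine Pseudofunctor.StrongTrans.homCategory.ext fun s => ?_
      refine Cat.Hom₂.ext (NatTrans.ext (funext fun (x : F.obj (s, J.obj l)) => ?_))
      exact (Category.comp_id _).trans (Category.id_comp _).symm)

end Weights

/-! ### Evaluation at the terminal category -/

section Evaluation

/-- The terminal category. -/
abbrev pt : Cat.{v, v} := Cat.of (Discrete PUnit.{v + 1})

/-- The pseudofunctor `e ↦ (c, e)`. -/
def constLeft {X : Type u₁} [Bicategory.{w₁, v₁} X] (c : X) (E : Type u₂)
    [Bicategory.{w₂, v₂} E] : E ⥤ᵖ (X × E) where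
  obj e := (c, e)
  map f := (𝟙 c, f)
  map₂ α := (𝟙 (𝟙 c), α)
  mapId _ := Iso.refl _
  mapComp f g := Iso.prod (λ_ (𝟙 c)).symm (Iso.refl (f ≫ g))

/-- The evaluation functor from `Cat(1, X)` to `X`. -/
def evalPt (X : Cat.{v, v}) : (pt.{v} ⟶ X) ⥤ X where
  obj z := z.toFunctor.obj ⟨PUnit.unit⟩
  map α := α.toNatTrans.app ⟨PUnit.unit⟩

theorem evalPt_isEquivalence (X : Cat.{v, v}) : (evalPt X).IsEquivalence where
  faithful := ⟨fun {z z'} α β e => by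
    refine Cat.Hom₂.ext (NatTrans.ext (funext ?_))
    rintro ⟨⟨⟩⟩
    exact e⟩
  full := ⟨fun {z z'} p => ⟨⟨Discrete.natTrans (fun ⟨⟨⟩⟩ => p)⟩, rfl⟩⟩
  essSurj := ⟨fun x => ⟨(Functor.fromPUnit x).toCatHom, ⟨Iso.refl _⟩⟩⟩

variable {E : Type u₁} [Bicategory.{v, v} E]

/-- The pseudonatural transformation `Cat(1, P -) ⟶ P`. -/
def evalPtTrans (P : E ⥤ᵖ Cat.{v, v}) :
    (constLeft (op pt.{v}) E).comp ((prodPF (Pseudofunctor.id Cat.{v, v}ᵒᵖ) P).comp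
      (homPF Cat.{v, v})) ⟶ P :=
  catTrans (fun e => evalPt (P.obj e))
    (fun {a b} f (z : pt ⟶ P.obj a) => Iso.refl ((fn P f).obj (z.toFunctor.obj ⟨PUnit.unit⟩)))
    (fun {a b} f z z' α => (Category.comp_id _).trans (Category.id_comp _).symm)
    (fun {a b f g} θ (z : pt ⟶ P.obj a) => by
      let z₀ := z.toFunctor.obj ⟨PUnit.unit⟩
      -- The contravariant slot of `homPF` is held constant, but its identity 2-cell still
      -- contributes the image under `z` of the identity of the point. Naming it `i` lets the
      -- simplifier erase it.
      let i : z₀ ⟶ z₀ := z.toFunctor.map (𝟙 _)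
      have e : i = 𝟙 z₀ := z.toFunctor.map_id _
      change ((fn P f).map i ≫ fn₂ P θ z₀) ≫ 𝟙 _ = 𝟙 _ ≫ fn₂ P θ z₀
      simp only [e, CategoryTheory.Functor.map_id, Category.id_comp, Category.comp_id])
    (fun a (z : pt ⟶ P.obj a) => by
      let z₀ := z.toFunctor.obj ⟨PUnit.unit⟩
      let i : z₀ ⟶ z₀ := z.toFunctor.map (𝟙 _)
      have e : i = 𝟙 z₀ := z.toFunctor.map_id _
      change 𝟙 _ ≫ (fnId P a z₀).hom =
        ((fn P (𝟙 a)).map i ≫ fn₂ P (𝟙 (𝟙 a)) z₀) ≫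
          ((fn P (𝟙 a)).map i ≫ (fnId P a z₀).hom) ≫ 𝟙 _ ≫ 𝟙 _
      simp only [e, fn₂_id, CategoryTheory.Functor.map_id, Category.id_comp, Category.comp_id])
    (fun {a b c} f g (z : pt ⟶ P.obj a) => by
      let z₀ := z.toFunctor.obj ⟨PUnit.unit⟩
      let i : z₀ ⟶ z₀ := z.toFunctor.map (𝟙 _)
      have e : i = 𝟙 z₀ := z.toFunctor.map_id _
      change 𝟙 _ ≫ (fnComp P f g z₀).hom =
        (((fn P (f ≫ g)).map i ≫ fn₂ P (𝟙 (f ≫ g)) z₀) ≫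
          ((fn P (f ≫ g)).map i ≫ (fnComp P f g z₀).hom) ≫
            𝟙 _ ≫ 𝟙 _ ≫ 𝟙 _) ≫ 𝟙 _ ≫ (fn P g).map (𝟙 _)
      simp only [e, fn₂_id, CategoryTheory.Functor.map_id, Category.id_comp, Category.comp_id])

/-- The pseudonatural transformation `Cat(1, D(-, -)) ⟶ D`. -/
def evalPtTrans₂ {S : Type v} [Bicategory.{v, v} S] (D : (S × E) ⥤ᵖ Cat.{v, v}) :
    (prodPF (Pseudofunctor.id S) (constLeft (op pt.{v}) E)).comp (homInto D) ⟶ D :=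
  catTrans (fun p => evalPt (D.obj p))
    (fun {a b} f (z : pt ⟶ D.obj a) => Iso.refl ((fn D f).obj (z.toFunctor.obj ⟨PUnit.unit⟩)))
    (fun {a b} f z z' α => (Category.comp_id _).trans (Category.id_comp _).symm)
    (fun {a b f g} θ (z : pt ⟶ D.obj a) => by
      let z₀ := z.toFunctor.obj ⟨PUnit.unit⟩
      let i : z₀ ⟶ z₀ := z.toFunctor.map (𝟙 _)
      have e : i = 𝟙 z₀ := z.toFunctor.map_id _
      change ((fn D f).map i ≫ fn₂ D θ z₀) ≫ 𝟙 _ = 𝟙 _ ≫ fn₂ D θ z₀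
      simp only [e, CategoryTheory.Functor.map_id, Category.id_comp, Category.comp_id])
    (fun a (z : pt ⟶ D.obj a) => by
      let z₀ := z.toFunctor.obj ⟨PUnit.unit⟩
      let i : z₀ ⟶ z₀ := z.toFunctor.map (𝟙 _)
      have e : i = 𝟙 z₀ := z.toFunctor.map_id _
      change 𝟙 _ ≫ (fnId D a z₀).hom =
        ((fn D (𝟙 a)).map i ≫ fn₂ D (𝟙 (𝟙 a)) z₀) ≫
          ((fn D (𝟙 a)).map i ≫ fn₂ D (𝟙 (𝟙 a)) z₀) ≫
          ((fn D (𝟙 a)).map i ≫ (fnId D a z₀).hom) ≫ 𝟙 _ ≫ 𝟙 _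
      simp only [e, fn₂_id, CategoryTheory.Functor.map_id, Category.id_comp, Category.comp_id])
    (fun {a b c} f g (z : pt ⟶ D.obj a) => by
      let z₀ := z.toFunctor.obj ⟨PUnit.unit⟩
      let i : z₀ ⟶ z₀ := z.toFunctor.map (𝟙 _)
      have e : i = 𝟙 z₀ := z.toFunctor.map_id _
      change 𝟙 _ ≫ (fnComp D f g z₀).hom =
        (((fn D (f ≫ g)).map i ≫ fn₂ D (𝟙 (f ≫ g)) z₀) ≫
          ((fn D (f ≫ g)).map i ≫ fn₂ D (𝟙 (f ≫ g)) z₀) ≫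
          ((fn D (f ≫ g)).map i ≫ (fnComp D f g z₀).hom) ≫
            𝟙 _ ≫ 𝟙 _ ≫ 𝟙 _) ≫ 𝟙 _ ≫ (fn D g).map (𝟙 _)
      simp only [e, fn₂_id, CategoryTheory.Functor.map_id, Category.id_comp, Category.comp_id])

end Evaluation

/-! ### Weighted bicolimits as biuniversal arrows -/

section Bicolimits

variable {S : Type v} [Bicategory.{v, v} S] {A : Type u₁} [Bicategory.{v, v} A]
  {C : Type u₃} [Bicategory.{v, v} C] {C' : Type u₄} [Bicategory.{v, v} C']

/-- A weighted bilimit gives an elementwise equivalence on points. -/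
theorem IsWeightedBilimit.exists_isUniversalElt_iff {W : S ⥤ᵖ Cat.{v, v}}
    {D : (S × C') ⥤ᵖ Cat.{v, v}} {P : C' ⥤ᵖ Cat.{v, v}} (h : IsWeightedBilimit W D P)
    (J : A ⥤ᵖ C') (l : A) :
    (∃ x : (J.comp P).obj l, IsUniversalElt (J.comp P) x) ↔
      ∃ x : (psHom W ((prodPF (Pseudofunctor.id S) J).comp D)).obj l,
        IsUniversalElt (psHom W ((prodPF (Pseudofunctor.id S) J).comp D)) x := by
  obtain ⟨τ, hτ⟩ := h
  -- Specializing the bilimit equivalence to `X = 1` turns `Cat(1, P -)` into `P` and the cones into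
  -- `Cat(1, D)` into cones into `D`.
  let K := constLeft (op pt.{v}) C'
  let e₁ := ElementwiseEquiv.ofTrans (evalPtTrans P) fun a => evalPt_isEquivalence (P.obj a)
  let e₂ := (((ElementwiseEquiv.ofTrans τ hτ).restrict K).trans
    (psHomEquivBaseChange W K (homInto D))).trans
    (psHomEquivOfTrans W (evalPtTrans₂ D) fun p => evalPt_isEquivalence (D.obj p))
  exact ((e₁.restrict J).exists_isUniversalElt_iff l).symm.trans
    (((e₂.restrict J).trans (psHomEquivBaseChange W J D)).exists_isUniversalElt_iff l)

/-- The weighted bicolimit is the value of a left biadjoint of `V ∘ J` at `y`. -/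
theorem exists_isBiuniversal_iff {W : S ⥤ᵖ Cat.{v, v}} {J : A ⥤ᵖ C'} {V : C' ⥤ᵖ C} {y : C}
    {D : (S × C') ⥤ᵖ Cat.{v, v}} (h : IsWeightedBilimit W D (V.comp (homFrom y)))
    {𝒜 : Sᵒᵖ ⥤ᵖ A}
    (h𝒜 : PseudonaturalEquiv ((prodPF (Pseudofunctor.id S) J).comp D) (homOut 𝒜)) (l : A) :
    (∃ g : y ⟶ (J.comp V).obj l, IsBiuniversal (J.comp V) g) ↔ IsWeightedBicolimit W 𝒜 l := by
  obtain ⟨σ, hσ⟩ := h𝒜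
  -- An element of `C(y, VJ l)` is a 1-cell `y ⟶ VJ l`, and its universality unfolds to
  -- biuniversality. The last equivalence is Yoneda for `psHom W (homOut 𝒜)`.
  exact (h.exists_isUniversalElt_iff J l).trans
    (((psHomEquivOfTrans W σ hσ).exists_isUniversalElt_iff l).trans
      (pseudonaturalEquiv_homFrom_iff l).symm)

end Bicolimits

end BiTri

/-! ### The biadjoint triangle -/

theorem mainTheorem4
    {S : Type v} [Bicategory.{v, v} S] [Bicategory.Strict S]
    {A : Type u₁} [Bicategory.{v, v} A] [Bicategory.Strict A]
    {B : Type u₂} [Bicategory.{v, v} B] [Bicategory.Strict B]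
    {C : Type u₃} [Bicategory.{v, v} C] [Bicategory.Strict C]
    {C' : Type u₄} [Bicategory.{v, v} C'] [Bicategory.Strict C']
    (W : S ⥤ᵖ Cat.{v, v})
    (R : A ⥤ᵖ B) (hR : IsRightBiadjoint R)
    (J : A ⥤ᵖ C') (U : C' ⥤ᵖ B) (hJ : J.comp U = R)
    (V : C' ⥤ᵖ C)
    (𝒟 : C → ((S × C') ⥤ᵖ Cat.{v, v}))
    (hfac : ∀ y : C, FactorsThroughStar U (𝒟 y))
    (hlim : ∀ y : C, IsWeightedBilimit W (𝒟 y) (V.comp (homFrom y))) :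
    (∀ y : C, ∃ 𝒜 : Sᵒᵖ ⥤ᵖ A,
      PseudonaturalEquiv ((prodPF (Pseudofunctor.id S) J).comp (𝒟 y)) (homOut 𝒜)) ∧
    ∀ 𝒜 : C → (Sᵒᵖ ⥤ᵖ A),
      (∀ y : C,
        PseudonaturalEquiv ((prodPF (Pseudofunctor.id S) J).comp (𝒟 y)) (homOut (𝒜 y))) →
      (IsRightBiadjoint (J.comp V) ↔ ∀ y : C, ∃ L : A, IsWeightedBicolimit W (𝒜 y) L) ∧
      ∀ L : C → A, (∀ y : C, IsWeightedBicolimit W (𝒜 y) (L y)) →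
        ∃ G : C ⥤ᵖ A, (∀ y : C, G.obj y = L y) ∧ Nonempty (Biadjunction G (J.comp V)) := by
  -- The statement with prescribed bicolimits comes first, since it also yields the "if" half of the
  -- equivalence once bicolimits are chosen.
  have h𝒟 : ∀ {𝒜 : C → (Sᵒᵖ ⥤ᵖ A)}, (∀ y : C,
      PseudonaturalEquiv ((prodPF (Pseudofunctor.id S) J).comp (𝒟 y)) (homOut (𝒜 y))) →
      ∀ L : C → A, (∀ y : C, IsWeightedBicolimit W (𝒜 y) (L y)) →
        ∃ G : C ⥤ᵖ A, (∀ y : C, G.obj y = L y) ∧ Nonempty (Biadjunction G (J.comp V)) := by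
    intro 𝒜 h𝒜 L hL
    choose η hη using fun y => (exists_isBiuniversal_iff (hlim y) (h𝒜 y) (L y)).2 (hL y)
    exact exists_biadjunction L η hη
  refine ⟨fun y => ?_, fun 𝒜 h𝒜 => ⟨⟨?_, fun h => ?_⟩, h𝒟 h𝒜⟩⟩
  · subst hJ
    exact exists_pseudonaturalEquiv_homOut _ (exists_colElt_isEquivalence J U (𝒟 y) (hfac y) hR)
  · rintro ⟨G, ⟨adj⟩⟩ y
    -- The unit of any left biadjoint `G` at `y` is biuniversal, so `G y` is itself a bicolimit.
    exact ⟨G.obj y, (exists_isBiuniversal_iff (hlim y) (h𝒜 y) (G.obj y)).1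
      ⟨_, adj.isBiuniversal y⟩⟩
  · choose L hL using h
    obtain ⟨G, -, adj⟩ := h𝒟 h𝒜 L hL
    exact ⟨G, adj⟩
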